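/- \textbf{Efficiency of the bias-corrected doubly robust estimator of Liu et al. (2019).} Clusters $i=1,2,\dots$ are independent and identically distributed. Cluster $i$ has a type $L_i\in\{1,\dots,K\}$ with $p_k=\mathrm{pr}(L_i=k)>0$; if $L_i=k$ it has $M_k$ units, outcomes $Y_i\in\mathbb{R}^{M_k}$, treatments $A_i\in\{0,1\}^{M_k}$, covariates $X_i$ and potential outcomes $Y_i(a)\in\mathbb{R}^{M_k}$, $a\in\{0,1\}^{M_k}$. Let $O_i=(Y_i,A_i,X_i)$, and let $e(a\mid x,k)=\mathrm{pr}(A_i=a\mid X_i=x,L_i=k)$, $g(a,x,k)=E(Y_i\mid A_i=a,X_i=x,L_i=k)$, $\Sigma(a,x,k)=\mathrm{var}(Y_i\mid A_i=a,X_i=x,L_i=k)$. Assume, for all $k$, all $a$ and almost all $x$: (A1) $Y_i=Y_i(A_i)$; (A2) $Y_i(a)$ and $A_i$ are independent given $X_i$, $L_i=k$; (A3) $c<e(a\mid x,k)<1-c$ for a constant $c>0$; (A4) $E\{g(a,X_i,k)\mid L_i=k\}$ and $E\{\Sigma(a,X_i,k)\mid L_i=k\}$ exist and are finite, and $\Sigma(a,x,k)$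 is positive definite. For $\alpha\in(0,1)$ put $\pi(b;\alpha)=\prod_l \alpha^{b_l}(1-\alpha)^{1-b_l}$ and $\overline Y_i(t;\alpha)=M_k^{-1}\sum_{j}\sum_{a:\,a_j=t}Y_{ij}(a)\,\pi(a_{(-j)};\alpha)$, where $a_{(-j)}$ is $a$ without its $j$th entry. The direct and indirect effects are $\tau^{\rm DE}(\alpha)=E\{\overline Y_i(1;\alpha)-\overline Y_i(0;\alpha)\}$ and $\tau^{\rm IE}(\alpha,\alpha')=E\{\overline Y_i(0;\alpha)-\overline Y_i(0;\alpha')\}$. Both have the form $\tau=\sum_k v_k(p_k)\theta_k$ with $v_k(p)=p$, $\theta_k=\sum_a E\{w_k(a)^{\rm T}g(a,X_i,k)\mid L_i=k\}$, where $w_k(a)$ has $j$th entry $M_k^{-1}\{1(a_j=1)-1(a_j=0)\}\pi(a_{(-j)};\alpha)$ for the direct effect and $M_k^{-1}1(a_j=0)\{\pi(a_{(-j)};\alpha)-\pi(a_{(-j)};\alpha')\}$ for the indirect effect. Let $e(a\mid x,k;\beta_e)$, $\beta_e\in B_e$, and $g(a,x,k;\beta_g)$, $\beta_g\in B_g$,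 be parametric models, both correctly specified: there are unique true values $\beta_e^*\in B_e$ and $\beta_g^*\in B_g$ at which they equal $e$ and $g$ (the models $\mathcal M_e$ and $\mathcal M_g$). Let $\hat\beta=(\hat\beta_e,\hat\beta_g)$ solve, with probability tending to one, an estimating equation $0=\sum_{i\le N}\Psi_\beta(O_i,L_i;\hat\beta)$ with $E\{\Psi_\beta(\beta^*)\}=0$, and let $\hat\beta$ have the probability limit $\beta^\dagger$. Put $$\phi_k(O_i;\beta)=\frac{w_k(A_i)^{\rm T}\{Y_i-g(A_i,X_i,k;\beta_g)\}}{e(A_i\mid X_i,k;\beta_e)}+\sum_a w_k(a)^{\rm T}g(a,X_i,k;\beta_g),$$ $\Psi_{\theta,k}(\theta,\beta)=1(L_i=k)\{\phi_k(O_i;\beta)-\theta_k\}$, $\Psi=(\Psi_\theta,\Psi_\beta)$. The plug-in estimator is $\hat\tau=\sum_k v_k(N_k/N)\hat\theta_k$, with $N_k$ the number of clusters of type $k$ among the first $N$ and $\hat\theta$ a solution of $0=\sum_{i\le N}\Psi_\theta(\hat\theta,\hat\beta)$. The estimator of Liu et al. with estimated propensity score $\hat f$ and outcome regressions $\hat m_j$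 is $\widehat{\rm DE}(\alpha)=N^{-1}\sum_{i\le N}\{\hat Y_i(1,\alpha)-\hat Y_i(0,\alpha)\}$ and $\widehat{\rm IE}(\alpha,\alpha')=N^{-1}\sum_{i\le N}\{\hat Y_i(0,\alpha)-\hat Y_i(0,\alpha')\}$, where, with $n_i$ the size of cluster $i$, $$\hat Y_i(t,\alpha)=\frac1{n_i}\sum_{j=1}^{n_i}\Big[\frac{1(A_{ij}=t)}{\hat f(A_i\mid X_i)}\{Y_{ij}-\hat m_{j}(A_i,X_i)\}\pi(A_{i(-j)};\alpha)+\sum_{b\in\{0,1\}^{n_i-1}}\hat m_{j}(t,b,X_i)\,\pi(b;\alpha)\Big].$$ Suppose that $\hat f=e(\cdot;\hat\beta_e)$ and $\hat m_j=g_j(\cdot;\hat\beta_g)$ on clusters of each type. Then: (a) for every sample, $\widehat{\rm DE}(\alpha)$ and $\widehat{\rm IE}(\alpha,\alpha')$ equal the plug-in estimators $\hat\tau$ of $\tau^{\rm DE}(\alpha)$ and $\tau^{\rm IE}(\alpha,\alpha')$; (b) each of the two estimators is locally efficient under $\mathcal M_e\cap\mathcal M_g$, provided that $\Psi$, with the corresponding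 weights, satisfies the following conditions, in which $\theta^*$ is the true $\theta$: (R1) $(\theta,\beta_e,\beta_g)$ ranges over a bounded open product set $\Theta\times B_e\times B_g$, which contains $(\theta^*,\beta^\dagger)$; (R2) $\Psi$ is twice continuously differentiable in $(\theta,\beta)$; (R3) $(\theta^*,\beta^\dagger)$ is the unique zero of $E\{\Psi(\theta,\beta)\}$, $E\|\Psi(\theta^*,\beta^\dagger)\|^2<\infty$, and $E\{\partial\Psi(\theta^*,\beta^\dagger)/\partial(\theta,\beta)\}$ exists and is nonsingular; (R4) the second partial derivatives of $\Psi$ are dominated by a fixed integrable function near $(\theta^*,\beta^\dagger)$. Locally efficient means that $N^{1/2}(\hat\tau-\tau)=N^{-1/2}\sum_{i\le N}\varphi(O_i,L_i)+o_P(1)$, where $\varphi$ is the efficient influence function of $\tau$ in the nonparametric model of all laws of $(O_i,L_i)$: $\varphi$ has mean zero and finite variance, $\partial\tau(\eta)/\partial\eta=E(\varphi s)$ at the truth for every regular parametric submodel with score $s$, and $\varphi$ lies in the mean-square closure of the linear combinations of such scores. (A regular submodel is differentiable in quadratic mean at the truth with nonsingular information, and has a likelihood ratio bounded away from $0$ and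 $\infty$ near the truth.) -/

import Mathlib

open MeasureTheory ProbabilityTheory Filter Topology Asymptotics

noncomputable section

namespace PartialInterference

/-! ### Clusters, cluster types and laws -/

/-- Outcome vectors of a cluster with `n` units. -/
abbrev Out (n : ℕ) : Type := Fin n → ℝ

/-- Treatment vectors of a cluster with `n` units (`true` is treated, `false` is control). -/
abbrev Trt (n : ℕ) : Type := Fin n → Bool

/-- Covariates of a cluster with `n` units, `d` covariates for each unit. -/
abbrev Cov (n d : ℕ) : Type := Fin n → Fin d → ℝ

/-- Observed data `(Y, A, X)` of one cluster. -/
abbrev Cluster (n d : ℕ) : Type := Out n × Trt n × Cov n d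

/-- Potential outcomes `(Y(a))_a` of one cluster, with its observed data `(Y, A, X)`. -/
abbrev FullCluster (n d : ℕ) : Type := (Trt n → Out n) × Cluster n d

instance instStandardBorelFullCluster (n d : ℕ) : StandardBorelSpace (FullCluster n d) := by
  have h1 : StandardBorelSpace (Trt n → Out n) := inferInstance
  have h2 : StandardBorelSpace (Cluster n d) := inferInstance
  exact StandardBorelSpace.prod

variable {K : ℕ}

/-- The observed pair `(L, O)`: a cluster type `k` and the data of a cluster of that type.
Clusters of type `k` have `M k` units, and `d k` covariates for each unit. -/
abbrev Obs (M d : Fin K → ℕ) : Type := Σ k : Fin K, Cluster (M k) (d k)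

/-- The pair of the cluster type and the full data (with potential outcomes) of a cluster. -/
abbrev FullObs (M d : Fin K → ℕ) : Type := Σ k : Fin K, FullCluster (M k) (d k)

/-- Forget the potential outcomes. -/
def observe {M d : Fin K → ℕ} (w : FullObs M d) : Obs M d := ⟨w.1, w.2.2⟩

theorem measurable_observe {M d : Fin K → ℕ} :
    Measurable (observe : FullObs M d → Obs M d) := by
  intro s hs
  rw [MeasurableSpace.measurableSet_iInf] at hs ⊢
  intro k
  exact (measurable_snd : Measurable (fun w : FullCluster (M k) (d k) => w.2)) (hs k)

/-- The law of the observed data of a cluster. -/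
def obsLaw {M d : Fin K → ℕ} (F : ProbabilityMeasure (FullObs M d)) :
    ProbabilityMeasure (Obs M d) :=
  F.map measurable_observe.aemeasurable

/-- `pr(L = k)`. -/
def typeProb {β : Fin K → Type} [∀ k, MeasurableSpace (β k)] (μ : Measure (Σ k, β k))
    (k : Fin K) : ℝ :=
  μ.real {z | z.1 = k}

/-- The conditional law, given `L = k`, of the data of a cluster. -/
def typeLaw {β : Fin K → Type} [∀ k, MeasurableSpace (β k)] (μ : Measure (Σ k, β k))
    (k : Fin K) : Measure (β k) :=
  (ProbabilityTheory.cond μ {z | z.1 = k}).comap (Sigma.mk k)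

instance {β : Fin K → Type} [∀ k, MeasurableSpace (β k)] (μ : Measure (Σ k, β k))
    (k : Fin K) : IsFiniteMeasure (typeLaw μ k) := by
  unfold typeLaw
  infer_instance

variable {M d : Fin K → ℕ}

/-- The law of the covariates `X` given `L = k`. -/
def covariateLaw (P : ProbabilityMeasure (Obs M d)) (k : Fin K) :
    Measure (Cov (M k) (d k)) :=
  (typeLaw (P : Measure (Obs M d)) k).map (fun o => o.2.2)

/-- The propensity score `e(a | x, k) = pr(A = a | X = x, L = k)`. -/
def propensity (P : ProbabilityMeasure (Obs M d)) (k : Fin K) (a : Trt (M k))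
    (x : Cov (M k) (d k)) : ℝ :=
  (condDistrib (fun o : Cluster (M k) (d k) => o.2.1) (fun o => o.2.2)
    (typeLaw (P : Measure (Obs M d)) k) x).real {a}

/-- The conditional law of the outcome vector `Y` given `A = a`, `X = x` and `L = k`. -/
def outcomeLaw (P : ProbabilityMeasure (Obs M d)) (k : Fin K) (a : Trt (M k))
    (x : Cov (M k) (d k)) : Measure (Out (M k)) :=
  condDistrib (fun o : Cluster (M k) (d k) => o.1) (fun o => o.2)
    (typeLaw (P : Measure (Obs M d)) k) (a, x)

/-- The outcome regression `g(a, x, k) = E(Y | A = a, X = x, L = k)`. -/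
def outcomeReg (P : ProbabilityMeasure (Obs M d)) (k : Fin K) (a : Trt (M k))
    (x : Cov (M k) (d k)) : Out (M k) :=
  fun j => ∫ y, y j ∂(outcomeLaw P k a x)

/-- The conditional covariance matrix `Σ(a, x, k) = var(Y | A = a, X = x, L = k)`. -/
def outcomeCov (P : ProbabilityMeasure (Obs M d)) (k : Fin K) (a : Trt (M k))
    (x : Cov (M k) (d k)) : Matrix (Fin (M k)) (Fin (M k)) ℝ :=
  fun j l => covariance (fun y : Out (M k) => y j) (fun y => y l) (outcomeLaw P k a x)

/-- The identifying assumptions (A1)-(A4), and that every cluster type has positive probability.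
Statements for all values `x` of the covariates in the support are statements for almost all `x`. -/
structure IdentifyingAssumptions (F : ProbabilityMeasure (FullObs M d)) : Prop where
  typeProb_pos : ∀ k, 0 < typeProb (F : Measure (FullObs M d)) k
  /-- (A1) consistency: `Y = Y(A)`. -/
  consistency : ∀ᵐ w ∂(F : Measure (FullObs M d)), w.2.2.1 = w.2.1 w.2.2.2.1
  /-- (A2) conditional ignorability: `Y(a)` and `A` are independent given `X`, in type `k`. -/
  ignorability : ∀ (k : Fin K) (a : Trt (M k)),
    CondIndepFun
      (MeasurableSpace.comap (fun w : FullCluster (M k) (d k) => w.2.2.2) inferInstance)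
      (Measurable.comap_le (by fun_prop))
      (fun w : FullCluster (M k) (d k) => w.1 a)
      (fun w : FullCluster (M k) (d k) => w.2.2.1)
      (typeLaw (F : Measure (FullObs M d)) k)
  /-- (A3) overlap. -/
  overlap : ∃ c : ℝ, 0 < c ∧ ∀ (k : Fin K) (a : Trt (M k)), ∀ᵐ x ∂(covariateLaw (obsLaw F) k),
    c < propensity (obsLaw F) k a x ∧ propensity (obsLaw F) k a x < 1 - c
  /-- (A4) moments: the conditional mean and covariance exist, have finite expectations over the
  covariates, and the conditional covariance is positive definite. -/
  cond_moments : ∀ (k : Fin K) (a : Trt (M k)), ∀ᵐ x ∂(covariateLaw (obsLaw F) k),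
    MemLp (fun y : Out (M k) => y) 2 (outcomeLaw (obsLaw F) k a x)
  integrable_reg : ∀ (k : Fin K) (a : Trt (M k)) (j : Fin (M k)),
    Integrable (fun x => outcomeReg (obsLaw F) k a x j) (covariateLaw (obsLaw F) k)
  integrable_cov : ∀ (k : Fin K) (a : Trt (M k)) (j l : Fin (M k)),
    Integrable (fun x => outcomeCov (obsLaw F) k a x j l) (covariateLaw (obsLaw F) k)
  cov_posDef : ∀ (k : Fin K) (a : Trt (M k)), ∀ᵐ x ∂(covariateLaw (obsLaw F) k),
    (outcomeCov (obsLaw F) k a x).PosDef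

/-! ### Causal estimands -/

/-- `π(b ; α) = ∏ α ^ b_j (1 - α) ^ (1 - b_j)`. -/
def allocProb {ι : Type} [Fintype ι] (α : ℝ) (b : ι → Bool) : ℝ :=
  ∏ j, if b j then α else 1 - α

/-- The treatments `a_(-j)` of the peers of unit `j`. -/
def peers {n : ℕ} (a : Trt n) (j : Fin n) : {l : Fin n // l ≠ j} → Bool := fun l => a l

/-- The treatment vector in which unit `j` has treatment `t` and its peers have treatments `b`. -/
def joinTrt {n : ℕ} (j : Fin n) (t : Bool) (b : {l : Fin n // l ≠ j} → Bool) : Trt n :=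
  fun l => if h : l = j then t else b ⟨l, h⟩

/-- The unit average potential outcome under the allocation strategy `α`. -/
def unitAverage {n : ℕ} (y : Trt n → Out n) (t : Bool) (α : ℝ) (j : Fin n) : ℝ :=
  ∑ a : Trt n, y a j * (if a j = t then 1 else 0) * allocProb α (peers a j)

/-- The cluster average potential outcome under the allocation strategy `α`. -/
def clusterAverage {n : ℕ} (y : Trt n → Out n) (t : Bool) (α : ℝ) : ℝ :=
  (n : ℝ)⁻¹ * ∑ j, unitAverage y t α j

/-- The direct effect. -/
def directEffect (F : ProbabilityMeasure (FullObs M d)) (α : ℝ) : ℝ :=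
  ∫ w, (clusterAverage w.2.1 true α - clusterAverage w.2.1 false α) ∂(F : Measure (FullObs M d))

/-- The indirect effect. -/
def indirectEffect (F : ProbabilityMeasure (FullObs M d)) (α α' : ℝ) : ℝ :=
  ∫ w, (clusterAverage w.2.1 false α - clusterAverage w.2.1 false α') ∂(F : Measure (FullObs M d))

/-- Weight functions `w_k(a, x)`. -/
abbrev Weights (M d : Fin K → ℕ) : Type :=
  (k : Fin K) → Trt (M k) → Cov (M k) (d k) → Out (M k)

/-- The weights of the direct effect. -/
def weightDE (α : ℝ) : Weights M d := fun k a _ j =>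
  (M k : ℝ)⁻¹ * (((if a j = true then 1 else 0) - (if a j = false then 1 else 0))
    * allocProb α (peers a j))

/-- The weights of the indirect effect. -/
def weightIE (α α' : ℝ) : Weights M d := fun k a _ j =>
  (M k : ℝ)⁻¹ * ((if a j = false then 1 else 0)
    * (allocProb α (peers a j) - allocProb α' (peers a j)))

/-- `θ_k`, as the functional of the law of the observed data that identifies it. -/
def theta (w : Weights M d) (P : ProbabilityMeasure (Obs M d)) (k : Fin K) : ℝ :=
  ∑ a : Trt (M k), ∫ x, (∑ j, w k a x j * outcomeReg P k a x j) ∂(covariateLaw P k)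

/-- `τ = ∑ v_k(p_k) θ_k`, as a functional of the law of the observed data. -/
def tau (w : Weights M d) (v : Fin K → ℝ → ℝ) (P : ProbabilityMeasure (Obs M d)) : ℝ :=
  ∑ k, v k (typeProb (P : Measure (Obs M d)) k) * theta w P k

/-- `v_k(p_k) = p_k`, for the direct and the indirect effect. -/
def vId : Fin K → ℝ → ℝ := fun _ p => p

/-! ### Semiparametric efficiency in the nonparametric model

A law in the nonparametric model is an arbitrary probability law of `(L, O)`, from which the
clusters are drawn independently. -/

/-- `Q` is a regular parametric submodel through `P = Q 0` with score `s` at the truth: the root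
likelihood is differentiable in quadratic mean, and the Fisher information is nonsingular. The
likelihood ratio to the truth stays away from `0` and `∞` near the truth, so that overlap and the
moments that define the estimand persist along the submodel. As every nonzero
bounded function with mean zero is a score of such a submodel, the tangent space is not affected by
this requirement. -/
structure IsRegularSubmodel {Z : Type} [MeasurableSpace Z] (P : ProbabilityMeasure Z) {m : ℕ}
    (Q : EuclideanSpace ℝ (Fin m) → ProbabilityMeasure Z)
    (s : Z → EuclideanSpace ℝ (Fin m)) : Prop where
  base : Q 0 = P
  score_memLp : MemLp s 2 (P : Measure Z)
  information : ∀ c : EuclideanSpace ℝ (Fin m), c ≠ 0 →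
    0 < ∫ z, (inner ℝ c (s z)) ^ 2 ∂(P : Measure Z)
  likelihood : ∃ (r : EuclideanSpace ℝ (Fin m) → Z → ℝ) (C : ℝ), 0 < C ∧
    (∀ η, Measurable (r η)) ∧
    (∀ᶠ η in 𝓝 0, (Q η : Measure Z) = (P : Measure Z).withDensity
      (fun z => ENNReal.ofReal (r η z))) ∧
    (∀ᶠ η in 𝓝 0, ∀ᵐ z ∂(P : Measure Z), C⁻¹ ≤ r η z ∧ r η z ≤ C) ∧
    (fun η => ∫ z, (√(r η z) - 1 - 2⁻¹ * inner ℝ η (s z)) ^ 2 ∂(P : Measure Z))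
      =o[𝓝 0] (fun η => ‖η‖ ^ 2)

/-- The tangent space at `P`: the mean-square closure of the linear combinations of scores of
regular parametric submodels. -/
def InTangentSpace {Z : Type} [MeasurableSpace Z] (P : ProbabilityMeasure Z) (φ : Z → ℝ) : Prop :=
  MemLp φ 2 (P : Measure Z) ∧
  ∀ ε : ℝ, 0 < ε → ∃ (m : ℕ) (Q : EuclideanSpace ℝ (Fin m) → ProbabilityMeasure Z)
    (s : Z → EuclideanSpace ℝ (Fin m)) (c : EuclideanSpace ℝ (Fin m)),
    IsRegularSubmodel P Q s ∧ ∫ z, (φ z - inner ℝ c (s z)) ^ 2 ∂(P : Measure Z) < ε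

/-- `φ` is the efficient influence function at `P` of the parameter `T` in the nonparametric
model: it has mean zero and finite variance, it represents the derivative of `T` along every
regular parametric submodel, `∂T/∂η = E(φ s)`, and it belongs to the tangent space. -/
structure IsEfficientInfluenceFunction {Z : Type} [MeasurableSpace Z]
    (T : ProbabilityMeasure Z → ℝ) (P : ProbabilityMeasure Z) (φ : Z → ℝ) : Prop where
  memLp : MemLp φ 2 (P : Measure Z)
  mean_zero : ∫ z, φ z ∂(P : Measure Z) = 0
  gradient : ∀ (m : ℕ) (Q : EuclideanSpace ℝ (Fin m) → ProbabilityMeasure Z)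
    (s : Z → EuclideanSpace ℝ (Fin m)), IsRegularSubmodel P Q s →
    HasGradientAt (fun η => T (Q η)) (∫ z, φ z • s z ∂(P : Measure Z)) 0
  tangent : InTangentSpace P φ

/-- The estimator `est` (a function of the sample, for each sample size) is asymptotically linear
for `τ`, with influence function `φ`:
`N^(1/2) (est - τ) = N^(-1/2) ∑ φ(Z_i) + o_P(1)`. -/
def AsymptoticallyLinear {Ω : Type*} {Z : Type} [MeasurableSpace Ω] (μ : Measure Ω) (D : ℕ → Ω → Z)
    (est : (N : ℕ) → (Fin N → Z) → ℝ) (τ : ℝ) (φ : Z → ℝ) : Prop :=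
  TendstoInMeasure μ
    (fun (N : ℕ) ω => √(N : ℝ) * (est N (fun i => D i ω) - τ)
      - (√(N : ℝ))⁻¹ * ∑ i : Fin N, φ (D i ω))
    atTop (fun _ => (0 : ℝ))

/-- The estimator is semiparametrically efficient at `P` for the parameter `T` of the
nonparametric model: it is asymptotically linear, and its influence function is the efficient
influence function. -/
def IsEfficientAt {Ω : Type*} {Z : Type} [MeasurableSpace Ω] [MeasurableSpace Z] (μ : Measure Ω)
    (D : ℕ → Ω → Z) (est : (N : ℕ) → (Fin N → Z) → ℝ) (T : ProbabilityMeasure Z → ℝ)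
    (P : ProbabilityMeasure Z) : Prop :=
  ∃ φ : Z → ℝ, IsEfficientInfluenceFunction T P φ ∧ AsymptoticallyLinear μ D est (T P) φ

/-! ### Parametric working models and the plug-in estimator -/

/-- A function on treatments and covariates for each type, such as a propensity score. -/
abbrev PSFun (M d : Fin K → ℕ) : Type := (k : Fin K) → Trt (M k) → Cov (M k) (d k) → ℝ

/-- A vector-valued function on treatments and covariates, such as an outcome regression. -/
abbrev ORFun (M d : Fin K → ℕ) : Type := (k : Fin K) → Trt (M k) → Cov (M k) (d k) → Out (M k)

/-- Values of the nuisance parameter `β = (β_e, β_g)`. -/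
abbrev Nuis (qe qg : ℕ) : Type := EuclideanSpace ℝ (Fin qe) × EuclideanSpace ℝ (Fin qg)

/-- Values of the entire parameter `(θ, β)`. -/
abbrev Param (K qe qg : ℕ) : Type := EuclideanSpace ℝ (Fin K) × Nuis qe qg

/-- `b` is a true parameter of the propensity score model `e(· ; b)`. -/
def TruePS {qe : ℕ} (P : ProbabilityMeasure (Obs M d))
    (e : EuclideanSpace ℝ (Fin qe) → PSFun M d) (b : EuclideanSpace ℝ (Fin qe)) : Prop :=
  ∀ (k : Fin K) (a : Trt (M k)), ∀ᵐ x ∂(covariateLaw P k), propensity P k a x = e b k a x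

/-- `b` is a true parameter of the outcome regression model `g(· ; b)`. -/
def TrueOR {qg : ℕ} (P : ProbabilityMeasure (Obs M d))
    (g : EuclideanSpace ℝ (Fin qg) → ORFun M d) (b : EuclideanSpace ℝ (Fin qg)) : Prop :=
  ∀ (k : Fin K) (a : Trt (M k)), ∀ᵐ x ∂(covariateLaw P k), outcomeReg P k a x = g b k a x

/-- The model of the laws whose propensity score is `e(· ; b)` for a unique `b` in the parameter
space. -/
def propensityModel {qe : ℕ} (e : EuclideanSpace ℝ (Fin qe) → PSFun M d)
    (Be : Set (EuclideanSpace ℝ (Fin qe))) : Set (ProbabilityMeasure (Obs M d)) :=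
  {P | ∃! b, b ∈ Be ∧ TruePS P e b}

/-- The model of the laws whose outcome regression is `g(· ; b)` for a unique `b` in the parameter
space. -/
def outcomeModel {qg : ℕ} (g : EuclideanSpace ℝ (Fin qg) → ORFun M d)
    (Bg : Set (EuclideanSpace ℝ (Fin qg))) : Set (ProbabilityMeasure (Obs M d)) :=
  {P | ∃! b, b ∈ Bg ∧ TrueOR P g b}

/-- `φ_k(O, e, g)`, the uncentered augmented inverse probability weighted term. -/
def phi (w : Weights M d) (e : PSFun M d) (g : ORFun M d) (k : Fin K)
    (o : Cluster (M k) (d k)) : ℝ :=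
  (∑ j, w k o.2.1 o.2.2 j * (o.1 j - g k o.2.1 o.2.2 j)) / e k o.2.1 o.2.2
    + ∑ a : Trt (M k), ∑ j, w k a o.2.2 j * g k a o.2.2 j

/-- The estimating function `Ψ_θ(θ, β)`, with components `1(L = k) (φ_k - θ_k)`. -/
def psiTheta {qe qg : ℕ} (w : Weights M d) (e : EuclideanSpace ℝ (Fin qe) → PSFun M d)
    (g : EuclideanSpace ℝ (Fin qg) → ORFun M d) (z : Obs M d) (u : Param K qe qg) :
    EuclideanSpace ℝ (Fin K) :=
  WithLp.toLp 2 fun k => if z.1 = k then phi w (e u.2.1) (g u.2.2) z.1 z.2 - u.1 k else 0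

/-- The entire estimating function `Ψ(θ, β) = (Ψ_θ(θ, β), Ψ_β(β))`. -/
def psi {qe qg : ℕ} (w : Weights M d) (e : EuclideanSpace ℝ (Fin qe) → PSFun M d)
    (g : EuclideanSpace ℝ (Fin qg) → ORFun M d) (psiBeta : Obs M d → Nuis qe qg → Nuis qe qg)
    (z : Obs M d) (u : Param K qe qg) : Param K qe qg :=
  (psiTheta w e g z u, psiBeta z u.2)

/-- The proportion `N_k / N` of clusters of type `k` in the sample. -/
def propHat {N : ℕ} (z : Fin N → Obs M d) (k : Fin K) : ℝ :=
  (∑ i, if (z i).1 = k then (1 : ℝ) else 0) / N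

/-- `t` is the plug-in estimate `∑ v_k(N_k / N) θ̂_k` from the sample `z`, at the value `b` of the
nuisance parameter, where `θ̂` solves the estimating equation `0 = ∑ Ψ_θ(θ̂, b)`. -/
def IsPlugInEstimate {qe qg N : ℕ} (w : Weights M d) (v : Fin K → ℝ → ℝ)
    (e : EuclideanSpace ℝ (Fin qe) → PSFun M d) (g : EuclideanSpace ℝ (Fin qg) → ORFun M d)
    (z : Fin N → Obs M d) (b : Nuis qe qg) (t : ℝ) : Prop :=
  ∃ θ : EuclideanSpace ℝ (Fin K), ∑ i, psiTheta w e g (z i) (θ, b) = 0 ∧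
    t = ∑ k, v k (propHat z k) * θ k

/-- The regularity conditions (R1)-(R4) on the estimating function `Ψ(θ, β)`, with parameter
space `Θ × Be × Bg`, at the true value `θs` of `θ` and the limit `bd` of the estimator of `β`. -/
structure RegularityConditions {qe qg : ℕ} (P : ProbabilityMeasure (Obs M d)) (w : Weights M d)
    (e : EuclideanSpace ℝ (Fin qe) → PSFun M d) (g : EuclideanSpace ℝ (Fin qg) → ORFun M d)
    (psiBeta : Obs M d → Nuis qe qg → Nuis qe qg) (Θ : Set (EuclideanSpace ℝ (Fin K)))
    (Be : Set (EuclideanSpace ℝ (Fin qe))) (Bg : Set (EuclideanSpace ℝ (Fin qg)))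
    (θs : EuclideanSpace ℝ (Fin K)) (bd : Nuis qe qg) : Prop where
  /-- (R1): the parameter space is open and bounded, and a product, so that `β_e` and `β_g` are
  variationally independent. -/
  r1_open : IsOpen Θ ∧ IsOpen Be ∧ IsOpen Bg
  r1_bounded : Bornology.IsBounded Θ ∧ Bornology.IsBounded Be ∧ Bornology.IsBounded Bg
  r1_mem : θs ∈ Θ ∧ bd.1 ∈ Be ∧ bd.2 ∈ Bg
  /-- (R2) -/
  r2 : ∀ᵐ z ∂(P : Measure (Obs M d)), ContDiffOn ℝ 2 (psi w e g psiBeta z) (Θ ×ˢ Be ×ˢ Bg)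
  /-- (R3) (i): a zero of the expected estimating function, and the only one. -/
  r3_zero : ∫ z, psi w e g psiBeta z (θs, bd) ∂(P : Measure (Obs M d)) = 0
  r3_unique : ∀ u ∈ Θ ×ˢ Be ×ˢ Bg,
    Integrable (fun z => psi w e g psiBeta z u) (P : Measure (Obs M d)) →
    ∫ z, psi w e g psiBeta z u ∂(P : Measure (Obs M d)) = 0 → u = (θs, bd)
  /-- (R3) (ii) -/
  r3_memLp : MemLp (fun z => psi w e g psiBeta z (θs, bd)) 2 (P : Measure (Obs M d))
  /-- (R3) (iii): the expected derivative exists and is nonsingular. -/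
  r3_integrable_deriv : Integrable (fun z => fderiv ℝ (psi w e g psiBeta z) (θs, bd))
    (P : Measure (Obs M d))
  r3_nonsingular :
    IsUnit (∫ z, fderiv ℝ (psi w e g psiBeta z) (θs, bd) ∂(P : Measure (Obs M d)))
  /-- (R4): the second derivatives are dominated near `(θs, bd)`. -/
  r4 : ∃ U ∈ 𝓝 (θs, bd), ∃ H : Obs M d → ℝ, Integrable H (P : Measure (Obs M d)) ∧
    ∀ᵐ z ∂(P : Measure (Obs M d)), ∀ u ∈ U, ‖iteratedFDeriv ℝ 2 (psi w e g psiBeta z) u‖ ≤ H z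

/-- `betaHat`, a function of the sample for each sample size, is an M-estimator of the nuisance
parameter `β = (β_e, β_g)` of the two models, with probability limit `bd`: it solves the estimating
equation `0 = ∑ Ψ_β` with probability tending to one. The estimating function `Ψ_β` is one for the
true parameters: it has expectation zero at the true `β` when both models hold. -/
structure IsNuisanceEstimator {qe qg : ℕ} {Ω : Type*} [MeasurableSpace Ω] (μ : Measure Ω)
    (D : ℕ → Ω → Obs M d) (P : ProbabilityMeasure (Obs M d))
    (e : EuclideanSpace ℝ (Fin qe) → PSFun M d) (g : EuclideanSpace ℝ (Fin qg) → ORFun M d)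
    (Be : Set (EuclideanSpace ℝ (Fin qe))) (Bg : Set (EuclideanSpace ℝ (Fin qg)))
    (psiBeta : Obs M d → Nuis qe qg → Nuis qe qg)
    (betaHat : (N : ℕ) → (Fin N → Obs M d) → Nuis qe qg) (bd : Nuis qe qg) : Prop where
  measurable_psiBeta : ∀ b, Measurable (fun z => psiBeta z b)
  measurable_betaHat : ∀ N, Measurable (betaHat N)
  unbiased : ∀ b : Nuis qe qg, b.1 ∈ Be → b.2 ∈ Bg → TruePS P e b.1 → TrueOR P g b.2 →
    Integrable (fun z => psiBeta z b) (P : Measure (Obs M d)) ∧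
    ∫ z, psiBeta z b ∂(P : Measure (Obs M d)) = 0
  solves : Tendsto (fun N : ℕ => μ {ω | ∑ i : Fin N,
    psiBeta (D i ω) (betaHat N (fun i => D i ω)) ≠ 0}) atTop (𝓝 0)
  limit : TendstoInMeasure μ (fun (N : ℕ) ω => betaHat N (fun i => D i ω)) atTop (fun _ => bd)

/-! ### The bias-corrected doubly robust estimator of Liu et al. -/

/-- The bias-corrected doubly robust estimate `Ŷ_i(t, α)` for one cluster, where `f` is the
estimated propensity score of the treatment vector of a cluster, and `m` has the estimated
outcome regressions `m_ij` of its units as components. -/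
def liuCluster (f : PSFun M d) (m : ORFun M d) (t : Bool) (α : ℝ) (z : Obs M d) : ℝ :=
  (M z.1 : ℝ)⁻¹ * ∑ j : Fin (M z.1),
    ((if z.2.2.1 j = t then 1 else 0) / f z.1 z.2.2.1 z.2.2.2
        * (z.2.1 j - m z.1 z.2.2.1 z.2.2.2 j) * allocProb α (peers z.2.2.1 j)
      + ∑ b : {l : Fin (M z.1) // l ≠ j} → Bool,
          m z.1 (joinTrt j t b) z.2.2.2 j * allocProb α b)

/-- The bias-corrected doubly robust estimator of the direct effect. -/
def liuDE {N : ℕ} (f : PSFun M d) (m : ORFun M d) (α : ℝ) (z : Fin N → Obs M d) : ℝ :=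
  (N : ℝ)⁻¹ * ∑ i, (liuCluster f m true α (z i) - liuCluster f m false α (z i))

/-- The bias-corrected doubly robust estimator of the indirect effect. -/
def liuIE {N : ℕ} (f : PSFun M d) (m : ORFun M d) (α α' : ℝ) (z : Fin N → Obs M d) : ℝ :=
  (N : ℝ)⁻¹ * ∑ i, (liuCluster f m false α (z i) - liuCluster f m false α' (z i))

end PartialInterference

end

open PartialInterference

/-! ### Finite algebra: the estimator of Liu et al. as a sample mean of `phi`. -/

namespace PartialInterference

variable {K : ℕ} {M d : Fin K → ℕ}

/-! Part (a) is finite algebra. Since `v_k(p) = p`, the count `N_k` in `(N_k / N) θ̂_k` cancels, and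
the plug-in estimator is the sample mean of `phi` (`isPlugInEstimate_iff`). A sum over the
treatments of the peers of unit `j` is a sum over whole treatment vectors with `a_j = t`, so the
cluster estimate of Liu et al. is `phi` for the corresponding weights (`liuCluster_eq`).

Part (b) has three ingredients. One is that `phi - tau` at the true nuisance functions is the
efficient influence function (`isEfficientInfluenceFunction_phi`). The tangent space is all of
mean-zero `L²`, because bounded centered functions `b` are scores of the submodels `1 + η b` and are
dense. It remains to differentiate `tau` along a submodel with likelihood ratio `r η`. The mean of
`phi` has derivative `E(phi s)` by quadratic mean differentiability. The difference between this
mean under the perturbed law and the perturbed `tau` equals `∫ u (r η - 1)`, where `u` is the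
inverse weighting error of the change in the outcome regression (`sq_integral_aipw_sub_le`). The
regression changes by `o(1)` in mean square and `r η - 1` is `O(‖η‖)`, so by Cauchy–Schwarz this
difference is `o(‖η‖)`.

The second is that estimating `β` costs nothing to first order. Uniqueness of the zero in (R3) makes
`β†` the true parameter. By double robustness, the mean of `phi` is constant when only `β_e` or only
`β_g` moves, so its expected derivative in `β` is zero. The estimating equation gives `β̂ - β† =
O_P(N^(-1/2))`, and a Taylor expansion leaves an error of `o_P(1)` after scaling
(`tendstoInMeasure_sub_of_orthogonal`).

The third is identification: under consistency and ignorability, inverse weighting turns the law of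
`Y(a)` on `A = a` into the law of `Y(a)` (`map_potentialOutcome`), so that `tau` is the causal
effect. -/

theorem joinTrt_apply_self {n : ℕ} (j : Fin n) (t : Bool) (b : {l : Fin n // l ≠ j} → Bool) :
    joinTrt j t b j = t := by
  simp [joinTrt]

theorem peers_joinTrt {n : ℕ} (j : Fin n) (t : Bool) (b : {l : Fin n // l ≠ j} → Bool) :
    peers (joinTrt j t b) j = b := by
  funext l
  simp [peers, joinTrt, l.2]

theorem joinTrt_peers {n : ℕ} (a : Trt n) (j : Fin n) : joinTrt j (a j) (peers a j) = a := by
  funext l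
  by_cases h : l = j
  · subst h; simp [joinTrt]
  · simp [joinTrt, peers, h]

/-- Summing over the treatments of the peers is summing over the treatment vectors in which unit
`j` has treatment `t`. -/
theorem sum_joinTrt {n : ℕ} (j : Fin n) (t : Bool) (f : Trt n → ({l : Fin n // l ≠ j} → Bool) → ℝ) :
    ∑ b, f (joinTrt j t b) b = ∑ a : Trt n, if a j = t then f a (peers a j) else 0 := by
  rw [← Finset.sum_filter]
  refine Finset.sum_bij' (fun b _ => joinTrt j t b) (fun a _ => peers a j) ?_ ?_ ?_ ?_ ?_
  · intro b _
    simp [joinTrt_apply_self]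
  · intros; simp
  · intro b _
    exact peers_joinTrt j t b
  · intro a ha
    simp only [Finset.mem_filter, Finset.mem_univ, true_and] at ha
    rw [← ha]
    exact joinTrt_peers a j
  · intro b _
    rw [peers_joinTrt]

/-- Both estimators have the same residual term up to the order of factors. The augmentation terms
agree by `sum_joinTrt`, after exchanging the sums over units and treatments. -/
theorem liuCluster_eq (f : PSFun M d) (m : ORFun M d) (t : Bool) (α : ℝ) (z : Obs M d) :
    liuCluster f m t α z = phi (fun k a _ j => (M k : ℝ)⁻¹ *
      ((if a j = t then 1 else 0) * allocProb α (peers a j))) f m z.1 z.2 := by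
  unfold liuCluster phi
  rw [Finset.sum_add_distrib, mul_add]
  congr 1
  · rw [Finset.mul_sum, Finset.sum_div]
    refine Finset.sum_congr rfl fun j _ => ?_
    ring
  · rw [Finset.sum_comm, Finset.mul_sum]
    refine Finset.sum_congr rfl fun j _ => ?_
    rw [sum_joinTrt j t (fun a b => m z.1 a z.2.2.2 j * allocProb α b), Finset.mul_sum]
    refine Finset.sum_congr rfl fun a _ => ?_
    by_cases h : a j = t <;> simp [h]
    ring

theorem phi_sub (w w' : Weights M d) (f : PSFun M d) (m : ORFun M d) (k : Fin K)
    (o : Cluster (M k) (d k)) :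
    phi w f m k o - phi w' f m k o = phi (fun k a x j => w k a x j - w' k a x j) f m k o := by
  simp only [phi, sub_mul, Finset.sum_sub_distrib, sub_div]
  ring

theorem phi_weightDE (f : PSFun M d) (m : ORFun M d) (α : ℝ) (z : Obs M d) :
    phi (weightDE α) f m z.1 z.2 = liuCluster f m true α z - liuCluster f m false α z := by
  rw [liuCluster_eq, liuCluster_eq, phi_sub]
  congr 1
  funext k a x j
  simp only [weightDE]
  ring

theorem phi_weightIE (f : PSFun M d) (m : ORFun M d) (α α' : ℝ) (z : Obs M d) :
    phi (weightIE α α') f m z.1 z.2 = liuCluster f m false α z - liuCluster f m false α' z := by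
  rw [liuCluster_eq, liuCluster_eq, phi_sub]
  congr 1
  funext k a x j
  simp only [weightIE]
  ring

/-- The plug-in estimate, for `v_k(p) = p`, is the sample mean of `φ`. -/
theorem isPlugInEstimate_iff {qe qg N : ℕ} (w : Weights M d)
    (e : EuclideanSpace ℝ (Fin qe) → PSFun M d) (g : EuclideanSpace ℝ (Fin qg) → ORFun M d)
    (z : Fin N → Obs M d) (b : Nuis qe qg) (t : ℝ) :
    IsPlugInEstimate w vId e g z b t ↔
      t = (N : ℝ)⁻¹ * ∑ i, phi w (e b.1) (g b.2) (z i).1 (z i).2 := by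
  -- Stated without division, `N_k θ_k` is the total of `phi` over type `k`; multiplied by `1 / N`
  -- it gives the term of the plug-in estimate, even when `N_k = 0`.
  have key : ∀ θ : EuclideanSpace ℝ (Fin K), ∑ i, psiTheta w e g (z i) (θ, b) = 0 ↔
      ∀ k, ∑ i, (if (z i).1 = k then phi w (e b.1) (g b.2) (z i).1 (z i).2 else 0)
        = (∑ i, if (z i).1 = k then (1 : ℝ) else 0) * θ k := by
    intro θ
    have h1 : ∀ k, (∑ i, psiTheta w e g (z i) (θ, b)) k =
        ∑ i, (if (z i).1 = k then phi w (e b.1) (g b.2) (z i).1 (z i).2 else 0)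
        - (∑ i, if (z i).1 = k then (1 : ℝ) else 0) * θ k := by
      intro k
      rw [WithLp.ofLp_sum, Finset.sum_apply, Finset.sum_mul, ← Finset.sum_sub_distrib]
      refine Finset.sum_congr rfl fun i _ => ?_
      simp only [psiTheta]
      split_ifs <;> simp
    constructor
    · intro h k
      have := h1 k
      rw [h] at this
      simp only [PiLp.zero_apply] at this
      linarith
    · intro h
      ext k
      rw [h1 k, h k]
      simp
  have val : ∀ θ : EuclideanSpace ℝ (Fin K), ∑ i, psiTheta w e g (z i) (θ, b) = 0 →
      ∑ k, vId k (propHat z k) * θ k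
        = (N : ℝ)⁻¹ * ∑ i, phi w (e b.1) (g b.2) (z i).1 (z i).2 := by
    intro θ hθ
    rw [key] at hθ
    have : ∀ k, vId k (propHat z k) * θ k = (N : ℝ)⁻¹ *
        ∑ i, (if (z i).1 = k then phi w (e b.1) (g b.2) (z i).1 (z i).2 else 0) := by
      intro k
      rw [hθ k, vId, propHat]
      ring
    simp_rw [this]
    rw [← Finset.mul_sum, Finset.sum_comm]
    simp
  constructor
  · rintro ⟨θ, hθ, rfl⟩
    exact val θ hθ
  · rintro rfl
    -- For a type absent from the sample the quotient is `0 / 0 = 0`; any value would solve the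
    -- equation there and would receive weight zero.
    let θ : EuclideanSpace ℝ (Fin K) := WithLp.toLp 2 fun k =>
      (∑ i, (if (z i).1 = k then phi w (e b.1) (g b.2) (z i).1 (z i).2 else 0)) /
        (∑ i, if (z i).1 = k then (1 : ℝ) else 0)
    have hθ : ∑ i, psiTheta w e g (z i) (θ, b) = 0 := by
      rw [key]
      intro k
      by_cases hk : (∑ i, if (z i).1 = k then (1 : ℝ) else 0) = 0
      · have hz : ∀ i, (z i).1 ≠ k := by
          intro i hi
          rw [Finset.sum_eq_zero_iff_of_nonneg (fun i _ => by split_ifs <;> norm_num)] at hk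
          simpa [hi] using hk i (Finset.mem_univ i)
        simp [hz]
      · simp only [θ]
        rw [mul_div_cancel₀ _ hk]
    exact ⟨θ, hθ, (val θ hθ).symm⟩

theorem liuDE_eq {N : ℕ} (f : PSFun M d) (m : ORFun M d) (α : ℝ) (z : Fin N → Obs M d) :
    liuDE f m α z = (N : ℝ)⁻¹ * ∑ i, phi (weightDE α) f m (z i).1 (z i).2 := by
  simp only [liuDE, phi_weightDE]

theorem liuIE_eq {N : ℕ} (f : PSFun M d) (m : ORFun M d) (α α' : ℝ) (z : Fin N → Obs M d) :
    liuIE f m α α' z = (N : ℝ)⁻¹ * ∑ i, phi (weightIE α α') f m (z i).1 (z i).2 := by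
  simp only [liuIE, phi_weightIE]

/-- The contrast of cluster averages of the direct effect is the weighted sum of the potential
outcomes. -/
theorem clusterAverage_sub_eq_weightDE (α : ℝ) (k : Fin K) (x : Cov (M k) (d k))
    (y : Trt (M k) → Out (M k)) :
    clusterAverage y true α - clusterAverage y false α
      = ∑ a, ∑ j, weightDE (M := M) (d := d) α k a x j * y a j := by
  simp only [clusterAverage, unitAverage, weightDE]
  rw [← mul_sub, ← Finset.sum_sub_distrib, Finset.sum_comm, Finset.mul_sum]
  refine Finset.sum_congr rfl fun j _ => ?_
  rw [← Finset.sum_sub_distrib, Finset.mul_sum]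
  refine Finset.sum_congr rfl fun a _ => ?_
  ring

theorem clusterAverage_sub_eq_weightIE (α α' : ℝ) (k : Fin K) (x : Cov (M k) (d k))
    (y : Trt (M k) → Out (M k)) :
    clusterAverage y false α - clusterAverage y false α'
      = ∑ a, ∑ j, weightIE (M := M) (d := d) α α' k a x j * y a j := by
  simp only [clusterAverage, unitAverage, weightIE]
  rw [← mul_sub, ← Finset.sum_sub_distrib, Finset.sum_comm, Finset.mul_sum]
  refine Finset.sum_congr rfl fun j _ => ?_
  rw [← Finset.sum_sub_distrib, Finset.mul_sum]
  refine Finset.sum_congr rfl fun a _ => ?_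
  ring

end PartialInterference

namespace PartialInterference

variable {K : ℕ}

/-! ### Laws on the disjoint union of the types, through their unnormalized parts. -/

section Sigma

variable {β : Fin K → Type} [∀ k, MeasurableSpace (β k)]

theorem measurable_sigmaMk (k : Fin K) : Measurable (Sigma.mk k : β k → Σ k, β k) := by
  intro s hs
  rw [MeasurableSpace.measurableSet_iInf] at hs
  exact hs k

theorem measurable_of_sigma {γ : Type*} [MeasurableSpace γ] {f : (Σ k, β k) → γ}
    (hf : ∀ k, Measurable fun o => f ⟨k, o⟩) : Measurable f := by
  intro s hs
  rw [MeasurableSpace.measurableSet_iInf]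
  intro k
  exact hf k hs

theorem measurableEmbedding_sigmaMk (k : Fin K) :
    MeasurableEmbedding (Sigma.mk k : β k → Σ k, β k) where
  injective := sigma_mk_injective
  measurable := measurable_sigmaMk k
  measurableSet_image' := by
    intro s hs
    rw [MeasurableSpace.measurableSet_iInf]
    intro l
    change MeasurableSet (Sigma.mk l ⁻¹' (Sigma.mk k '' s))
    by_cases h : l = k
    · subst h
      rwa [Set.preimage_image_eq _ sigma_mk_injective]
    · convert! MeasurableSet.empty
      ext o
      simp only [Set.mem_preimage, Set.mem_image, Sigma.mk.injEq, Set.mem_empty_iff_false,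
        iff_false, not_exists, not_and]
      intro x _ hk
      exact absurd hk.symm h

theorem measurableSet_type (k : Fin K) : MeasurableSet {z : Σ k, β k | z.1 = k} := by
  have : Measurable (fun z : Σ k, β k => z.1) := measurable_of_sigma fun k => measurable_const
  exact this (measurableSet_singleton k)

/-- The part of a measure that is carried by the clusters of type `k`. -/
noncomputable def typeMeas (μ : Measure (Σ k, β k)) (k : Fin K) : Measure (β k) :=
  μ.comap (Sigma.mk k)

instance (μ : Measure (Σ k, β k)) [IsFiniteMeasure μ] (k : Fin K) :
    IsFiniteMeasure (typeMeas μ k) := by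
  unfold typeMeas
  infer_instance

theorem typeMeas_apply (μ : Measure (Σ k, β k)) (k : Fin K) (s : Set (β k)) :
    typeMeas μ k s = μ (Sigma.mk k '' s) :=
  (measurableEmbedding_sigmaMk k).comap_apply μ s

/-- Integrability, integrals and null sets on the disjoint union are all reduced to single types
through this decomposition. -/
theorem eq_sum_typeMeas (μ : Measure (Σ k, β k)) :
    μ = Measure.sum fun k => (typeMeas μ k).map (Sigma.mk k) := by
  ext s hs
  rw [Measure.sum_apply _ hs, tsum_fintype]
  have h1 : ∀ k, (typeMeas μ k).map (Sigma.mk k) s = μ (s ∩ {z | z.1 = k}) := by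
    intro k
    rw [Measure.map_apply (measurable_sigmaMk k) hs, typeMeas_apply, Set.image_preimage_eq_inter_range,
      Set.range_sigmaMk]
    rfl
  simp_rw [h1]
  have h2 : s = ⋃ k, s ∩ {z | z.1 = k} := by
    ext z; simp
  conv_lhs => rw [h2]
  rw [measure_iUnion, tsum_fintype]
  · intro i j hij
    refine Set.disjoint_left.2 fun z hz hz' => hij ?_
    rw [← hz.2, ← hz'.2]
  · exact fun k => hs.inter (measurableSet_type k)

theorem typeMeas_univ (μ : Measure (Σ k, β k)) (k : Fin K) :
    typeMeas μ k Set.univ = μ {z | z.1 = k} := by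
  rw [typeMeas_apply, Set.image_univ, Set.range_sigmaMk]
  rfl

theorem typeLaw_eq_smul (μ : Measure (Σ k, β k)) (k : Fin K) :
    typeLaw μ k = (μ {z | z.1 = k})⁻¹ • typeMeas μ k := by
  ext s hs
  rw [typeLaw, (measurableEmbedding_sigmaMk k).comap_apply, ProbabilityTheory.cond_apply
    (measurableSet_type k), Measure.smul_apply, typeMeas_apply, smul_eq_mul]
  congr 2
  rw [Set.inter_eq_right]
  rintro _ ⟨o, _, rfl⟩
  rfl

theorem integrable_iff_typeMeas {E : Type*} [NormedAddCommGroup E] (μ : Measure (Σ k, β k))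
    (f : (Σ k, β k) → E) :
    Integrable f μ ↔ ∀ k, Integrable (fun o => f ⟨k, o⟩) (typeMeas μ k) := by
  conv_lhs => rw [eq_sum_typeMeas μ]
  rw [Measure.sum_fintype, integrable_finsetSum_measure]
  simp only [Finset.mem_univ, true_implies]
  refine forall_congr' fun k => ?_
  rw [(measurableEmbedding_sigmaMk k).integrable_map_iff]
  rfl

theorem integral_eq_sum_typeMeas {E : Type*} [NormedAddCommGroup E] [NormedSpace ℝ E]
    (μ : Measure (Σ k, β k)) (f : (Σ k, β k) → E) (hf : Integrable f μ) :
    ∫ z, f z ∂μ = ∑ k, ∫ o, f ⟨k, o⟩ ∂(typeMeas μ k) := by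
  rw [integrable_iff_typeMeas] at hf
  conv_lhs => rw [eq_sum_typeMeas μ]
  rw [Measure.sum_fintype, integral_finsetSum_measure]
  · exact Finset.sum_congr rfl fun k _ => (measurableEmbedding_sigmaMk k).integral_map _
  · exact fun k _ => ((measurableEmbedding_sigmaMk k).integrable_map_iff).2 (hf k)

theorem ae_iff_typeMeas (μ : Measure (Σ k, β k)) (p : (Σ k, β k) → Prop) :
    (∀ᵐ z ∂μ, p z) ↔ ∀ k, ∀ᵐ o ∂(typeMeas μ k), p ⟨k, o⟩ := by
  conv_lhs => rw [eq_sum_typeMeas μ]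
  rw [Measure.ae_sum_iff]
  exact forall_congr' fun k => (measurableEmbedding_sigmaMk k).ae_map_iff

/-- The advantage of `typeMeas` over `typeLaw`: a density on the union restricts to each type
without a normalizing constant. -/
theorem typeMeas_withDensity (μ : Measure (Σ k, β k)) (r : (Σ k, β k) → ENNReal)
    (k : Fin K) :
    typeMeas (μ.withDensity r) k = (typeMeas μ k).withDensity fun o => r ⟨k, o⟩ := by
  ext s hs
  have hm : MeasurableSet ((Sigma.mk k : β k → Σ k, β k) '' s) :=
    (measurableEmbedding_sigmaMk k).measurableSet_image.2 hs
  rw [typeMeas_apply, withDensity_apply _ hm, withDensity_apply _ hs, typeMeas,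
    ← (measurableEmbedding_sigmaMk k).lintegral_map (μ := (μ.comap (Sigma.mk k)).restrict s) r]
  have h := (measurableEmbedding_sigmaMk k).restrict_map (μ.comap (Sigma.mk k)) (Sigma.mk k '' s)
  rw [Set.preimage_image_eq _ sigma_mk_injective] at h
  rw [← h, (measurableEmbedding_sigmaMk k).map_comap, Measure.restrict_restrict hm,
    Set.inter_eq_left.2 (Set.image_subset_range _ _)]

/-- Integrals with respect to the conditional law given the type. -/
theorem typeProb_mul_integral (μ : Measure (Σ k, β k)) [IsFiniteMeasure μ] (k : Fin K)
    (f : β k → ℝ) :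
    typeProb μ k * ∫ o, f o ∂(typeLaw μ k) = ∫ o, f o ∂(typeMeas μ k) := by
  rw [typeLaw_eq_smul, integral_smul_measure, typeProb, measureReal_def, ENNReal.toReal_inv,
    smul_eq_mul]
  by_cases h : μ {z | z.1 = k} = 0
  · have : typeMeas μ k = 0 := by
      rw [← Measure.measure_univ_eq_zero, typeMeas_univ, h]
    simp [this]
  · rw [mul_inv_cancel_left₀]
    exact ENNReal.toReal_ne_zero.2 ⟨h, measure_ne_top _ _⟩

theorem integrable_typeLaw_iff {E : Type*} [NormedAddCommGroup E] (μ : Measure (Σ k, β k))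
    [IsFiniteMeasure μ] {k : Fin K} (hk : 0 < typeProb μ k) (f : β k → E) :
    Integrable f (typeLaw μ k) ↔ Integrable f (typeMeas μ k) := by
  rw [typeLaw_eq_smul]
  refine integrable_smul_measure ?_ ?_
  · simp
  · rw [typeProb, measureReal_def] at hk
    simp only [ne_eq, ENNReal.inv_eq_top]
    intro h
    simp [h] at hk

/-- No positivity of the type is needed: the scalar between the two measures is the inverse of a
finite number, hence nonzero, although it may be infinite. -/
theorem ae_typeLaw_iff (μ : Measure (Σ k, β k)) [IsFiniteMeasure μ] {k : Fin K}
    (p : β k → Prop) :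
    (∀ᵐ o ∂(typeLaw μ k), p o) ↔ ∀ᵐ o ∂(typeMeas μ k), p o := by
  rw [typeLaw_eq_smul, Measure.ae_ennreal_smul_measure_iff]
  simp

end Sigma

/-! ### Cauchy–Schwarz for real square integrable functions. -/

section L2

variable {Z : Type*} [MeasurableSpace Z] {μ : Measure Z}

theorem integrable_mul_of_memLp {f g : Z → ℝ} (hf : MemLp f 2 μ) (hg : MemLp g 2 μ) :
    Integrable (fun z => f z * g z) μ :=
  hf.integrable_mul hg

theorem abs_integral_mul_le {f g : Z → ℝ} (hf : MemLp f 2 μ) (hg : MemLp g 2 μ) :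
    |∫ z, f z * g z ∂μ| ≤ √(∫ z, f z ^ 2 ∂μ) * √(∫ z, g z ^ 2 ∂μ) := by
  calc |∫ z, f z * g z ∂μ| ≤ ∫ z, ‖f z‖ * ‖g z‖ ∂μ := by
        refine (abs_integral_le_integral_abs).trans (le_of_eq ?_)
        simp only [abs_mul, Real.norm_eq_abs]
    _ ≤ _ := by
        have := integral_mul_norm_le_Lp_mul_Lq (μ := μ) (p := 2) (q := 2) (f := f) (g := g)
          (Real.HolderConjugate.two_two) (by simpa using hf) (by simpa using hg)
        refine this.trans (le_of_eq ?_)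
        simp only [Real.sqrt_eq_rpow, Real.rpow_two, Real.norm_eq_abs, sq_abs]

theorem sq_integral_mul_le {f g : Z → ℝ} (hf : MemLp f 2 μ) (hg : MemLp g 2 μ) :
    (∫ z, f z * g z ∂μ) ^ 2 ≤ (∫ z, f z ^ 2 ∂μ) * ∫ z, g z ^ 2 ∂μ := by
  have h := abs_integral_mul_le hf hg
  rw [← sq_abs]
  calc |∫ z, f z * g z ∂μ| ^ 2 ≤ (√(∫ z, f z ^ 2 ∂μ) * √(∫ z, g z ^ 2 ∂μ)) ^ 2 := by gcongr
    _ = _ := by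
      rw [mul_pow, Real.sq_sqrt (integral_nonneg fun z => sq_nonneg _),
        Real.sq_sqrt (integral_nonneg fun z => sq_nonneg _)]

end L2

end PartialInterference

namespace PartialInterference

/-! ### Differentiability in quadratic mean and derivatives of means. -/

section DQM

variable {Z : Type*} [MeasurableSpace Z] {μ : Measure Z} {E : Type*} [NormedAddCommGroup E]
  [InnerProductSpace ℝ E]

/-- Likelihood ratios `r η` to `μ`, bounded near `η = 0` and differentiable in quadratic mean there
with score `s`. -/
structure IsDQM (μ : Measure Z) (r : E → Z → ℝ) (s : Z → E) (C : ℝ) : Prop where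
  pos : 0 < C
  measurable : ∀ η, Measurable (r η)
  score : MemLp s 2 μ
  bounds : ∀ᶠ η in 𝓝 0, ∀ᵐ z ∂μ, C⁻¹ ≤ r η z ∧ r η z ≤ C
  littleO : (fun η => ∫ z, (√(r η z) - 1 - 2⁻¹ * inner ℝ η (s z)) ^ 2 ∂μ)
    =o[𝓝 0] (fun η => ‖η‖ ^ 2)

theorem memLp_of_ae_abs_le [IsFiniteMeasure μ] {f : Z → ℝ} (hf : Measurable f) {C : ℝ}
    (h : ∀ᵐ z ∂μ, |f z| ≤ C) {p : ENNReal} : MemLp f p μ :=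
  MemLp.of_bound hf.aestronglyMeasurable C (by simpa [Real.norm_eq_abs] using h)

theorem memLp_mul_of_ae_abs_le {f b : Z → ℝ} (hf : MemLp f 2 μ) (hb : Measurable b) {C : ℝ}
    (h : ∀ᵐ z ∂μ, |b z| ≤ C) : MemLp (fun z => f z * b z) 2 μ := by
  refine hf.of_le_mul (c := C) (hf.1.mul hb.aestronglyMeasurable) ?_
  filter_upwards [h] with z hz
  rw [norm_mul, mul_comm]
  gcongr
  simpa using hz

theorem abs_sqrt_sub_one_le {x : ℝ} (hx : 0 ≤ x) : |√x - 1| ≤ |x - 1| := by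
  have h : x - 1 = (√x - 1) * (√x + 1) := by
    have := Real.mul_self_sqrt hx
    linarith
  rw [h, abs_mul]
  have h1 : 1 ≤ |√x + 1| := by
    rw [abs_of_nonneg (by positivity)]
    linarith [Real.sqrt_nonneg x]
  nlinarith [abs_nonneg (√x - 1)]

theorem sq_sub_one_le {x C : ℝ} (hx : 0 ≤ x) (hC : x ≤ C) :
    (x - 1) ^ 2 ≤ (√C + 1) ^ 2 * (√x - 1) ^ 2 := by
  have h : x - 1 = (√x + 1) * (√x - 1) := by
    have := Real.mul_self_sqrt hx
    linarith
  rw [h, mul_pow]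
  have := Real.sqrt_le_sqrt hC
  gcongr

theorem abs_sub_one_le_of_bounds {x C : ℝ} (hC : 0 < C) (h : C⁻¹ ≤ x ∧ x ≤ C) :
    |x - 1| ≤ C + 1 := by
  have : 0 < C⁻¹ := by positivity
  rw [abs_le]
  constructor <;> linarith [h.1, h.2]

variable {r : E → Z → ℝ} {s : Z → E} {C : ℝ}

theorem IsDQM.measurable_sub (h : IsDQM μ r s C) (η : E) : Measurable fun z => r η z - 1 :=
  (h.measurable η).sub_const 1

theorem IsDQM.abs_sub_one_le (h : IsDQM μ r s C) :
    ∀ᶠ η in 𝓝 0, ∀ᵐ z ∂μ, |r η z - 1| ≤ C + 1 := by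
  filter_upwards [h.bounds] with η hη
  filter_upwards [hη] with z hz using abs_sub_one_le_of_bounds h.pos hz

theorem memLp_inner_left {s : Z → E} (hs : MemLp s 2 μ) (η : E) :
    MemLp (fun z => inner ℝ η (s z)) 2 μ :=
  hs.const_inner η

/-- The likelihood ratio differs from one by `O(‖η‖)` in mean square. -/
theorem IsDQM.integral_sq_le [IsFiniteMeasure μ] (h : IsDQM μ r s C) :
    ∃ D, 0 ≤ D ∧ ∀ᶠ η in 𝓝 0, ∫ z, (r η z - 1) ^ 2 ∂μ ≤ D * ‖η‖ ^ 2 := by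
  -- The factor `(√C + 1) ^ 2` passes from `√r - 1` to `r - 1`. In the bracket, `2` belongs to the
  -- quadratic mean remainder, eventually at most `‖η‖ ^ 2`, and the other term to the linear part
  -- `2⁻¹ * inner ℝ η s`.
  refine ⟨(√C + 1) ^ 2 * (2 + 2⁻¹ * ∫ z, ‖s z‖ ^ 2 ∂μ), by positivity, ?_⟩
  filter_upwards [h.bounds, h.littleO.def one_pos, h.abs_sub_one_le] with η hη ho hb
  have hu0 : MemLp (fun z => √(r η z) - 1) 2 μ := by
    refine memLp_of_ae_abs_le (C := C + 1) (by have := h.measurable η; fun_prop) ?_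
    filter_upwards [hη, hb] with z hz hz'
    exact (abs_sqrt_sub_one_le ((inv_pos.2 h.pos).le.trans hz.1)).trans hz'
  have hi : MemLp (fun z => 2⁻¹ * inner ℝ η (s z)) 2 μ := (memLp_inner_left h.score η).const_mul _
  have hu : MemLp (fun z => √(r η z) - 1 - 2⁻¹ * inner ℝ η (s z)) 2 μ := hu0.sub hi
  have hs2 : Integrable (fun z => ‖s z‖ ^ 2) μ := h.score.integrable_norm_pow (by norm_num)
  rw [one_mul, Real.norm_of_nonneg (integral_nonneg fun z => sq_nonneg _),
    Real.norm_of_nonneg (by positivity)] at ho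
  calc ∫ z, (r η z - 1) ^ 2 ∂μ
      ≤ ∫ z, (√C + 1) ^ 2 * (2 * (√(r η z) - 1 - 2⁻¹ * inner ℝ η (s z)) ^ 2
          + 2⁻¹ * ‖η‖ ^ 2 * ‖s z‖ ^ 2) ∂μ := by
        refine integral_mono_of_nonneg (ae_of_all _ fun z => sq_nonneg _) ?_ ?_
        · exact ((hu.integrable_sq.const_mul 2).add (hs2.const_mul _)).const_mul _
        · filter_upwards [hη] with z hz
          refine (sq_sub_one_le ((inv_pos.2 h.pos).le.trans hz.1) hz.2).trans ?_
          gcongr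
          have h1 : (inner ℝ η (s z)) ^ 2 ≤ ‖η‖ ^ 2 * ‖s z‖ ^ 2 := by
            rw [← mul_pow, ← sq_abs]
            gcongr
            exact abs_real_inner_le_norm _ _
          nlinarith [sq_nonneg ((√(r η z) - 1 - 2⁻¹ * inner ℝ η (s z)) - 2⁻¹ * inner ℝ η (s z))]
    _ = (√C + 1) ^ 2 * (2 * ∫ z, (√(r η z) - 1 - 2⁻¹ * inner ℝ η (s z)) ^ 2 ∂μ
          + 2⁻¹ * ‖η‖ ^ 2 * ∫ z, ‖s z‖ ^ 2 ∂μ) := by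
        rw [integral_const_mul, integral_add (hu.integrable_sq.const_mul 2) (hs2.const_mul _),
          integral_const_mul, integral_const_mul]
    _ ≤ (√C + 1) ^ 2 * (2 * ‖η‖ ^ 2 + 2⁻¹ * ‖η‖ ^ 2 * ∫ z, ‖s z‖ ^ 2 ∂μ) := by gcongr
    _ = _ := by ring

theorem IsDQM.memLp_sub_one [IsFiniteMeasure μ] (h : IsDQM μ r s C) :
    ∀ᶠ η in 𝓝 0, MemLp (fun z => r η z - 1) 2 μ := by
  filter_upwards [h.abs_sub_one_le] with η hη
  exact memLp_of_ae_abs_le (h.measurable_sub η) hη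

theorem IsDQM.memLp_mul_sub_one (h : IsDQM μ r s C) {f : Z → ℝ} (hf : MemLp f 2 μ) :
    ∀ᶠ η in 𝓝 0, MemLp (fun z => f z * (r η z - 1)) 2 μ := by
  filter_upwards [h.abs_sub_one_le] with η hη
  exact memLp_mul_of_ae_abs_le hf (h.measurable_sub η) hη

/-- A square integrable function times the likelihood ratio minus one vanishes in mean square. -/
theorem IsDQM.tendsto_integral_sq [IsFiniteMeasure μ] (h : IsDQM μ r s C) {f : Z → ℝ}
    (hf : MemLp f 2 μ) :
    Tendsto (fun η => ∫ z, (f z * (r η z - 1)) ^ 2 ∂μ) (𝓝 0) (𝓝 0) := by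
  obtain ⟨D, hD0, hD⟩ := h.integral_sq_le
  have hC := h.pos
  rw [Metric.tendsto_nhds]
  intro ε hε
  obtain ⟨δ, hδ, hδε⟩ : ∃ δ : ℝ, 0 < δ ∧ 2 * (C + 1) ^ 2 * δ ^ 2 < ε / 2 := by
    refine ⟨√(ε / (8 * (C + 1) ^ 2)), by positivity, ?_⟩
    rw [Real.sq_sqrt (by positivity)]
    have : 2 * (C + 1) ^ 2 * (ε / (8 * (C + 1) ^ 2)) = ε / 4 := by field_simp; norm_num
    linarith
  -- As `f` need not be bounded, it is split into a bounded `g` and a small rest. On the rest `r -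
  -- 1` is bounded by `C + 1`; on `g` the bound `D * ‖η‖ ^ 2` applies.
  obtain ⟨g, hg, hg2⟩ := hf.exists_simpleFunc_eLpNorm_sub_lt (by norm_num)
    (ε := ENNReal.ofReal δ) (by simpa using hδ)
  obtain ⟨B, hB⟩ := g.exists_forall_norm_le
  have hfg : MemLp (fun z => f z - g z) 2 μ := hf.sub hg2
  have hfgI : ∫ z, (f z - g z) ^ 2 ∂μ ≤ δ ^ 2 := by
    have h1 := hfg.eLpNorm_eq_integral_rpow_norm (by norm_num) (by norm_num)
    have h2 : eLpNorm (fun z => f z - g z) 2 μ < ENNReal.ofReal δ := hg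
    rw [h1, ENNReal.ofReal_lt_ofReal_iff hδ] at h2
    simp only [ENNReal.toReal_ofNat, Real.rpow_two, Real.norm_eq_abs, sq_abs] at h2
    rw [← one_div, ← Real.sqrt_eq_rpow] at h2
    exact (Real.sqrt_le_left hδ.le).1 h2.le
  have hlim : ∀ᶠ η : E in 𝓝 0, 2 * B ^ 2 * (D * ‖η‖ ^ 2) < ε / 2 := by
    have : Tendsto (fun η : E => 2 * B ^ 2 * (D * ‖η‖ ^ 2)) (𝓝 0) (𝓝 (2 * B ^ 2 * (D * ‖(0:E)‖ ^ 2))) :=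
      Continuous.tendsto (by fun_prop) 0
    refine this.eventually (gt_mem_nhds ?_)
    simp [hε]
  filter_upwards [hD, hlim, h.abs_sub_one_le, h.memLp_sub_one] with η h1 h2 h3 h4
  rw [Real.dist_0_eq_abs, abs_of_nonneg (integral_nonneg fun z => sq_nonneg _)]
  calc ∫ z, (f z * (r η z - 1)) ^ 2 ∂μ
      ≤ ∫ z, (2 * (C + 1) ^ 2 * (f z - g z) ^ 2 + 2 * B ^ 2 * (r η z - 1) ^ 2) ∂μ := by
        refine integral_mono_of_nonneg (ae_of_all _ fun z => sq_nonneg _) ?_ ?_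
        · exact (hfg.integrable_sq.const_mul _).add (h4.integrable_sq.const_mul _)
        · filter_upwards [h3] with z hz
          have e1 : (r η z - 1) ^ 2 ≤ (C + 1) ^ 2 := by
            rw [← sq_abs]; gcongr
          have e2 : g z ^ 2 ≤ B ^ 2 := by
            rw [← sq_abs]; gcongr; exact hB z
          calc (f z * (r η z - 1)) ^ 2
              ≤ 2 * (f z - g z) ^ 2 * (r η z - 1) ^ 2 + 2 * g z ^ 2 * (r η z - 1) ^ 2 := by
                nlinarith [sq_nonneg ((f z - g z - g z) * (r η z - 1))]
            _ ≤ 2 * (f z - g z) ^ 2 * (C + 1) ^ 2 + 2 * B ^ 2 * (r η z - 1) ^ 2 := by gcongr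
            _ = _ := by ring
    _ = 2 * (C + 1) ^ 2 * ∫ z, (f z - g z) ^ 2 ∂μ + 2 * B ^ 2 * ∫ z, (r η z - 1) ^ 2 ∂μ := by
        rw [integral_add (hfg.integrable_sq.const_mul _) (h4.integrable_sq.const_mul _),
          integral_const_mul, integral_const_mul]
    _ ≤ 2 * (C + 1) ^ 2 * δ ^ 2 + 2 * B ^ 2 * (D * ‖η‖ ^ 2) := by gcongr
    _ < ε := by linarith

/-- The score represents the derivative of the mean of a square integrable function. -/
theorem IsDQM.integral_mul_sub_isLittleO [IsFiniteMeasure μ] (h : IsDQM μ r s C) {f : Z → ℝ}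
    (hf : MemLp f 2 μ) :
    (fun η => ∫ z, f z * (r η z - 1) ∂μ - ∫ z, f z * inner ℝ η (s z) ∂μ)
      =o[𝓝 0] (fun η => η) := by
  obtain ⟨D, hD0, hD⟩ := h.integral_sq_le
  have hlim : Tendsto (fun η => 2 * √(∫ z, f z ^ 2 ∂μ) *
      √((∫ z, (√(r η z) - 1 - 2⁻¹ * inner ℝ η (s z)) ^ 2 ∂μ) / ‖η‖ ^ 2)
      + √(∫ z, (f z * (r η z - 1)) ^ 2 ∂μ) * √D) (𝓝 0) (𝓝 0) := by
    have h1 := h.littleO.tendsto_div_nhds_zero.sqrt.const_mul (2 * √(∫ z, f z ^ 2 ∂μ))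
    have h2 := (h.tendsto_integral_sq hf).sqrt.mul_const (√D)
    simpa using h1.add h2
  rw [isLittleO_iff]
  intro c hc
  filter_upwards [h.bounds, h.abs_sub_one_le, h.memLp_sub_one, h.memLp_mul_sub_one hf, hD,
    hlim.eventually (gt_mem_nhds hc)] with η hη hb h2 h4 hDη hcη
  have hu0 : MemLp (fun z => √(r η z) - 1) 2 μ := by
    refine memLp_of_ae_abs_le (C := C + 1) (by have := h.measurable η; fun_prop) ?_
    filter_upwards [hη, hb] with z hz hz'
    exact (abs_sqrt_sub_one_le ((inv_pos.2 h.pos).le.trans hz.1)).trans hz'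
  have hi0 := memLp_inner_left h.score η
  have hi : MemLp (fun z => 2⁻¹ * inner ℝ η (s z)) 2 μ := hi0.const_mul _
  have hu : MemLp (fun z => √(r η z) - 1 - 2⁻¹ * inner ℝ η (s z)) 2 μ := hu0.sub hi
  -- Splitting the square this way prepares a Cauchy–Schwarz bound in which `f (r - 1)` is `o(1)`
  -- and `r - 1` is `O(‖η‖)`.
  have hle : ∀ᵐ z ∂μ, |f z * (√(r η z) - 1) ^ 2| ≤ |f z * (r η z - 1)| * |r η z - 1| := by
    filter_upwards [hη] with z hz
    rw [abs_mul, abs_mul, abs_pow, sq, mul_assoc]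
    have := abs_sqrt_sub_one_le ((inv_pos.2 h.pos).le.trans hz.1)
    gcongr
  have i0 : Integrable (fun z => |f z * (r η z - 1)| * |r η z - 1|) μ :=
    integrable_mul_of_memLp h4.abs h2.abs
  have i1 : Integrable (fun z => f z * (√(r η z) - 1) ^ 2) μ :=
    i0.mono' (hf.1.mul (hu0.1.pow 2)) hle
  -- This rests on `r - 1 = 2 (√r - 1) + (√r - 1) ^ 2`: twice the linear part of `√r - 1` is the
  -- score, and the square is of smaller order.
  have e : ∫ z, f z * (r η z - 1) ∂μ - ∫ z, f z * inner ℝ η (s z) ∂μ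
      = 2 * ∫ z, f z * (√(r η z) - 1 - 2⁻¹ * inner ℝ η (s z)) ∂μ
        + ∫ z, f z * (√(r η z) - 1) ^ 2 ∂μ := by
    rw [← integral_sub (integrable_mul_of_memLp hf h2) (integrable_mul_of_memLp hf hi0),
      ← integral_const_mul, ← integral_add ((integrable_mul_of_memLp hf hu).const_mul 2) i1]
    refine integral_congr_ae ?_
    filter_upwards [hη] with z hz
    have := Real.mul_self_sqrt ((inv_pos.2 h.pos).le.trans hz.1)
    have e2 : r η z - 1 = 2 * (√(r η z) - 1) + (√(r η z) - 1) ^ 2 := by linarith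
    rw [e2]; ring
  have b1 := abs_integral_mul_le hf hu
  have b2 : |∫ z, f z * (√(r η z) - 1) ^ 2 ∂μ|
      ≤ √(∫ z, (f z * (r η z - 1)) ^ 2 ∂μ) * √(∫ z, (r η z - 1) ^ 2 ∂μ) := by
    calc |∫ z, f z * (√(r η z) - 1) ^ 2 ∂μ|
        ≤ ∫ z, |f z * (r η z - 1)| * |r η z - 1| ∂μ :=
          abs_integral_le_integral_abs.trans (integral_mono_ae i1.abs i0 hle)
      _ ≤ _ := (le_abs_self _).trans (by
        simpa only [Pi.abs_apply, sq_abs] using abs_integral_mul_le h4.abs h2.abs)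
  have b3 : √(∫ z, (√(r η z) - 1 - 2⁻¹ * inner ℝ η (s z)) ^ 2 ∂μ) ≤
      √((∫ z, (√(r η z) - 1 - 2⁻¹ * inner ℝ η (s z)) ^ 2 ∂μ) / ‖η‖ ^ 2) * ‖η‖ := by
    -- At `η = 0` the quotient by `‖η‖ ^ 2` is `0`, so the remainder itself must vanish. It does,
    -- because the bound `D * ‖η‖ ^ 2` forces `r 0 = 1` almost everywhere.
    by_cases h0 : η = 0
    · subst h0
      rw [show (∫ z, (√(r 0 z) - 1 - 2⁻¹ * inner ℝ (0 : E) (s z)) ^ 2 ∂μ) = 0 from ?_]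
      · simp
      · have hz : (fun z => (r 0 z - 1) ^ 2) =ᵐ[μ] 0 := by
          rw [← integral_eq_zero_iff_of_nonneg (fun z => sq_nonneg _) h2.integrable_sq]
          refine le_antisymm (by simpa using hDη) (integral_nonneg fun z => sq_nonneg _)
        refine integral_eq_zero_of_ae ?_
        filter_upwards [hz] with z hz
        have : r 0 z = 1 := by
          have := pow_eq_zero_iff (two_ne_zero) |>.1 hz
          linarith
        simp [this]
    · have : 0 < ‖η‖ := norm_pos_iff.2 h0
      rw [Real.sqrt_div' _ (by positivity), Real.sqrt_sq this.le, div_mul_cancel₀ _ this.ne']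
  have b4 : √(∫ z, (r η z - 1) ^ 2 ∂μ) ≤ √D * ‖η‖ := by
    calc √(∫ z, (r η z - 1) ^ 2 ∂μ) ≤ √(D * ‖η‖ ^ 2) := Real.sqrt_le_sqrt hDη
      _ = √D * ‖η‖ := by rw [Real.sqrt_mul hD0, Real.sqrt_sq (norm_nonneg _)]
  rw [e, Real.norm_eq_abs]
  calc _ ≤ 2 * (√(∫ z, f z ^ 2 ∂μ) *
        (√((∫ z, (√(r η z) - 1 - 2⁻¹ * inner ℝ η (s z)) ^ 2 ∂μ) / ‖η‖ ^ 2) * ‖η‖))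
        + √(∫ z, (f z * (r η z - 1)) ^ 2 ∂μ) * (√D * ‖η‖) := by
        refine (abs_add_le _ _).trans (add_le_add ?_ (b2.trans (by gcongr)))
        rw [abs_mul, abs_two]
        gcongr
        exact b1.trans (by gcongr)
    _ = (2 * √(∫ z, f z ^ 2 ∂μ) *
      √((∫ z, (√(r η z) - 1 - 2⁻¹ * inner ℝ η (s z)) ^ 2 ∂μ) / ‖η‖ ^ 2)
      + √(∫ z, (f z * (r η z - 1)) ^ 2 ∂μ) * √D) * ‖η‖ := by ring
    _ ≤ c * ‖η‖ := by gcongr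

end DQM

end PartialInterference

namespace PartialInterference

/-! ### The tangent space of the nonparametric model. -/

section Tangent

variable {Z : Type} [MeasurableSpace Z]

theorem IsRegularSubmodel.exists_isDQM {P : ProbabilityMeasure Z} {m : ℕ}
    {Q : EuclideanSpace ℝ (Fin m) → ProbabilityMeasure Z} {s : Z → EuclideanSpace ℝ (Fin m)}
    (h : IsRegularSubmodel P Q s) :
    ∃ r C, IsDQM (P : Measure Z) r s C ∧ (∀ᶠ η in 𝓝 0, (Q η : Measure Z) =
      (P : Measure Z).withDensity (fun z => ENNReal.ofReal (r η z))) := by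
  obtain ⟨r, C, hC, hm, hQ, hb, ho⟩ := h.likelihood
  exact ⟨r, C, ⟨hC, hm, h.score_memLp, hb, ho⟩, hQ⟩

/-- A zero function cannot be the score of a one-dimensional submodel with nonsingular information;
the zero-dimensional submodel covers that case. -/
theorem isRegularSubmodel_const (P : ProbabilityMeasure Z) :
    IsRegularSubmodel P (fun _ : EuclideanSpace ℝ (Fin 0) => P) (fun _ => 0) where
  base := rfl
  score_memLp := MemLp.zero
  information c hc := absurd (Subsingleton.elim c 0) hc
  likelihood := by
    refine ⟨fun _ _ => 1, 1, one_pos, fun _ => measurable_const, ?_, ?_, ?_⟩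
    · simp
    · simp
    · simp [isLittleO_iff]

/-- The remainder is exactly `-(√(1 + x) - 1) ^ 2 / 2`, and `|√(1 + x) - 1| ≤ |x|`. Along a linear
submodel this makes the quadratic mean remainder `O(‖η‖ ^ 4)`. -/
theorem sq_sqrt_one_add_sub_le {x : ℝ} (hx : -1 ≤ x) : (√(1 + x) - 1 - 2⁻¹ * x) ^ 2 ≤ x ^ 4 := by
  have h0 : 0 ≤ 1 + x := by linarith
  have h1 := Real.mul_self_sqrt h0
  have h2 := abs_sqrt_sub_one_le h0
  have h3 : (√(1 + x) - 1) ^ 2 ≤ x ^ 2 := by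
    rw [← sq_abs, ← sq_abs x]
    have : |1 + x - 1| = |x| := by ring_nf
    rw [this] at h2
    gcongr
  have h4 : √(1 + x) - 1 - 2⁻¹ * x = -2⁻¹ * (√(1 + x) - 1) ^ 2 := by linarith
  rw [h4]
  calc (-2⁻¹ * (√(1 + x) - 1) ^ 2) ^ 2 = 4⁻¹ * ((√(1 + x) - 1) ^ 2) ^ 2 := by ring
    _ ≤ 1 * (x ^ 2) ^ 2 := by gcongr; norm_num
    _ = x ^ 4 := by ring

/-- The likelihood ratio `1 + η b` of the linear submodel with score `b`, for small `η`. -/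
noncomputable def linearRatio {Z : Type} (b : Z → ℝ) (B : ℝ) (η : EuclideanSpace ℝ (Fin 1)) (z : Z) : ℝ :=
  if |η 0| * B ≤ 2⁻¹ then 1 + η 0 * b z else 1

theorem measurable_linearRatio {b : Z → ℝ} (hb : Measurable b) (B : ℝ)
    (η : EuclideanSpace ℝ (Fin 1)) : Measurable (linearRatio b B η) := by
  unfold linearRatio
  split_ifs <;> fun_prop

theorem linearRatio_bounds {Z : Type} {b : Z → ℝ} {B : ℝ} (hB : ∀ z, |b z| ≤ B)
    (η : EuclideanSpace ℝ (Fin 1)) (z : Z) :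
    2⁻¹ ≤ linearRatio b B η z ∧ linearRatio b B η z ≤ 2 := by
  unfold linearRatio
  split_ifs with h
  · have : |η 0 * b z| ≤ 2⁻¹ := by
      rw [abs_mul]
      refine le_trans ?_ h
      gcongr
      exact hB z
    rw [abs_le] at this
    constructor <;> linarith [this.1, this.2]
  · constructor <;> norm_num

theorem integral_linearRatio {P : ProbabilityMeasure Z} {b : Z → ℝ} (B : ℝ)
    (hint : Integrable b (P : Measure Z)) (h0 : ∫ z, b z ∂(P : Measure Z) = 0)
    (η : EuclideanSpace ℝ (Fin 1)) : ∫ z, linearRatio b B η z ∂(P : Measure Z) = 1 := by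
  unfold linearRatio
  split_ifs
  · rw [integral_add (integrable_const _) (hint.const_mul _), integral_const_mul, h0]
    simp
  · simp

/-- A bounded function with mean zero that is not almost surely zero is the score of a regular
submodel. -/
theorem exists_isRegularSubmodel (P : ProbabilityMeasure Z) {b : Z → ℝ} (hb : Measurable b) {B : ℝ}
    (hB : ∀ z, |b z| ≤ B) (h0 : ∫ z, b z ∂(P : Measure Z) = 0)
    (hne : ¬ b =ᵐ[(P : Measure Z)] 0) :
    ∃ Q : EuclideanSpace ℝ (Fin 1) → ProbabilityMeasure Z,
      IsRegularSubmodel P Q (fun z => EuclideanSpace.single 0 (b z)) := by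
  have hb2 : MemLp b 2 (P : Measure Z) := memLp_of_ae_abs_le hb (ae_of_all _ hB)
  have hint : Integrable b (P : Measure Z) := hb2.integrable (by norm_num)
  have hrI : ∀ η, Integrable (linearRatio b B η) (P : Measure Z) := fun η =>
    (memLp_of_ae_abs_le (measurable_linearRatio hb B η) (C := 2) (p := 1) (ae_of_all _ fun z => by
      have := linearRatio_bounds hB η z
      rw [abs_of_nonneg (by linarith [this.1])]
      exact this.2)).integrable le_rfl
  -- Holds for every `η`, not only near `0`, because `linearRatio` is replaced by `1` where `1 + η
  -- b` might fail to be positive.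
  have hprob : ∀ η, IsProbabilityMeasure
      ((P : Measure Z).withDensity fun z => ENNReal.ofReal (linearRatio b B η z)) := by
    intro η
    refine ⟨?_⟩
    rw [withDensity_apply _ MeasurableSet.univ, Measure.restrict_univ,
      ← ofReal_integral_eq_lintegral_ofReal (hrI η) (ae_of_all _ fun z =>
        le_trans (by norm_num) (linearRatio_bounds hB η z).1),
      integral_linearRatio B hint h0, ENNReal.ofReal_one]
  have hinner : ∀ (c : EuclideanSpace ℝ (Fin 1)) z,
      inner ℝ c (EuclideanSpace.single 0 (b z)) = c 0 * b z := by
    intro c z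
    simp [EuclideanSpace.inner_single_right, mul_comm]
  refine ⟨fun η => ⟨_, hprob η⟩, ?_, ?_, ?_, ?_⟩
  · ext s hs
    simp [linearRatio]
  · refine MemLp.of_bound ?_ B (ae_of_all _ fun z => by simpa using hB z)
    have : Measurable fun z => EuclideanSpace.single (0 : Fin 1) (b z) := by
      have h : Measurable fun x : ℝ => EuclideanSpace.single (0 : Fin 1) x := by
        refine Continuous.measurable ?_
        refine (PiLp.continuous_toLp 2 _).comp ?_
        exact continuous_single (A := fun _ : Fin 1 => ℝ) 0
      exact h.comp hb
    exact this.aestronglyMeasurable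
  · intro c hc
    have hc0 : c 0 ≠ 0 := by
      intro h
      apply hc
      ext i
      rw [Subsingleton.elim i 0, h]
      rfl
    simp only [hinner]
    rw [integral_pos_iff_support_of_nonneg (fun z => sq_nonneg _)
      (hb2.const_mul _).integrable_sq, pos_iff_ne_zero]
    intro h
    apply hne
    rw [Filter.EventuallyEq, ae_iff]
    convert! h using 2
    ext z
    simp [hc0]
  · refine ⟨linearRatio b B, 2, two_pos, measurable_linearRatio hb B, ?_, ?_, ?_⟩
    · exact Eventually.of_forall fun η => rfl
    · exact Eventually.of_forall fun η => ae_of_all _ fun z => linearRatio_bounds hB η z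
    · have hsmall : ∀ᶠ η : EuclideanSpace ℝ (Fin 1) in 𝓝 0, |η 0| * B ≤ 2⁻¹ := by
        have : Tendsto (fun η : EuclideanSpace ℝ (Fin 1) => |η 0| * B) (𝓝 0)
            (𝓝 (|(0 : EuclideanSpace ℝ (Fin 1)) 0| * B)) := Continuous.tendsto (by fun_prop) 0
        exact (this.eventually (gt_mem_nhds (by simp))).mono fun _ h => h.le
      have hO : (fun η : EuclideanSpace ℝ (Fin 1) => ∫ z, (√(linearRatio b B η z) - 1 - 2⁻¹ *
          inner ℝ η (EuclideanSpace.single 0 (b z))) ^ 2 ∂(P : Measure Z))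
          =O[𝓝 0] (fun η => ‖η‖ ^ 4) := by
        refine IsBigO.of_bound (B ^ 4) ?_
        filter_upwards [hsmall] with η hη
        rw [Real.norm_of_nonneg (integral_nonneg fun z => sq_nonneg _),
          Real.norm_of_nonneg (by positivity)]
        have hle : ∀ z, (√(linearRatio b B η z) - 1 - 2⁻¹ *
            inner ℝ η (EuclideanSpace.single 0 (b z))) ^ 2 ≤ B ^ 4 * ‖η‖ ^ 4 := by
          intro z
          have hab : |η 0 * b z| ≤ B * ‖η‖ := by
            rw [abs_mul, mul_comm]
            have := EuclideanSpace.norm_eq η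
            have h1 : |η 0| ≤ ‖η‖ := PiLp.norm_apply_le η 0
            exact mul_le_mul (hB z) h1 (abs_nonneg _) ((abs_nonneg _).trans (hB z))
          have hab' : |η 0 * b z| ≤ 2⁻¹ := by
            rw [abs_mul]
            refine le_trans ?_ hη
            gcongr
            exact hB z
          rw [hinner, linearRatio, if_pos hη]
          refine (sq_sqrt_one_add_sub_le (by linarith [(abs_le.1 hab').1])).trans ?_
          rw [← mul_pow, ← Even.pow_abs (by decide : Even 4)]
          gcongr
        calc _ ≤ ∫ z, B ^ 4 * ‖η‖ ^ 4 ∂(P : Measure Z) := by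
              refine integral_mono_of_nonneg (ae_of_all _ fun z => sq_nonneg _)
                (integrable_const _) (ae_of_all _ hle)
          _ = _ := by simp
      refine hO.trans_isLittleO ?_
      have : (fun x : ℝ => x ^ 4) =o[𝓝 0] fun x : ℝ => x ^ 2 := isLittleO_pow_pow (by norm_num)
      exact this.comp_tendsto tendsto_norm_zero

/-- In the nonparametric model, every square integrable function with mean zero belongs to the
tangent space. -/
theorem inTangentSpace_of_integral_eq_zero (P : ProbabilityMeasure Z) {φ : Z → ℝ}
    (hφ : MemLp φ 2 (P : Measure Z)) (h0 : ∫ z, φ z ∂(P : Measure Z) = 0) :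
    InTangentSpace P φ := by
  refine ⟨hφ, fun ε hε => ?_⟩
  obtain ⟨δ, hδ, hδε⟩ : ∃ δ : ℝ, 0 < δ ∧ δ ^ 2 < ε := by
    refine ⟨√(ε / 2), by positivity, ?_⟩
    rw [Real.sq_sqrt (by positivity)]
    linarith
  obtain ⟨g, hg, hg2⟩ := hφ.exists_simpleFunc_eLpNorm_sub_lt (by norm_num)
    (ε := ENNReal.ofReal δ) (by simpa using hδ)
  obtain ⟨B, hB⟩ := g.exists_forall_norm_le
  have hfg : MemLp (fun z => φ z - g z) 2 (P : Measure Z) := hφ.sub hg2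
  have hfgI : ∫ z, (φ z - g z) ^ 2 ∂(P : Measure Z) ≤ δ ^ 2 := by
    have h1 := hfg.eLpNorm_eq_integral_rpow_norm (by norm_num) (by norm_num)
    have h2 : eLpNorm (fun z => φ z - g z) 2 (P : Measure Z) < ENNReal.ofReal δ := hg
    rw [h1, ENNReal.ofReal_lt_ofReal_iff hδ] at h2
    simp only [ENNReal.toReal_ofNat, Real.rpow_two, Real.norm_eq_abs, sq_abs] at h2
    rw [← one_div, ← Real.sqrt_eq_rpow] at h2
    exact (Real.sqrt_le_left hδ.le).1 h2.le
  have hgI : Integrable g (P : Measure Z) := hg2.integrable (by norm_num)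
  set c : ℝ := ∫ z, g z ∂(P : Measure Z)
  -- Scores have mean zero, so the simple function must be centered. As `φ` has mean zero, this
  -- replaces the second moment of `φ - g` by its variance, which is no larger.
  have hcent : ∫ z, (φ z - (g z - c)) ^ 2 ∂(P : Measure Z) < ε := by
    have hmean : ∫ z, (φ z - g z) ∂(P : Measure Z) = -c := by
      rw [integral_sub (hφ.integrable (by norm_num)) hgI, h0, zero_sub]
    have hv := variance_eq_integral (μ := (P : Measure Z)) hfg.1.aemeasurable
    rw [hmean] at hv
    have hv2 := variance_le_expectation_sq (μ := (P : Measure Z)) hfg.1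
    calc ∫ z, (φ z - (g z - c)) ^ 2 ∂(P : Measure Z)
        = ∫ z, (φ z - g z - -c) ^ 2 ∂(P : Measure Z) := by congr with z; ring
      _ ≤ ∫ z, (φ z - g z) ^ 2 ∂(P : Measure Z) := by rw [← hv]; exact hv2
      _ < ε := hfgI.trans_lt hδε
  -- A null `g - c` would have zero information, so the zero-dimensional submodel is used instead.
  by_cases hz : (fun z => g z - c) =ᵐ[(P : Measure Z)] 0
  · refine ⟨0, _, _, 0, isRegularSubmodel_const P, ?_⟩
    refine lt_of_eq_of_lt (integral_congr_ae ?_) hcent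
    filter_upwards [hz] with z hz
    have : g z - c = 0 := hz
    simp [this]
  · obtain ⟨Q, hQ⟩ := exists_isRegularSubmodel P (b := fun z => g z - c)
      (g.measurable.sub_const c) (B := B + |c|)
      (fun z => (abs_sub _ _).trans (by gcongr; exact hB z))
      (by rw [integral_sub hgI (integrable_const _)]; simp [c]) hz
    refine ⟨1, Q, _, EuclideanSpace.single 0 1, hQ, ?_⟩
    refine lt_of_eq_of_lt ?_ hcent
    simp [EuclideanSpace.inner_single_right]

end Tangent

end PartialInterference

namespace PartialInterference

/-! ### Laws tilted by a density bounded away from zero and infinity. -/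

section Density

variable {Z : Type*} [MeasurableSpace Z] {ν : Measure Z} {ρ : Z → ℝ} {C : ℝ}

/-- `ν` multiplied by the density `ρ`. -/
noncomputable def tilt (ν : Measure Z) (ρ : Z → ℝ) : Measure Z :=
  ν.withDensity fun z => ENNReal.ofReal (ρ z)

/-- The density `ρ` stays away from `0` and `∞`. -/
structure BddDensity (ν : Measure Z) (ρ : Z → ℝ) (C : ℝ) : Prop where
  pos : 0 < C
  measurable : Measurable ρ
  bounds : ∀ᵐ z ∂ν, C⁻¹ ≤ ρ z ∧ ρ z ≤ C

theorem BddDensity.nonneg (h : BddDensity ν ρ C) : ∀ᵐ z ∂ν, 0 ≤ ρ z := by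
  filter_upwards [h.bounds] with z hz using (inv_pos.2 h.pos).le.trans hz.1

theorem BddDensity.integrable_iff (h : BddDensity ν ρ C) (f : Z → ℝ) :
    Integrable f (tilt ν ρ) ↔ Integrable (fun z => ρ z * f z) ν := by
  rw [tilt, integrable_withDensity_iff_integrable_smul' (by have := h.measurable; fun_prop)
    (ae_of_all _ fun z => ENNReal.ofReal_lt_top)]
  refine integrable_congr ?_
  filter_upwards [h.nonneg] with z hz
  simp [ENNReal.toReal_ofReal hz]

theorem BddDensity.integral_eq (h : BddDensity ν ρ C) (f : Z → ℝ) :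
    ∫ z, f z ∂(tilt ν ρ) = ∫ z, ρ z * f z ∂ν := by
  rw [tilt, integral_withDensity_eq_integral_toReal_smul (by have := h.measurable; fun_prop)
    (ae_of_all _ fun z => ENNReal.ofReal_lt_top)]
  refine integral_congr_ae ?_
  filter_upwards [h.nonneg] with z hz
  simp [ENNReal.toReal_ofReal hz]

theorem BddDensity.tilt_le (h : BddDensity ν ρ C) : tilt ν ρ ≤ ENNReal.ofReal C • ν := by
  rw [tilt, ← withDensity_const]
  refine withDensity_mono ?_
  filter_upwards [h.bounds] with z hz using ENNReal.ofReal_le_ofReal hz.2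

theorem BddDensity.le_tilt (h : BddDensity ν ρ C) : ν ≤ ENNReal.ofReal C • tilt ν ρ := by
  rw [tilt, ← withDensity_smul _ (by have := h.measurable; fun_prop)]
  conv_lhs => rw [← withDensity_one (μ := ν)]
  refine withDensity_mono ?_
  filter_upwards [h.bounds] with z hz
  simp only [Pi.one_apply, Pi.smul_apply, smul_eq_mul]
  rw [← ENNReal.ofReal_mul h.pos.le, ENNReal.one_le_ofReal]
  calc 1 = C * C⁻¹ := (mul_inv_cancel₀ h.pos.ne').symm
    _ ≤ C * ρ z := by have := h.pos; gcongr; exact hz.1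

/-- Each of the two measures is at most `C` times the other. This is what makes moments persist
along a regular submodel. -/
theorem BddDensity.memLp_iff (h : BddDensity ν ρ C) (f : Z → ℝ) (p : ENNReal) :
    MemLp f p (tilt ν ρ) ↔ MemLp f p ν :=
  ⟨fun hf => hf.of_measure_le_smul ENNReal.ofReal_ne_top h.le_tilt,
    fun hf => hf.of_measure_le_smul ENNReal.ofReal_ne_top h.tilt_le⟩

theorem BddDensity.integrable_tilt_iff (h : BddDensity ν ρ C) (f : Z → ℝ) :
    Integrable f (tilt ν ρ) ↔ Integrable f ν := by
  rw [← memLp_one_iff_integrable, ← memLp_one_iff_integrable, h.memLp_iff]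

theorem BddDensity.isFiniteMeasure_tilt [IsFiniteMeasure ν] (h : BddDensity ν ρ C) :
    IsFiniteMeasure (tilt ν ρ) :=
  have : IsFiniteMeasure (ENNReal.ofReal C • ν) := ν.smul_finite ENNReal.ofReal_ne_top
  isFiniteMeasure_of_le _ h.tilt_le

end Density

section Cluster

variable {n d : ℕ} {ν : Measure (Cluster n d)}

/-! ### Conditional means given treatments and covariates -/

/-- `ζ` is integrable with conditional mean zero given treatments and covariates. -/
structure CondMeanZero (ν : Measure (Cluster n d)) (ζ : Cluster n d → ℝ) : Prop where
  integrable : Integrable ζ ν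
  setIntegral : ∀ s : Set (Trt n × Cov n d), MeasurableSet s →
    ∫ o in (fun o : Cluster n d => o.2) ⁻¹' s, ζ o ∂ν = 0

theorem comap_treatCov_le : MeasurableSpace.comap (fun o : Cluster n d => o.2) inferInstance
    ≤ (inferInstance : MeasurableSpace (Cluster n d)) :=
  Measurable.comap_le measurable_snd

theorem CondMeanZero.condExp_eq [IsFiniteMeasure ν] {ζ : Cluster n d → ℝ}
    (h : CondMeanZero ν ζ) :
    ν[ζ | MeasurableSpace.comap (fun o : Cluster n d => o.2) inferInstance] =ᵐ[ν] 0 := by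
  symm
  refine ae_eq_condExp_of_forall_setIntegral_eq comap_treatCov_le h.integrable ?_ ?_ ?_
  · exact fun _ _ _ => integrableOn_zero
  · rintro s ⟨t, ht, rfl⟩ _
    rw [h.setIntegral t ht]
    simp
  · exact stronglyMeasurable_zero.aestronglyMeasurable

/-- Functions of treatments and covariates are orthogonal to functions with conditional mean
zero. -/
theorem CondMeanZero.integral_mul_eq_zero [IsFiniteMeasure ν] {ζ : Cluster n d → ℝ}
    (h : CondMeanZero ν ζ) {q : Trt n × Cov n d → ℝ} (hq : Measurable q)
    (hi : Integrable (fun o => q o.2 * ζ o) ν) : ∫ o, q o.2 * ζ o ∂ν = 0 := by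
  have hqm : StronglyMeasurable[MeasurableSpace.comap (fun o : Cluster n d => o.2) inferInstance]
      (fun o : Cluster n d => q o.2) :=
    (hq.comp (comap_measurable _)).stronglyMeasurable
  have h1 := condExp_mul_of_stronglyMeasurable_left (μ := ν) hqm (g := ζ) hi h.integrable
  rw [← integral_condExp comap_treatCov_le (f := fun o => q o.2 * ζ o)]
  refine integral_eq_zero_of_ae ?_
  filter_upwards [h1, h.condExp_eq] with o h1 h2
  refine (show _ = _ from h1).trans ?_
  simp [h2]

theorem CondMeanZero.sum {ι : Type*} (t : Finset ι) {ζ : ι → Cluster n d → ℝ}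
    (h : ∀ i ∈ t, CondMeanZero ν (ζ i)) : CondMeanZero ν (fun o => ∑ i ∈ t, ζ i o) where
  integrable := integrable_finsetSum _ fun i hi => (h i hi).integrable
  setIntegral s hs := by
    rw [integral_finsetSum _ fun i hi => (h i hi).integrable.integrableOn]
    exact Finset.sum_eq_zero fun i hi => (h i hi).setIntegral s hs

theorem CondMeanZero.mul [IsFiniteMeasure ν] {ζ : Cluster n d → ℝ}
    (h : CondMeanZero ν ζ) {q : Trt n × Cov n d → ℝ} (hq : Measurable q)
    (hi : Integrable (fun o => q o.2 * ζ o) ν) : CondMeanZero ν (fun o => q o.2 * ζ o) where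
  integrable := hi
  setIntegral s hs := by
    rw [← integral_indicator (measurable_snd hs)]
    have := h.integral_mul_eq_zero (q := s.indicator q) (hq.indicator hs) (by
      refine (hi.indicator (measurable_snd hs : MeasurableSet
        ((fun o : Cluster n d => o.2) ⁻¹' s))).congr (ae_of_all _ fun o => ?_)
      by_cases ho : o.2 ∈ s <;> simp [Set.indicator, ho])
    rw [← this]
    congr with o
    by_cases ho : o.2 ∈ s <;> simp [Set.indicator, ho]

theorem CondMeanZero.mul_bdd [IsFiniteMeasure ν] {ζ : Cluster n d → ℝ}
    (h : CondMeanZero ν ζ) {q : Trt n × Cov n d → ℝ} (hq : Measurable q) {B : ℝ}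
    (hB : ∀ᵐ o ∂ν, |q o.2| ≤ B) : CondMeanZero ν (fun o => q o.2 * ζ o) :=
  h.mul hq (h.integrable.bdd_mul (hq.comp measurable_snd).aestronglyMeasurable
    (by simpa [Real.norm_eq_abs] using hB))

/-- Conditional means of square integrable functions are square integrable. -/
theorem CondMeanZero.memLp [IsFiniteMeasure ν] {ε : Cluster n d → ℝ} (hε : MemLp ε 2 ν)
    {h : Trt n × Cov n d → ℝ} (hm : Measurable h) (H : CondMeanZero ν (fun o => ε o - h o.2)) :
    MemLp (fun o => h o.2) 2 ν := by
  have hεi : Integrable ε ν := hε.integrable (by norm_num)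
  have hi : Integrable (fun o => h o.2) ν := by
    refine (hεi.sub H.integrable).congr (ae_of_all _ fun o => ?_)
    simp
  -- Identifies `h` as a conditional expectation of `ε`; conditional expectation maps `L²` to `L²`.
  have : (fun o => h o.2) =ᵐ[ν]
      ν[ε | MeasurableSpace.comap (fun o : Cluster n d => o.2) inferInstance] := by
    refine ae_eq_condExp_of_forall_setIntegral_eq comap_treatCov_le hεi ?_ ?_ ?_
    · exact fun _ _ _ => hi.integrableOn
    · rintro s ⟨t, ht, rfl⟩ _
      have := H.setIntegral t ht
      rw [integral_sub hεi.integrableOn hi.integrableOn] at this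
      linarith
    · exact (hm.comp (comap_measurable _)).stronglyMeasurable.aestronglyMeasurable
  exact (memLp_congr_ae this).2 (hε.condExp (by norm_num))

/-- The change in mean square of a conditional mean when the law is tilted. -/
theorem integral_sq_condMean_le [IsFiniteMeasure ν] {ρ : Cluster n d → ℝ} {C : ℝ}
    (hρ : BddDensity ν ρ C) {ε : Cluster n d → ℝ} (hε : MemLp ε 2 ν) (hε0 : CondMeanZero ν ε)
    {h : Trt n × Cov n d → ℝ} (hm : Measurable h)
    (H : CondMeanZero (tilt ν ρ) (fun o => ε o - h o.2)) :
    MemLp (fun o => h o.2) 2 ν ∧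
      ∫ o, h o.2 ^ 2 ∂ν ≤ C ^ 2 * ∫ o, (ε o * (ρ o - 1)) ^ 2 ∂ν := by
  have := hρ.isFiniteMeasure_tilt
  have hC := hρ.pos
  have hε' := (hρ.memLp_iff ε 2).2 hε
  have hh' := H.memLp hε' hm
  have hh := (hρ.memLp_iff _ 2).1 hh'
  refine ⟨hh, ?_⟩
  have hb : ∀ᵐ o ∂ν, |ρ o - 1| ≤ C + 1 := by
    filter_upwards [hρ.bounds] with o ho using abs_sub_one_le_of_bounds hC ho
  have hε1 : MemLp (fun o => ε o * (ρ o - 1)) 2 ν :=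
    memLp_mul_of_ae_abs_le hε (hρ.measurable.sub_const 1) hb
  have i1 : Integrable (fun o => h o.2 * (ε o - h o.2)) (tilt ν ρ) :=
    integrable_mul_of_memLp hh' (hε'.sub hh')
  have e1 := H.integral_mul_eq_zero hm i1
  have e2 := hε0.integral_mul_eq_zero hm (integrable_mul_of_memLp hh hε)
  have i2 : Integrable (fun o => h o.2 * ε o) (tilt ν ρ) := integrable_mul_of_memLp hh' hε'
  have i3 : Integrable (fun o => h o.2 ^ 2) (tilt ν ρ) := hh'.integrable_sq
  -- Under the tilted law `h` is the projection of `ε`, and under `ν` it is orthogonal to `ε`. Hence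
  -- `C⁻¹ ∫ h² ≤ ∫ h ε (ρ - 1)` with integrals under `ν`, and Cauchy–Schwarz allows one factor `‖h‖`
  -- to be cancelled.
  have e3 : ∫ o, h o.2 ^ 2 ∂(tilt ν ρ) = ∫ o, h o.2 * ε o ∂(tilt ν ρ) := by
    rw [← sub_eq_zero, ← integral_sub i3 i2, ← neg_eq_zero, ← integral_neg, ← e1]
    congr with o
    ring
  have e4 : ∫ o, h o.2 * ε o ∂(tilt ν ρ) = ∫ o, h o.2 * (ε o * (ρ o - 1)) ∂ν := by
    rw [hρ.integral_eq, ← sub_zero (∫ o, ρ o * (h o.2 * ε o) ∂ν), ← e2, ← integral_sub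
      ((hρ.integrable_iff _).1 i2) (integrable_mul_of_memLp hh hε)]
    congr with o
    ring
  have e5 : C⁻¹ * ∫ o, h o.2 ^ 2 ∂ν ≤ ∫ o, h o.2 ^ 2 ∂(tilt ν ρ) := by
    rw [hρ.integral_eq, ← integral_const_mul]
    refine integral_mono_ae (hh.integrable_sq.const_mul _) ((hρ.integrable_iff _).1 i3) ?_
    filter_upwards [hρ.bounds] with o ho
    have := ho.1
    gcongr
  rw [e3, e4] at e5
  have e6 := sq_integral_mul_le hh hε1
  set I := ∫ o, h o.2 ^ 2 ∂ν
  set J := ∫ o, (ε o * (ρ o - 1)) ^ 2 ∂ν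
  have hI : 0 ≤ I := integral_nonneg fun o => sq_nonneg _
  have hJ : 0 ≤ J := integral_nonneg fun o => sq_nonneg _
  have e7 : (C⁻¹ * I) ^ 2 ≤ I * J := (pow_le_pow_left₀ (by positivity) e5 2).trans e6
  rcases hI.eq_or_lt with h0 | h0
  · rw [← h0]; positivity
  · have : I * I ≤ I * (C ^ 2 * J) := by
      calc I * I = C ^ 2 * (C⁻¹ * I) ^ 2 := by field_simp
        _ ≤ C ^ 2 * (I * J) := by gcongr
        _ = _ := by ring
    exact le_of_mul_le_mul_left this h0

/-! ### Propensity scores -/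

/-- `e` is the propensity score of a cluster with law `ν`, and bounded below by `c`. -/
structure IsPropensity (ν : Measure (Cluster n d)) (e : Trt n → Cov n d → ℝ) (c : ℝ) : Prop where
  pos : 0 < c
  measurable : ∀ a, Measurable (e a)
  overlap : ∀ a, ∀ᵐ o ∂ν, c ≤ e a o.2.2
  sum_one : ∀ᵐ o ∂ν, ∑ a, e a o.2.2 = 1
  restrict_map : ∀ a, (ν.restrict {o | o.2.1 = a}).map (fun o => o.2.2)
    = (ν.map (fun o => o.2.2)).withDensity fun x => ENNReal.ofReal (e a x)

variable {e : Trt n → Cov n d → ℝ} {c : ℝ}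

theorem measurable_cov : Measurable (fun o : Cluster n d => o.2.2) := by fun_prop

theorem measurable_trt : Measurable (fun o : Cluster n d => o.2.1) := by fun_prop

theorem measurableSet_trt (a : Trt n) : MeasurableSet {o : Cluster n d | o.2.1 = a} :=
  measurable_trt (measurableSet_singleton a)

theorem measurable_uncurry_trt {γ : Type*} [MeasurableSpace γ] {f : Trt n → Cov n d → γ}
    (hf : ∀ a, Measurable (f a)) : Measurable (fun p : Trt n × Cov n d => f p.1 p.2) :=
  measurable_from_prod_countable_right hf

theorem IsPropensity.integrableOn_iff (h : IsPropensity ν e c) (a : Trt n) {f : Cov n d → ℝ}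
    (hf : Measurable f) :
    IntegrableOn (fun o => f o.2.2) {o | o.2.1 = a} ν ↔
      Integrable (fun o => e a o.2.2 * f o.2.2) ν := by
  have he := h.measurable a
  rw [IntegrableOn, ← Function.comp_def f, ← integrable_map_measure hf.aestronglyMeasurable
    measurable_cov.aemeasurable, h.restrict_map a, integrable_withDensity_iff_integrable_smul'
    (by fun_prop) (ae_of_all _ fun z => ENNReal.ofReal_lt_top),
    integrable_map_measure (by fun_prop) measurable_cov.aemeasurable]
  refine integrable_congr ?_
  filter_upwards [h.overlap a] with o ho
  simp [ENNReal.toReal_ofReal (h.pos.le.trans ho)]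

theorem IsPropensity.setIntegral_eq (h : IsPropensity ν e c) (a : Trt n) {f : Cov n d → ℝ}
    (hf : Measurable f) :
    ∫ o in {o | o.2.1 = a}, f o.2.2 ∂ν = ∫ o, e a o.2.2 * f o.2.2 ∂ν := by
  have he := h.measurable a
  rw [← integral_map (f := f) measurable_cov.aemeasurable hf.aestronglyMeasurable,
    h.restrict_map a, integral_withDensity_eq_integral_toReal_smul
    (by fun_prop) (ae_of_all _ fun z => ENNReal.ofReal_lt_top),
    integral_map measurable_cov.aemeasurable (by fun_prop)]
  refine integral_congr_ae ?_
  filter_upwards [h.overlap a] with o ho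
  simp [ENNReal.toReal_ofReal (h.pos.le.trans ho)]

theorem integral_eq_sum_trt (f : Cluster n d → ℝ) (hf : Integrable f ν) :
    ∫ o, f o ∂ν = ∑ a, ∫ o in {o | o.2.1 = a}, f o ∂ν := by
  rw [← integral_iUnion_fintype (fun a => measurableSet_trt a) ?_ (fun a => hf.integrableOn),
    show (⋃ a : Trt n, {o : Cluster n d | o.2.1 = a}) = Set.univ by ext; simp, Measure.restrict_univ]
  intro a b hab
  refine Set.disjoint_left.2 fun o ho ho' => hab ?_
  rw [← ho, ← ho']

variable {f : Trt n → Cov n d → ℝ}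

/-- A function of treatments and covariates that is integrable is so at every treatment. -/
theorem IsPropensity.integrable_apply (h : IsPropensity ν e c) (hf : ∀ a, Measurable (f a))
    (hi : Integrable (fun o => f o.2.1 o.2.2) ν) (a : Trt n) :
    Integrable (fun o => e a o.2.2 * f a o.2.2) ν ∧ Integrable (fun o => f a o.2.2) ν := by
  have h1 : Integrable (fun o => e a o.2.2 * f a o.2.2) ν := by
    rw [← h.integrableOn_iff a (hf a)]
    refine hi.integrableOn.congr_fun ?_ (measurableSet_trt a)
    rintro o rfl
    rfl
  refine ⟨h1, (h1.norm.const_mul c⁻¹).mono' ((hf a).comp measurable_cov).aestronglyMeasurable ?_⟩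
  filter_upwards [h.overlap a] with o ho
  have hc := h.pos
  rw [norm_mul, Real.norm_of_nonneg (hc.le.trans ho), ← mul_assoc]
  refine le_mul_of_one_le_left (norm_nonneg _) ?_
  calc 1 = c⁻¹ * c := (inv_mul_cancel₀ hc.ne').symm
    _ ≤ _ := by gcongr

theorem integrable_of_apply (hf : ∀ a, Measurable (f a))
    (hi : ∀ a, Integrable (fun o : Cluster n d => f a o.2.2) ν) :
    Integrable (fun o : Cluster n d => f o.2.1 o.2.2) ν := by
  refine (integrable_finsetSum Finset.univ fun a _ => (hi a).norm).mono'
    ((measurable_uncurry_trt hf).comp measurable_snd).aestronglyMeasurable (ae_of_all _ fun o => ?_)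
  exact Finset.single_le_sum (f := fun a => ‖f a o.2.2‖) (fun a _ => norm_nonneg _)
    (Finset.mem_univ o.2.1)

theorem IsPropensity.integral_eq (h : IsPropensity ν e c) (hf : ∀ a, Measurable (f a))
    (hi : Integrable (fun o => f o.2.1 o.2.2) ν) :
    ∫ o, f o.2.1 o.2.2 ∂ν = ∫ o, ∑ a, e a o.2.2 * f a o.2.2 ∂ν := by
  rw [integral_eq_sum_trt _ hi, integral_finsetSum _ fun a _ => (h.integrable_apply hf hi a).1]
  refine Finset.sum_congr rfl fun a _ => ?_
  rw [← h.setIntegral_eq a (hf a)]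
  exact setIntegral_congr_fun (measurableSet_trt a) (by rintro o rfl; rfl)

/-- Inverse probability weighting is unbiased, provided that the error is integrable. -/
theorem IsPropensity.integral_ipw_sub (h : IsPropensity ν e c) (hf : ∀ a, Measurable (f a))
    (hi : Integrable (fun o => f o.2.1 o.2.2 / e o.2.1 o.2.2 - ∑ a, f a o.2.2) ν) :
    ∫ o, (f o.2.1 o.2.2 / e o.2.1 o.2.2 - ∑ a, f a o.2.2) ∂ν = 0 := by
  have he := h.measurable
  -- Conditioning on the covariates is applied to the whole difference, since its two terms need not
  -- be integrable separately.
  rw [h.integral_eq (f := fun b x => f b x / e b x - ∑ a, f a x) (fun b => by fun_prop) hi]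
  refine integral_eq_zero_of_ae ?_
  filter_upwards [h.sum_one, eventually_countable_forall.2 h.overlap] with o h1 h2
  have : ∀ a, e a o.2.2 * (f a o.2.2 / e a o.2.2 - ∑ b, f b o.2.2)
      = f a o.2.2 - e a o.2.2 * ∑ b, f b o.2.2 := by
    intro a
    have := (h.pos.trans_le (h2 a)).ne'
    field_simp
  simp only [this, Finset.sum_sub_distrib, ← Finset.sum_mul, h1, Pi.zero_apply]
  ring

theorem IsPropensity.ae_le (h : IsPropensity ν e c) : ∀ᵐ o ∂ν, c ≤ e o.2.1 o.2.2 := by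
  filter_upwards [eventually_countable_forall.2 h.overlap] with o ho using ho _

/-- Square integrable functions remain so after inverse probability weighting, up to a constant. -/
theorem IsPropensity.integral_sq_ipw_sub_le [IsFiniteMeasure ν] (h : IsPropensity ν e c)
    (hf : ∀ a, Measurable (f a)) (hi : MemLp (fun o => f o.2.1 o.2.2) 2 ν) :
    MemLp (fun o => f o.2.1 o.2.2 / e o.2.1 o.2.2 - ∑ a, f a o.2.2) 2 ν ∧
    ∫ o, (f o.2.1 o.2.2 / e o.2.1 o.2.2 - ∑ a, f a o.2.2) ^ 2 ∂ν ≤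
      (2 / c ^ 2 + 2 * Fintype.card (Trt n) / c) * ∫ o, f o.2.1 o.2.2 ^ 2 ∂ν := by
  have hc := h.pos
  have he := h.measurable
  have hsq : ∀ a, Measurable fun x => f a x ^ 2 := fun a => by fun_prop
  have hia := h.integrable_apply hsq hi.integrable_sq
  have hm1 : Measurable (fun o : Cluster n d => f o.2.1 o.2.2 / e o.2.1 o.2.2) :=
    ((measurable_uncurry_trt hf).comp measurable_snd).div
      ((measurable_uncurry_trt he).comp measurable_snd)
  have hm2 : Measurable (fun o : Cluster n d => ∑ a, f a o.2.2) := by fun_prop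
  have hle : ∀ᵐ o ∂ν, (f o.2.1 o.2.2 / e o.2.1 o.2.2 - ∑ a, f a o.2.2) ^ 2 ≤
      2 / c ^ 2 * f o.2.1 o.2.2 ^ 2
        + 2 * Fintype.card (Trt n) / c * ∑ a, e a o.2.2 * f a o.2.2 ^ 2 := by
    filter_upwards [eventually_countable_forall.2 h.overlap] with o ho
    have h1 : (f o.2.1 o.2.2 / e o.2.1 o.2.2) ^ 2 ≤ f o.2.1 o.2.2 ^ 2 / c ^ 2 := by
      rw [div_pow]
      have := ho o.2.1
      gcongr
    have h2 : (∑ a, f a o.2.2) ^ 2 ≤ Fintype.card (Trt n) * ∑ a, f a o.2.2 ^ 2 :=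
      sq_sum_le_card_mul_sum_sq
    -- Inserting the factor `e a / c`, which is at least one, turns the sum over treatments into
    -- `c⁻¹` times a conditional mean of `f(A, X) ^ 2`.
    have h3 : ∑ a, f a o.2.2 ^ 2 ≤ (∑ a, e a o.2.2 * f a o.2.2 ^ 2) / c := by
      rw [le_div_iff₀ hc, Finset.sum_mul]
      refine Finset.sum_le_sum fun a _ => ?_
      rw [mul_comm]
      have := ho a
      gcongr
    calc (f o.2.1 o.2.2 / e o.2.1 o.2.2 - ∑ a, f a o.2.2) ^ 2
        ≤ 2 * (f o.2.1 o.2.2 / e o.2.1 o.2.2) ^ 2 + 2 * (∑ a, f a o.2.2) ^ 2 := by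
          nlinarith [sq_nonneg (f o.2.1 o.2.2 / e o.2.1 o.2.2 + ∑ a, f a o.2.2)]
      _ ≤ 2 * (f o.2.1 o.2.2 ^ 2 / c ^ 2) + 2 * (Fintype.card (Trt n) *
          ((∑ a, e a o.2.2 * f a o.2.2 ^ 2) / c)) := by
          gcongr
          exact h2.trans (by gcongr)
      _ = _ := by ring
  have i2 : Integrable (fun o => ∑ a, e a o.2.2 * f a o.2.2 ^ 2) ν :=
    integrable_finsetSum _ fun a _ => (hia a).1
  have i3 : Integrable (fun o => 2 / c ^ 2 * f o.2.1 o.2.2 ^ 2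
        + 2 * Fintype.card (Trt n) / c * ∑ a, e a o.2.2 * f a o.2.2 ^ 2) ν :=
    (hi.integrable_sq.const_mul _).add (i2.const_mul _)
  constructor
  · refine (memLp_two_iff_integrable_sq (hm1.sub hm2).aestronglyMeasurable).2 ?_
    refine i3.mono' ((hm1.sub hm2).pow_const 2).aestronglyMeasurable ?_
    filter_upwards [hle] with o ho
    rw [Real.norm_of_nonneg (sq_nonneg _)]
    exact ho
  · refine (integral_mono_of_nonneg (ae_of_all _ fun o => sq_nonneg _) i3 hle).trans (le_of_eq ?_)
    rw [integral_add (hi.integrable_sq.const_mul _) (i2.const_mul _), integral_const_mul,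
      integral_const_mul, ← h.integral_eq hsq hi.integrable_sq]
    ring

end Cluster

end PartialInterference

namespace PartialInterference

/-! ### The augmented inverse probability weighted term within one type. -/

section Cluster

variable {n d : ℕ} {ν : Measure (Cluster n d)}

/-- `G` is the outcome regression of a cluster with law `ν`. -/
structure IsRegression (ν : Measure (Cluster n d)) (G : Trt n → Cov n d → Out n) : Prop where
  measurable : ∀ a, Measurable (G a)
  condMean : ∀ j, CondMeanZero ν (fun o => o.1 j - G o.2.1 o.2.2 j)

/-- The augmented inverse probability weighted term of a cluster. -/
noncomputable def aipw (w : Trt n → Cov n d → Out n) (e : Trt n → Cov n d → ℝ)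
    (G : Trt n → Cov n d → Out n) (o : Cluster n d) : ℝ :=
  (∑ j, w o.2.1 o.2.2 j * (o.1 j - G o.2.1 o.2.2 j)) / e o.2.1 o.2.2
    + ∑ a, ∑ j, w a o.2.2 j * G a o.2.2 j

/-- The weights are measurable and bounded. -/
structure BddWeights (w : Trt n → Cov n d → Out n) (B : ℝ) : Prop where
  measurable : ∀ a, Measurable (w a)
  bound : ∀ a x j, |w a x j| ≤ B

variable {w : Trt n → Cov n d → Out n} {B c C : ℝ} {e e' : Trt n → Cov n d → ℝ}
  {G G' : Trt n → Cov n d → Out n}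

theorem measurable_apply_trtCov {G : Trt n → Cov n d → Out n} (hG : ∀ a, Measurable (G a))
    (j : Fin n) : Measurable (fun p : Trt n × Cov n d => G p.1 p.2 j) :=
  measurable_uncurry_trt (f := fun a x => G a x j) fun a => (measurable_pi_apply j).comp (hG a)

theorem measurable_apply_cluster {G : Trt n → Cov n d → Out n} (hG : ∀ a, Measurable (G a))
    (j : Fin n) : Measurable (fun o : Cluster n d => G o.2.1 o.2.2 j) :=
  (measurable_apply_trtCov hG j).comp measurable_snd

theorem measurable_weighted (hw : ∀ a, Measurable (w a)) (hG : ∀ a, Measurable (G a)) (a : Trt n) :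
    Measurable fun x => ∑ j, w a x j * G a x j := by
  have h1 := hw a
  have h2 := hG a
  fun_prop

theorem measurable_aipw (hw : ∀ a, Measurable (w a)) (he : ∀ a, Measurable (e a))
    (hG : ∀ a, Measurable (G a)) : Measurable (aipw w e G) := by
  have h1 := measurable_apply_cluster hw
  have h2 := measurable_apply_cluster hG
  have h3 : Measurable (fun o : Cluster n d => e o.2.1 o.2.2) :=
    (measurable_uncurry_trt he).comp measurable_snd
  have h4 : ∀ a, Measurable fun o : Cluster n d => ∑ j, w a o.2.2 j * G a o.2.2 j :=
    fun a => (measurable_weighted hw hG a).comp measurable_cov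
  have h5 : ∀ j, Measurable fun o : Cluster n d => o.1 j := fun j => by fun_prop
  unfold aipw
  refine Measurable.add (Measurable.div (Finset.measurable_sum _ fun j _ => ?_) h3)
    (Finset.measurable_sum _ fun a _ => h4 a)
  exact (h1 j).mul ((h5 j).sub (h2 j))

theorem BddWeights.condMeanZero [IsFiniteMeasure ν] (hw : BddWeights w B)
    (hG : IsRegression ν G) :
    CondMeanZero ν (fun o => ∑ j, w o.2.1 o.2.2 j * (o.1 j - G o.2.1 o.2.2 j)) :=
  CondMeanZero.sum _ fun j _ => (hG.condMean j).mul_bdd (q := fun p => w p.1 p.2 j)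
    (measurable_apply_trtCov hw.measurable j) (ae_of_all _ fun _ => hw.bound _ _ _)

theorem IsPropensity.condMeanZero_div [IsFiniteMeasure ν] (he : IsPropensity ν e c)
    {ζ : Cluster n d → ℝ} (h : CondMeanZero ν ζ) :
    CondMeanZero ν (fun o => ζ o / e o.2.1 o.2.2) := by
  have := h.mul_bdd (q := fun p => (e p.1 p.2)⁻¹) (measurable_uncurry_trt he.measurable).inv
    (B := c⁻¹) (by
      have hc := he.pos
      filter_upwards [he.ae_le] with o ho
      rw [abs_inv, abs_of_nonneg (hc.le.trans ho)]
      gcongr)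
  simpa only [div_eq_mul_inv, mul_comm] using this

theorem CondMeanZero.integral_eq_zero {ζ : Cluster n d → ℝ} (h : CondMeanZero ν ζ) :
    ∫ o, ζ o ∂ν = 0 := by
  simpa using h.setIntegral Set.univ MeasurableSet.univ

theorem IsPropensity.integrable_weighted (he : IsPropensity ν e c) (hw : BddWeights w B)
    (hG : ∀ a, Measurable (G a)) (hGi : ∀ j, Integrable (fun o => G o.2.1 o.2.2 j) ν) (a : Trt n) :
    Integrable (fun o => ∑ j, w a o.2.2 j * G a o.2.2 j) ν := by
  refine integrable_finsetSum _ fun j _ => ?_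
  have := (he.integrable_apply (f := fun a x => G a x j)
    (fun a => (measurable_pi_apply j).comp (hG a)) (hGi j) a).2
  exact this.bdd_mul (c := B)
    (((measurable_pi_apply j).comp (hw.measurable a)).comp measurable_cov).aestronglyMeasurable
    (ae_of_all _ fun o => hw.bound _ _ _)

/-- The weighted residual has conditional mean zero given treatments and covariates, so only the
regression part contributes to the mean. -/
theorem IsPropensity.aipw_integrable [IsFiniteMeasure ν] (he : IsPropensity ν e c)
    (hw : BddWeights w B) (hG : IsRegression ν G)
    (hGi : ∀ j, Integrable (fun o => G o.2.1 o.2.2 j) ν) :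
    Integrable (aipw w e G) ν ∧
      ∫ o, aipw w e G o ∂ν = ∑ a, ∫ o, ∑ j, w a o.2.2 j * G a o.2.2 j ∂ν := by
  have h1 := he.condMeanZero_div (hw.condMeanZero hG)
  have h2 := he.integrable_weighted hw hG.measurable hGi
  refine ⟨h1.integrable.add (integrable_finsetSum _ fun a _ => h2 a), ?_⟩
  unfold aipw
  rw [integral_add h1.integrable (integrable_finsetSum _ fun a _ => h2 a), h1.integral_eq_zero,
    zero_add, integral_finsetSum _ fun a _ => h2 a]

/-- Robustness to misspecification of the outcome regression. -/
theorem IsPropensity.integral_aipw_regression [IsFiniteMeasure ν] (he : IsPropensity ν e c)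
    (hw : ∀ a, Measurable (w a)) (hG : ∀ a, Measurable (G a)) (hG' : ∀ a, Measurable (G' a))
    (hi : Integrable (aipw w e G) ν) (hi' : Integrable (aipw w e G') ν) :
    ∫ o, aipw w e G' o ∂ν = ∫ o, aipw w e G o ∂ν := by
  -- The outcome cancels. What remains is the inverse weighting error of `w · (G' - G)`, which has
  -- mean zero for any `G'` once it is integrable.
  have key : ∀ o, aipw w e G o - aipw w e G' o =
      (∑ j, w o.2.1 o.2.2 j * (G' o.2.1 o.2.2 j - G o.2.1 o.2.2 j)) / e o.2.1 o.2.2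
        - ∑ a, ∑ j, w a o.2.2 j * (G' a o.2.2 j - G a o.2.2 j) := by
    intro o
    simp only [aipw, mul_sub, Finset.sum_sub_distrib, sub_div]
    ring
  have := he.integral_ipw_sub (f := fun a x => ∑ j, w a x j * (G' a x j - G a x j))
    (fun a => by have := hw a; have := hG a; have := hG' a; fun_prop)
    ((hi.sub hi').congr (ae_of_all _ key))
  rw [← integral_congr_ae (ae_of_all _ key), integral_sub hi hi'] at this
  linarith

/-- Robustness to misspecification of the propensity score. -/
theorem IsRegression.integral_aipw_propensity [IsFiniteMeasure ν] (hG : IsRegression ν G)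
    (hw : BddWeights w B) (he : ∀ a, Measurable (e a)) (he' : ∀ a, Measurable (e' a))
    (hi : Integrable (aipw w e G) ν) (hi' : Integrable (aipw w e' G) ν) :
    ∫ o, aipw w e' G o ∂ν = ∫ o, aipw w e G o ∂ν := by
  -- The regression parts cancel. What remains is a function of treatments and covariates times a
  -- residual with conditional mean zero.
  have key : ∀ o, aipw w e' G o - aipw w e G o = ((e' o.2.1 o.2.2)⁻¹ - (e o.2.1 o.2.2)⁻¹) *
      ∑ j, w o.2.1 o.2.2 j * (o.1 j - G o.2.1 o.2.2 j) := by
    intro o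
    simp only [aipw]
    ring
  have := (hw.condMeanZero hG).integral_mul_eq_zero
    (q := fun p => (e' p.1 p.2)⁻¹ - (e p.1 p.2)⁻¹)
    ((measurable_uncurry_trt he').inv.sub (measurable_uncurry_trt he).inv)
    ((hi'.sub hi).congr (ae_of_all _ key))
  rw [← integral_congr_ae (ae_of_all _ key), integral_sub hi' hi] at this
  linarith

/-- The second order remainder of the augmented inverse probability weighted functional. -/
theorem sq_integral_aipw_sub_le [IsFiniteMeasure ν] (he : IsPropensity ν e c)
    (hw : BddWeights w B) (hG : IsRegression ν G)
    (hGi : ∀ j, Integrable (fun o => G o.2.1 o.2.2 j) ν)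
    (hε : ∀ j, MemLp (fun o => o.1 j - G o.2.1 o.2.2 j) 2 ν)
    {ρ : Cluster n d → ℝ} (hρ : BddDensity ν ρ C) (hG' : IsRegression (tilt ν ρ) G') :
    (∫ o, aipw w e G o ∂(tilt ν ρ) - ∑ a, ∫ o, ∑ j, w a o.2.2 j * G' a o.2.2 j ∂(tilt ν ρ)) ^ 2 ≤
      (2 / c ^ 2 + 2 * Fintype.card (Trt n) / c) * (n * B ^ 2 * C ^ 2) *
        (∑ j, ∫ o, ((o.1 j - G o.2.1 o.2.2 j) * (ρ o - 1)) ^ 2 ∂ν) * ∫ o, (ρ o - 1) ^ 2 ∂ν := by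
  have := hρ.isFiniteMeasure_tilt
  have hc := he.pos
  have hC := hρ.pos
  have hmd : ∀ j, Measurable fun p : Trt n × Cov n d => G' p.1 p.2 j - G p.1 p.2 j := fun j =>
    (measurable_apply_trtCov hG'.measurable j).sub (measurable_apply_trtCov hG.measurable j)
  -- Under the tilted law `G' - G` is the conditional mean of the residual `Y - G`, whose
  -- conditional mean under `ν` is zero; `integral_sq_condMean_le` therefore bounds it through `ρ -
  -- 1`.
  have hd : ∀ j, MemLp (fun o : Cluster n d => G' o.2.1 o.2.2 j - G o.2.1 o.2.2 j) 2 ν ∧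
      ∫ o, (G' o.2.1 o.2.2 j - G o.2.1 o.2.2 j) ^ 2 ∂ν
        ≤ C ^ 2 * ∫ o, ((o.1 j - G o.2.1 o.2.2 j) * (ρ o - 1)) ^ 2 ∂ν := by
    intro j
    refine integral_sq_condMean_le hρ (hε j) (hG.condMean j) (hmd j) ?_
    convert! hG'.condMean j using 2
    ring
  have hGi' : ∀ j, Integrable (fun o => G' o.2.1 o.2.2 j) ν := fun j => by
    refine (((hd j).1.integrable (by norm_num)).add (hGi j)).congr (ae_of_all _ fun o => ?_)
    simp
  set f : Trt n → Cov n d → ℝ := fun a x => ∑ j, w a x j * (G' a x j - G a x j) with hf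
  have hfm : ∀ a, Measurable (f a) := fun a =>
    measurable_weighted (G := fun a x j => G' a x j - G a x j) hw.measurable
      (fun a => (hG'.measurable a).sub (hG.measurable a)) a
  have hf2 : MemLp (fun o => f o.2.1 o.2.2) 2 ν := by
    refine memLp_finsetSum _ fun j _ => ?_
    have := memLp_mul_of_ae_abs_le (hd j).1 (measurable_apply_cluster hw.measurable j)
      (ae_of_all _ fun o => hw.bound _ _ _)
    simpa only [mul_comm] using this
  have hfI : ∫ o, f o.2.1 o.2.2 ^ 2 ∂ν ≤ n * B ^ 2 * C ^ 2 *
      ∑ j, ∫ o, ((o.1 j - G o.2.1 o.2.2 j) * (ρ o - 1)) ^ 2 ∂ν := by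
    have i1 : ∀ j, Integrable (fun o => B ^ 2 * (G' o.2.1 o.2.2 j - G o.2.1 o.2.2 j) ^ 2) ν :=
      fun j => (hd j).1.integrable_sq.const_mul _
    calc ∫ o, f o.2.1 o.2.2 ^ 2 ∂ν
        ≤ ∫ o, n * ∑ j, B ^ 2 * (G' o.2.1 o.2.2 j - G o.2.1 o.2.2 j) ^ 2 ∂ν := by
          refine integral_mono_of_nonneg (ae_of_all _ fun o => sq_nonneg _)
            ((integrable_finsetSum _ fun j _ => i1 j).const_mul _) (ae_of_all _ fun o => ?_)
          refine (sq_sum_le_card_mul_sum_sq).trans ?_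
          simp only [Finset.card_univ, Fintype.card_fin]
          gcongr with j _
          rw [mul_pow, ← sq_abs (w _ _ j)]
          gcongr
          exact hw.bound _ _ _
      _ = n * ∑ j, B ^ 2 * ∫ o, (G' o.2.1 o.2.2 j - G o.2.1 o.2.2 j) ^ 2 ∂ν := by
          rw [integral_const_mul, integral_finsetSum _ fun j _ => i1 j]
          simp only [integral_const_mul]
      _ ≤ n * ∑ j, B ^ 2 * (C ^ 2 * ∫ o, ((o.1 j - G o.2.1 o.2.2 j) * (ρ o - 1)) ^ 2 ∂ν) := by
          gcongr with j _
          exact (hd j).2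
      _ = _ := by
          rw [← Finset.mul_sum, ← Finset.mul_sum]
          ring
  obtain ⟨hu, huI⟩ := he.integral_sq_ipw_sub_le hfm hf2
  have hb : ∀ᵐ o ∂ν, |ρ o - 1| ≤ C + 1 := by
    filter_upwards [hρ.bounds] with o ho using abs_sub_one_le_of_bounds hC ho
  have hρ1 : MemLp (fun o => ρ o - 1) 2 ν := memLp_of_ae_abs_le (hρ.measurable.sub_const 1) hb
  have hui : Integrable (fun o => f o.2.1 o.2.2 / e o.2.1 o.2.2 - ∑ a, f a o.2.2) ν :=
    hu.integrable (by norm_num)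
  have heT : ∀ᵐ o ∂(tilt ν ρ), c ≤ e o.2.1 o.2.2 := by
    refine Measure.AbsolutelyContinuous.ae_le ?_ he.ae_le
    exact withDensity_absolutelyContinuous _ _
  have hζ : CondMeanZero (tilt ν ρ)
      (fun o => (e o.2.1 o.2.2)⁻¹ * ∑ j, w o.2.1 o.2.2 j * (o.1 j - G' o.2.1 o.2.2 j)) :=
    (hw.condMeanZero hG').mul_bdd (q := fun p => (e p.1 p.2)⁻¹)
      (measurable_uncurry_trt he.measurable).inv (B := c⁻¹) (by
        filter_upwards [heT] with o ho
        rw [abs_inv, abs_of_nonneg (hc.le.trans ho)]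
        gcongr)
  have hwi : ∀ a, Integrable (fun o => ∑ j, w a o.2.2 j * G' a o.2.2 j) (tilt ν ρ) := fun a =>
    (hρ.integrable_tilt_iff _).2 (he.integrable_weighted hw hG'.measurable hGi' a)
  have huT : Integrable (fun o => f o.2.1 o.2.2 / e o.2.1 o.2.2 - ∑ a, f a o.2.2) (tilt ν ρ) :=
    (hρ.integrable_tilt_iff _).2 hui
  -- Recentered at `G'`: a residual with mean zero under the tilted law, the regression part that
  -- defines the functional there, and the weighting error of `f = w · (G' - G)`.
  have key : ∀ o, aipw w e G o =
      (e o.2.1 o.2.2)⁻¹ * ∑ j, w o.2.1 o.2.2 j * (o.1 j - G' o.2.1 o.2.2 j)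
      + ∑ a, ∑ j, w a o.2.2 j * G' a o.2.2 j
      + (f o.2.1 o.2.2 / e o.2.1 o.2.2 - ∑ a, f a o.2.2) := by
    intro o
    simp only [aipw, f, mul_sub, Finset.sum_sub_distrib, sub_div]
    ring
  -- The weighting error has mean zero under `ν`, so its tilted mean is its integral against `ρ -
  -- 1`. Both factors are small, which makes the remainder of second order.
  have e1 : ∫ o, aipw w e G o ∂(tilt ν ρ)
      - ∑ a, ∫ o, ∑ j, w a o.2.2 j * G' a o.2.2 j ∂(tilt ν ρ)
      = ∫ o, (f o.2.1 o.2.2 / e o.2.1 o.2.2 - ∑ a, f a o.2.2) * (ρ o - 1) ∂ν := by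
    have hwS : Integrable (fun o => ∑ a, ∑ j, w a o.2.2 j * G' a o.2.2 j) (tilt ν ρ) :=
      integrable_finsetSum _ fun a _ => hwi a
    have hζw : Integrable (fun o =>
        (e o.2.1 o.2.2)⁻¹ * ∑ j, w o.2.1 o.2.2 j * (o.1 j - G' o.2.1 o.2.2 j)
        + ∑ a, ∑ j, w a o.2.2 j * G' a o.2.2 j) (tilt ν ρ) := hζ.integrable.add hwS
    rw [integral_congr_ae (ae_of_all _ key), integral_add hζw huT,
      integral_add hζ.integrable hwS, hζ.integral_eq_zero,
      integral_finsetSum _ fun a _ => hwi a, zero_add, add_sub_cancel_left, hρ.integral_eq,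
      ← sub_zero (∫ o, ρ o * _ ∂ν), ← he.integral_ipw_sub hfm hui,
      ← integral_sub ((hρ.integrable_iff _).1 huT) hui]
    congr with o
    ring
  rw [e1]
  refine (sq_integral_mul_le hu hρ1).trans ?_
  have : 0 ≤ ∫ o, (ρ o - 1) ^ 2 ∂ν := integral_nonneg fun o => sq_nonneg _
  calc _ ≤ ((2 / c ^ 2 + 2 * Fintype.card (Trt n) / c) * ∫ o, f o.2.1 o.2.2 ^ 2 ∂ν) *
        ∫ o, (ρ o - 1) ^ 2 ∂ν := by gcongr
    _ ≤ ((2 / c ^ 2 + 2 * Fintype.card (Trt n) / c) * (n * B ^ 2 * C ^ 2 *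
      ∑ j, ∫ o, ((o.1 j - G o.2.1 o.2.2 j) * (ρ o - 1)) ^ 2 ∂ν)) *
        ∫ o, (ρ o - 1) ^ 2 ∂ν := by gcongr
    _ = _ := by ring

end Cluster

end PartialInterference

namespace PartialInterference

/-! ### From regular conditional distributions to propensity scores and regressions. -/

section Cluster

variable {n d : ℕ} {T : Measure (Cluster n d)}

theorem ae_trtCov_of_forall {p : Trt n → Cov n d → Prop}
    (h : ∀ a, ∀ᵐ x ∂(T.map (fun o => o.2.2)), p a x) : ∀ᵐ o ∂T, p o.2.1 o.2.2 := by
  filter_upwards [eventually_countable_forall.2 fun a =>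
    ae_of_ae_map measurable_cov.aemeasurable (h a)] with o ho using ho _

/-- There are finitely many treatments, so their exceptional covariate sets can be combined. As `p`
need not be measurable, each of these sets is enlarged to a measurable null set. -/
theorem ae_map_trtCov_of_forall {p : Trt n × Cov n d → Prop}
    (h : ∀ a, ∀ᵐ x ∂(T.map (fun o => o.2.2)), p (a, x)) :
    ∀ᵐ z ∂(T.map (fun o => o.2)), p z := by
  have h1 : ∀ a, ∃ s, MeasurableSet s ∧ {x | ¬ p (a, x)} ⊆ s ∧ T.map (fun o => o.2.2) s = 0 :=
    fun a => by
      obtain ⟨s, hs, hm, h0⟩ := exists_measurable_superset_of_null (ae_iff.1 (h a))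
      exact ⟨s, hm, hs, h0⟩
  choose s hm hs h0 using h1
  have hS : MeasurableSet {z : Trt n × Cov n d | z.2 ∈ s z.1} := by
    rw [show {z : Trt n × Cov n d | z.2 ∈ s z.1} = ⋃ a, {a} ×ˢ s a by
      ext ⟨a, x⟩; simp]
    exact MeasurableSet.iUnion fun a => (measurableSet_singleton a).prod (hm a)
  rw [ae_iff]
  refine measure_mono_null (t := {z : Trt n × Cov n d | z.2 ∈ s z.1}) (fun z hz => hs z.1 hz) ?_
  rw [Measure.map_apply measurable_snd hS]
  have : ∀ᵐ o ∂T, o.2.2 ∉ s o.2.1 := ae_trtCov_of_forall (p := fun a x => x ∉ s a) fun a => by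
    rw [ae_iff]; simpa using h0 a
  simpa [ae_iff] using this

theorem isPropensity_of_condDistrib [IsFiniteMeasure T] {e : Trt n → Cov n d → ℝ} {c : ℝ}
    (hc : 0 < c) (hm : ∀ a, Measurable (e a))
    (h : ∀ a, ∀ᵐ x ∂(T.map (fun o => o.2.2)),
      (condDistrib (fun o : Cluster n d => o.2.1) (fun o => o.2.2) T x).real {a} = e a x)
    (ho : ∀ a, ∀ᵐ x ∂(T.map (fun o => o.2.2)), c ≤ e a x) : IsPropensity T e c where
  pos := hc
  measurable := hm
  overlap a := ae_of_ae_map measurable_cov.aemeasurable (ho a)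
  sum_one := by
    filter_upwards [eventually_countable_forall.2 fun a =>
      ae_of_ae_map measurable_cov.aemeasurable (h a)] with o ho
    simp only [← ho]
    rw [sum_measureReal_singleton]
    simp
  restrict_map a := by
    have he := hm a
    ext t ht
    rw [Measure.map_apply measurable_cov ht, Measure.restrict_apply (measurable_cov ht),
      withDensity_apply _ ht, Measure.restrict_map measurable_cov ht,
      lintegral_map (by fun_prop) measurable_cov]
    have := setLIntegral_preimage_condDistrib (μ := T) (X := fun o : Cluster n d => o.2.2)
      (Y := fun o : Cluster n d => o.2.1) measurable_cov measurable_trt.aemeasurable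
      (measurableSet_singleton a) ht
    rw [show (fun o : Cluster n d => o.2.2) ⁻¹' t ∩ {o | o.2.1 = a} =
      (fun o : Cluster n d => o.2.2) ⁻¹' t ∩ (fun o => o.2.1) ⁻¹' {a} from rfl, ← this]
    refine lintegral_congr_ae (ae_restrict_of_ae ?_)
    filter_upwards [ae_of_ae_map measurable_cov.aemeasurable (h a)] with o ho
    rw [← ho, measureReal_def, ENNReal.ofReal_toReal (measure_ne_top _ _)]

theorem IsPropensity.smul {e : Trt n → Cov n d → ℝ} {c : ℝ} (h : IsPropensity T e c)
    (r : ENNReal) : IsPropensity (r • T) e c where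
  pos := h.pos
  measurable := h.measurable
  overlap a := Measure.ae_smul_measure (h.overlap a) r
  sum_one := Measure.ae_smul_measure h.sum_one r
  restrict_map a := by
    rw [Measure.restrict_smul, Measure.map_smul, Measure.map_smul, withDensity_smul_measure,
      h.restrict_map]

theorem CondMeanZero.smul {ζ : Cluster n d → ℝ} (h : CondMeanZero T ζ) {r : ENNReal}
    (hr : r ≠ ⊤) : CondMeanZero (r • T) ζ where
  integrable := h.integrable.smul_measure hr
  setIntegral s hs := by
    rw [Measure.restrict_smul, integral_smul_measure, h.setIntegral s hs, smul_zero]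

theorem IsRegression.smul {G : Trt n → Cov n d → Out n} (h : IsRegression T G) {r : ENNReal}
    (hr : r ≠ ⊤) : IsRegression (r • T) G where
  measurable := h.measurable
  condMean j := (h.condMean j).smul hr

theorem isRegression_of_condDistrib [IsFiniteMeasure T] {G : Trt n → Cov n d → Out n}
    (hm : ∀ a, Measurable (G a)) (hY : ∀ j, Integrable (fun o => o.1 j) T)
    (h : ∀ᵐ o ∂T, ∀ j, G o.2.1 o.2.2 j =
      ∫ y, y j ∂(condDistrib (fun o : Cluster n d => o.1) (fun o => o.2) T o.2)) :
    IsRegression T G where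
  measurable := hm
  condMean j := by
    have h1 : T[fun o => o.1 j | MeasurableSpace.comap (fun o : Cluster n d => o.2) inferInstance]
        =ᵐ[T] fun o => G o.2.1 o.2.2 j := by
      have := condExp_ae_eq_integral_condDistrib (μ := T) (X := fun o : Cluster n d => o.2)
        (Y := fun o : Cluster n d => o.1) measurable_snd measurable_fst.aemeasurable
        (f := fun y : Out n => y j) (measurable_pi_apply j).stronglyMeasurable (hY j)
      filter_upwards [this, h] with o h1 h2
      rw [h2 j]
      exact h1
    have hGi : Integrable (fun o => G o.2.1 o.2.2 j) T := integrable_condExp.congr h1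
    refine ⟨(hY j).sub hGi, fun s hs => ?_⟩
    rw [integral_sub (hY j).integrableOn hGi.integrableOn,
      ← setIntegral_condExp comap_treatCov_le (hY j) ⟨s, hs, rfl⟩,
      integral_congr_ae (ae_restrict_of_ae h1), sub_self]

/-- Finite conditional variances make the residuals square integrable. -/
theorem memLp_residual [IsFiniteMeasure T]
    (h2 : ∀ a, ∀ᵐ x ∂(T.map (fun o => o.2.2)), MemLp (fun y : Out n => y) 2
      (condDistrib (fun o : Cluster n d => o.1) (fun o => o.2) T (a, x)))
    (j : Fin n)
    (hc : ∀ a, Integrable (fun x => covariance (fun y : Out n => y j) (fun y => y j)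
      (condDistrib (fun o : Cluster n d => o.1) (fun o => o.2) T (a, x)))
        (T.map (fun o => o.2.2))) :
    MemLp (fun o => o.1 j -
      ∫ y, y j ∂(condDistrib (fun o : Cluster n d => o.1) (fun o => o.2) T o.2)) 2 T := by
  set κ := condDistrib (fun o : Cluster n d => o.1) (fun o => o.2) T with hκ
  have hG : Measurable fun p => ∫ y, y j ∂(κ p) :=
    ((measurable_pi_apply j).stronglyMeasurable (f := fun y : Out n => y j)).integral_kernel
      (κ := κ) |>.measurable
  have hF : Measurable fun q : (Trt n × Cov n d) × Out n => (q.2 j - ∫ y, y j ∂(κ q.1)) ^ 2 := by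
    have h4 : Measurable fun q : (Trt n × Cov n d) × Out n => ∫ y, y j ∂(κ q.1) :=
      hG.comp measurable_fst
    have h3 : Measurable fun q : (Trt n × Cov n d) × Out n => q.2 j := by fun_prop
    exact (h3.sub h4).pow_const 2
  have hm : Measurable fun o : Cluster n d => o.1 j - ∫ y, y j ∂(κ o.2) := by
    have h3 : Measurable fun o : Cluster n d => o.1 j := by fun_prop
    exact h3.sub (hG.comp measurable_snd)
  refine (memLp_two_iff_integrable_sq hm.aestronglyMeasurable).2 ?_
  -- Disintegration over treatments and covariates: the inner integral of the squared residual is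
  -- the conditional variance, whose integrability is the assumption.
  have e1 : T.map (fun o : Cluster n d => (o.2, o.1)) = T.map (fun o => o.2) ⊗ₘ κ :=
    (compProd_map_condDistrib measurable_fst.aemeasurable).symm
  have e2 : Integrable (fun q : (Trt n × Cov n d) × Out n => (q.2 j - ∫ y, y j ∂(κ q.1)) ^ 2)
      (T.map (fun o => o.2) ⊗ₘ κ) := by
    rw [Measure.integrable_compProd_iff hF.aestronglyMeasurable]
    constructor
    · refine ae_map_trtCov_of_forall (p := fun z => Integrable
        (fun y : Out n => (y j - ∫ y, y j ∂(κ z)) ^ 2) (κ z)) fun a => ?_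
      filter_upwards [h2 a] with x hx
      have hj : MemLp (fun y : Out n => y j) 2 (κ (a, x)) := hx.eval j
      exact (hj.sub (memLp_const _)).integrable_sq
    · have e3 : ∀ z, ∫ y : Out n, ‖(y j - ∫ y, y j ∂(κ z)) ^ 2‖ ∂(κ z) =
          covariance (fun y : Out n => y j) (fun y => y j) (κ z) := by
        intro z
        rw [covariance]
        refine integral_congr_ae (ae_of_all _ fun y => ?_)
        dsimp only
        rw [Real.norm_of_nonneg (sq_nonneg _), sq]
      simp only [e3]
      have hcm : Measurable fun z => covariance (fun y : Out n => y j) (fun y => y j) (κ z) := by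
        simp only [← e3]
        exact (hF.norm.stronglyMeasurable.integral_kernel_prod_right' (κ := κ)).measurable
      rw [integrable_map_measure hcm.aestronglyMeasurable measurable_snd.aemeasurable]
      refine integrable_of_apply (f := fun a x => covariance (fun y : Out n => y j) (fun y => y j)
        (κ (a, x))) (fun a => hcm.comp (by fun_prop)) fun a => ?_
      exact (hc a).comp_measurable measurable_cov
  rw [← e1, integrable_map_measure hF.aestronglyMeasurable (by fun_prop)] at e2
  exact e2

end Cluster

/-! ### Identification of the means of the potential outcomes. -/

section Identification

/-- Inverse weighting of a conditionally independent event by its conditional probability. -/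
theorem setIntegral_inv_condProb {Ω : Type*} {m mΩ : MeasurableSpace Ω} (hle : m ≤ mΩ)
    {T : Measure Ω} [IsFiniteMeasure T] {S A : Set Ω} (hS : MeasurableSet S) (hA : MeasurableSet A)
    (hind : T⟦S ∩ A | m⟧ =ᵐ[T] fun ω => (T⟦S | m⟧) ω * (T⟦A | m⟧) ω)
    {E : Ω → ℝ} (hE : StronglyMeasurable[m] E) {c : ℝ} (hc : 0 < c) (hcE : ∀ᵐ ω ∂T, c ≤ E ω)
    (hEA : E =ᵐ[T] T⟦A | m⟧) : ∫ ω in S ∩ A, (E ω)⁻¹ ∂T = T.real S := by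
  have hEi : StronglyMeasurable[m] fun ω => (E ω)⁻¹ := hE.measurable.inv.stronglyMeasurable
  have hi : Integrable ((S ∩ A).indicator fun _ => (1 : ℝ)) T :=
    (integrable_const _).indicator (hS.inter hA)
  have hb : ∀ᵐ ω ∂T, ‖(E ω)⁻¹‖ ≤ c⁻¹ := by
    filter_upwards [hcE] with ω hω
    rw [norm_inv, Real.norm_of_nonneg (hc.le.trans hω)]
    gcongr
  have hprod : Integrable ((fun ω => (E ω)⁻¹) * (S ∩ A).indicator fun _ => (1 : ℝ)) T :=
    hi.bdd_mul (hEi.mono hle).aestronglyMeasurable hb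
  have h1 := condExp_mul_of_stronglyMeasurable_left (μ := T) hEi hprod hi
  calc ∫ ω in S ∩ A, (E ω)⁻¹ ∂T
      = ∫ ω, ((fun ω => (E ω)⁻¹) * (S ∩ A).indicator fun _ => (1 : ℝ)) ω ∂T := by
        rw [← integral_indicator (hS.inter hA)]
        congr with ω
        by_cases h : ω ∈ S ∩ A <;> simp [h, Set.indicator]
    -- Given `m`, independence factors the conditional probability of `S ∩ A`, and the weight `E⁻¹`
    -- cancels that of `A`.
    _ = ∫ ω, (T⟦S | m⟧) ω ∂T := by
        rw [← integral_condExp hle]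
        refine integral_congr_ae ?_
        filter_upwards [h1, hind, hEA, hcE] with ω a1 a2 a3 a4
        rw [a1, Pi.mul_apply, a2, ← a3]
        have : E ω ≠ 0 := (hc.trans_le a4).ne'
        field_simp
    _ = T.real S := by
        rw [integral_condExp hle, integral_indicator_const _ hS]
        simp

variable {n d : ℕ} {T : Measure (FullCluster n d)} {e : Trt n → Cov n d → ℝ} {c : ℝ}

/-- Ignorability concerns conditional probabilities on the space with potential outcomes, whereas
`IsPropensity` concerns the law of the observed data; this links the two. -/
theorem IsPropensity.ae_eq_condExp [IsFiniteMeasure T] (he : IsPropensity (T.map Prod.snd) e c)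
    (a : Trt n) : (fun w : FullCluster n d => e a w.2.2.2) =ᵐ[T]
      T⟦(fun w : FullCluster n d => w.2.2.1) ⁻¹' {a} |
        MeasurableSpace.comap (fun w : FullCluster n d => w.2.2.2) inferInstance⟧ := by
  have hem := he.measurable a
  have hA : Measurable fun w : FullCluster n d => w.2.2.1 := by fun_prop
  have hX : Measurable fun w : FullCluster n d => w.2.2.2 := by fun_prop
  have hei : Integrable (fun w : FullCluster n d => e a w.2.2.2) T := by
    have := (he.integrableOn_iff a (f := fun _ => 1) measurable_const).1 (integrable_const _)
    simp only [mul_one] at this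
    exact this.comp_measurable measurable_snd
  refine ae_eq_condExp_of_forall_setIntegral_eq (Measurable.comap_le hX)
    ((integrable_const _).indicator (hA (measurableSet_singleton a))) ?_ ?_ ?_
  · exact fun _ _ _ => hei.integrableOn
  · rintro s ⟨t, ht, rfl⟩ _
    have h1 := he.setIntegral_eq a (f := t.indicator fun _ => 1) (measurable_const.indicator ht)
    rw [← integral_indicator (measurableSet_trt a),
      integral_map measurable_snd.aemeasurable, integral_map measurable_snd.aemeasurable] at h1
    · rw [← integral_indicator (hX ht), ← integral_indicator (hX ht)]
      refine Eq.trans (integral_congr_ae (ae_of_all _ fun w => ?_))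
        (h1.symm.trans (integral_congr_ae (ae_of_all _ fun w => ?_)))
      · by_cases hw : w.2.2.2 ∈ t <;> simp [Set.indicator, hw]
      · by_cases hw : w.2.2.2 ∈ t <;> by_cases hw' : w.2.2.1 = a <;> simp [Set.indicator, hw, hw']
    · have : Measurable (t.indicator fun _ => (1 : ℝ)) := measurable_const.indicator ht
      exact ((hem.comp measurable_cov).mul (this.comp measurable_cov)).aestronglyMeasurable
    · have : Measurable (t.indicator fun _ => (1 : ℝ)) := measurable_const.indicator ht
      exact ((this.comp measurable_cov).indicator (measurableSet_trt a)).aestronglyMeasurable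
  · exact (hem.comp (comap_measurable _)).stronglyMeasurable.aestronglyMeasurable

/-- Under ignorability, weighting by the inverse propensity score of the treatment `a` turns the
law of `Y(a)` on the clusters with treatment `a` into the law of `Y(a)`. -/
theorem map_potentialOutcome [IsFiniteMeasure T] (he : IsPropensity (T.map Prod.snd) e c)
    (a : Trt n)
    (hind : CondIndepFun
      (MeasurableSpace.comap (fun w : FullCluster n d => w.2.2.2) inferInstance)
      (Measurable.comap_le (by fun_prop)) (fun w => w.1 a) (fun w => w.2.2.1) T) :
    T.map (fun w => w.1 a) = ((T.restrict {w | w.2.2.1 = a}).withDensity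
      fun w => ENNReal.ofReal (e a w.2.2.2)⁻¹).map (fun w => w.1 a) := by
  have hc := he.pos
  have hem := he.measurable a
  have hY : Measurable fun w : FullCluster n d => w.1 a := by fun_prop
  have hA : Measurable fun w : FullCluster n d => w.2.2.1 := by fun_prop
  have hX : Measurable fun w : FullCluster n d => w.2.2.2 := by fun_prop
  have hov : ∀ᵐ w ∂T, c ≤ e a w.2.2.2 :=
    ae_of_ae_map measurable_snd.aemeasurable (he.overlap a)
  have hAs : MeasurableSet {w : FullCluster n d | w.2.2.1 = a} := hA (measurableSet_singleton a)
  rw [condIndepFun_iff_condExp_inter_preimage_eq_mul hY hA] at hind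
  ext s hs
  have hSs : MeasurableSet ((fun w : FullCluster n d => w.1 a) ⁻¹' s) := hY hs
  have key := setIntegral_inv_condProb (Measurable.comap_le hX) hSs hAs
    (hind s {a} hs (measurableSet_singleton a)) (E := fun w => e a w.2.2.2)
    (hem.comp (comap_measurable _)).stronglyMeasurable hc hov (he.ae_eq_condExp a)
  rw [Measure.map_apply hY hs, Measure.map_apply hY hs, withDensity_apply _ hSs,
    Measure.restrict_restrict hSs, ← ofReal_integral_eq_lintegral_ofReal, key, ofReal_measureReal]
  · refine Measure.integrableOn_of_bounded (M := c⁻¹) (measure_ne_top _ _) ?_ ?_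
    · exact (hem.comp hX).inv.aestronglyMeasurable
    · refine ae_restrict_of_ae ?_
      filter_upwards [hov] with w hw
      rw [norm_inv, Real.norm_of_nonneg (hc.le.trans hw)]
      gcongr
  · refine ae_restrict_of_ae ?_
    filter_upwards [hov] with w hw
    exact inv_nonneg.2 (hc.le.trans hw)

/-- Identification of the mean of a potential outcome. -/
theorem integral_potentialOutcome [IsFiniteMeasure T] (he : IsPropensity (T.map Prod.snd) e c)
    {G : Trt n → Cov n d → Out n} (hG : IsRegression (T.map Prod.snd) G)
    (hYi : ∀ j, Integrable (fun o => o.1 j) (T.map Prod.snd))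
    (hcons : ∀ᵐ w ∂T, w.2.1 = w.1 w.2.2.1) (a : Trt n)
    (hind : CondIndepFun
      (MeasurableSpace.comap (fun w : FullCluster n d => w.2.2.2) inferInstance)
      (Measurable.comap_le (by fun_prop)) (fun w => w.1 a) (fun w => w.2.2.1) T) (j : Fin n) :
    Integrable (fun w => w.1 a j) T ∧
      ∫ w, w.1 a j ∂T = ∫ o, G a o.2.2 j ∂(T.map Prod.snd) := by
  have hc := he.pos
  have hem := he.measurable a
  have hY : Measurable fun w : FullCluster n d => w.1 a := by fun_prop
  have hX : Measurable fun w : FullCluster n d => w.2.2.2 := by fun_prop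
  have hA : Measurable fun w : FullCluster n d => w.2.2.1 := by fun_prop
  have hAs : MeasurableSet {w : FullCluster n d | w.2.2.1 = a} := hA (measurableSet_singleton a)
  have hmap := map_potentialOutcome he a hind
  have hcoord : Measurable fun y : Out n => y j := measurable_pi_apply j
  have hov : ∀ᵐ w ∂T, c ≤ e a w.2.2.2 :=
    ae_of_ae_map measurable_snd.aemeasurable (he.overlap a)
  -- The weight `1(A = a) / e(a, X)`. It is bounded, by overlap, and a function of treatments and
  -- covariates, so it may multiply the residual without changing its conditional mean zero.
  set q : Trt n × Cov n d → ℝ := fun p => if p.1 = a then (e a p.2)⁻¹ else 0 with hq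
  have hqm : Measurable q := by
    refine Measurable.ite (measurable_fst (measurableSet_singleton a)) ?_ measurable_const
    exact (hem.comp measurable_snd).inv
  have hqb : ∀ᵐ o ∂(T.map Prod.snd), |q o.2| ≤ c⁻¹ := by
    filter_upwards [he.overlap a] with o ho
    simp only [q]
    split_ifs
    · rw [abs_inv, abs_of_nonneg (hc.le.trans ho)]
      gcongr
    · simp [hc.le]
  have hqY : Integrable (fun o => q o.2 * o.1 j) (T.map Prod.snd) :=
    (hYi j).bdd_mul (hqm.comp measurable_snd).aestronglyMeasurable hqb
  have hqG := (hG.condMean j).mul_bdd hqm hqb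
  -- Consistency enters here: on `A = a` the observed outcome is `Y(a)`.
  have hwt : (fun w : FullCluster n d => q w.2.2 * w.2.1 j) =ᵐ[T]
      {w : FullCluster n d | w.2.2.1 = a}.indicator
        fun w => (ENNReal.ofReal (e a w.2.2.2)⁻¹).toReal • w.1 a j := by
    filter_upwards [hcons, hov] with w hw ho
    by_cases h : w.2.2.1 = a
    · simp only [q, Set.indicator, Set.mem_ofPred_eq, h, if_true, smul_eq_mul]
      rw [hw, h, ENNReal.toReal_ofReal (inv_nonneg.2 (hc.le.trans ho))]
    · simp [q, Set.indicator, h]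
  have hYT : Integrable (fun w : FullCluster n d => q w.2.2 * w.2.1 j) T :=
    hqY.comp_measurable measurable_snd
  have hdm : Measurable fun w : FullCluster n d => ENNReal.ofReal (e a w.2.2.2)⁻¹ :=
    (hem.comp hX).inv.ennreal_ofReal
  constructor
  -- Integrability of `Y(a)` is not assumed; it is inherited from the weighted observed outcome.
  · have h1 : Integrable (fun y : Out n => y j) (T.map (fun w => w.1 a)) := by
      rw [hmap, integrable_map_measure hcoord.aestronglyMeasurable hY.aemeasurable,
        integrable_withDensity_iff_integrable_smul' hdm
        (ae_of_all _ fun _ => ENNReal.ofReal_lt_top)]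
      change IntegrableOn _ _ T
      rw [← integrable_indicator_iff hAs]
      exact hYT.congr hwt
    exact h1.comp_measurable hY
  · have h2 : ∫ w, w.1 a j ∂T = ∫ w, q w.2.2 * w.2.1 j ∂T := by
      rw [integral_congr_ae hwt, integral_indicator hAs,
        ← integral_withDensity_eq_integral_toReal_smul hdm
          (ae_of_all _ fun _ => ENNReal.ofReal_lt_top) (fun w : FullCluster n d => w.1 a j),
        ← integral_map (f := fun y : Out n => y j) hY.aemeasurable hcoord.aestronglyMeasurable,
        ← integral_map (f := fun y : Out n => y j) hY.aemeasurable hcoord.aestronglyMeasurable,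
        ← hmap]
    have h3 : ∫ w, q w.2.2 * w.2.1 j ∂T = ∫ o, q o.2 * o.1 j ∂(T.map Prod.snd) :=
      (integral_map measurable_snd.aemeasurable
        ((hqm.comp measurable_snd).mul (hcoord.comp measurable_fst)).aestronglyMeasurable).symm
    have hqGi : Integrable (fun o => q o.2 * G o.2.1 o.2.2 j) (T.map Prod.snd) := by
      refine (hqY.sub hqG.integrable).congr (ae_of_all _ fun o => ?_)
      simp only [Pi.sub_apply]
      ring
    have h4 : ∫ o, q o.2 * o.1 j ∂(T.map Prod.snd)
        = ∫ o, q o.2 * G o.2.1 o.2.2 j ∂(T.map Prod.snd) := by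
      rw [← sub_eq_zero, ← integral_sub hqY hqGi, ← hqG.integral_eq_zero]
      congr with o
      ring
    have hGj : Measurable fun x => G a x j := (measurable_pi_apply j).comp (hG.measurable a)
    have h5 : ∫ o, q o.2 * G o.2.1 o.2.2 j ∂(T.map Prod.snd)
        = ∫ o in {o | o.2.1 = a}, (e a o.2.2)⁻¹ * G a o.2.2 j ∂(T.map Prod.snd) := by
      rw [← integral_indicator (measurableSet_trt a)]
      congr with o
      by_cases h : o.2.1 = a
      · simp [q, h, Set.indicator]
      · simp [q, h, Set.indicator]
    rw [h2, h3, h4, h5, he.setIntegral_eq a (f := fun x => (e a x)⁻¹ * G a x j)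
      (hem.inv.mul hGj)]
    refine integral_congr_ae ?_
    filter_upwards [he.overlap a] with o ho
    have := (hc.trans_le ho).ne'
    field_simp

end Identification

end PartialInterference

/-! ### The efficient influence function. -/

namespace PartialInterference

variable {K : ℕ} {M d : Fin K → ℕ}

section Sigma

variable {β : Fin K → Type} [∀ k, MeasurableSpace (β k)]

theorem map_typeMeas_le (μ : Measure (Σ k, β k)) (k : Fin K) :
    (typeMeas μ k).map (Sigma.mk k) ≤ μ := by
  rw [typeMeas, (measurableEmbedding_sigmaMk k).map_comap]
  exact Measure.restrict_le_self

theorem memLp_typeMeas {E : Type*} [NormedAddCommGroup E] {μ : Measure (Σ k, β k)}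
    {f : (Σ k, β k) → E} {p : ENNReal} (hf : MemLp f p μ) (k : Fin K) :
    MemLp (fun o => f ⟨k, o⟩) p (typeMeas μ k) :=
  (hf.mono_measure (map_typeMeas_le μ k)).comp_of_map (measurable_sigmaMk k).aemeasurable

theorem integral_typeMeas_le {μ : Measure (Σ k, β k)} {f : (Σ k, β k) → ℝ} (hf : Integrable f μ)
    (h0 : ∀ z, 0 ≤ f z) (k : Fin K) : ∫ o, f ⟨k, o⟩ ∂(typeMeas μ k) ≤ ∫ z, f z ∂μ := by
  rw [integral_eq_sum_typeMeas μ f hf]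
  exact Finset.single_le_sum (f := fun k => ∫ o, f ⟨k, o⟩ ∂(typeMeas μ k))
    (fun k _ => integral_nonneg fun o => h0 _) (Finset.mem_univ k)

/-- The squared remainder is nonnegative, so its integral over one type is at most that over all
types and stays `o(‖η‖ ^ 2)`. -/
theorem IsDQM.typeMeas {E : Type*} [NormedAddCommGroup E] [InnerProductSpace ℝ E]
    {μ : Measure (Σ k, β k)} [IsFiniteMeasure μ] {r : E → (Σ k, β k) → ℝ} {s : (Σ k, β k) → E}
    {C : ℝ} (h : IsDQM μ r s C) (k : Fin K) :
    IsDQM (typeMeas μ k) (fun η o => r η ⟨k, o⟩) (fun o => s ⟨k, o⟩) C where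
  pos := h.pos
  measurable η := (h.measurable η).comp (measurable_sigmaMk k)
  score := memLp_typeMeas h.score k
  bounds := by
    filter_upwards [h.bounds] with η hη
    exact (ae_iff_typeMeas μ _).1 hη k
  littleO := by
    refine IsBigO.trans_isLittleO (IsBigO.of_bound 1 ?_) h.littleO
    filter_upwards [h.bounds, h.abs_sub_one_le] with η hη hb
    have hu0 : MemLp (fun z => √(r η z) - 1) 2 μ := by
      refine memLp_of_ae_abs_le (C := C + 1) (by have := h.measurable η; fun_prop) ?_
      filter_upwards [hη, hb] with z hz hz'
      exact (abs_sqrt_sub_one_le ((inv_pos.2 h.pos).le.trans hz.1)).trans hz'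
    have hi : MemLp (fun z => 2⁻¹ * inner ℝ η (s z)) 2 μ := (memLp_inner_left h.score η).const_mul _
    have hu : MemLp (fun z => √(r η z) - 1 - 2⁻¹ * inner ℝ η (s z)) 2 μ := hu0.sub hi
    rw [one_mul, Real.norm_of_nonneg (integral_nonneg fun z => sq_nonneg _),
      Real.norm_of_nonneg (integral_nonneg fun z => sq_nonneg _)]
    exact integral_typeMeas_le hu.integrable_sq (fun z => sq_nonneg _) k

end Sigma

/-- `e` and `g` are the propensity score and the outcome regression of the law `P`, with overlap,
and with the moments that make the augmented inverse probability weighted term integrable. -/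
structure IsNuisance (P : ProbabilityMeasure (Obs M d)) (e : PSFun M d) (g : ORFun M d) (c : ℝ) :
    Prop where
  typeProb_pos : ∀ k, 0 < typeProb (P : Measure (Obs M d)) k
  propensity : ∀ k, IsPropensity (typeMeas (P : Measure (Obs M d)) k) (e k) c
  regression : ∀ k, IsRegression (typeMeas (P : Measure (Obs M d)) k) (g k)
  integrable : ∀ k j, Integrable (fun o : Cluster (M k) (d k) => g k o.2.1 o.2.2 j)
    (typeMeas (P : Measure (Obs M d)) k)
  residual : ∀ k j, MemLp (fun o : Cluster (M k) (d k) => o.1 j - g k o.2.1 o.2.2 j) 2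
    (typeMeas (P : Measure (Obs M d)) k)
  eq_outcomeReg : ∀ k a, ∀ᵐ o ∂(typeMeas (P : Measure (Obs M d)) k),
    outcomeReg P k a o.2.2 = g k a o.2.2

theorem measurable_outcomeReg (P : ProbabilityMeasure (Obs M d)) (k : Fin K) (a : Trt (M k)) :
    Measurable (outcomeReg P k a) := by
  refine measurable_pi_lambda _ fun j => ?_
  have := ((measurable_pi_apply j).stronglyMeasurable (f := fun y : Out (M k) => y j)).integral_kernel
    (κ := condDistrib (fun o : Cluster (M k) (d k) => o.1) (fun o => o.2)
      (typeLaw (P : Measure (Obs M d)) k))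
  exact this.measurable.comp (by fun_prop)

theorem isRegression_outcomeReg (P : ProbabilityMeasure (Obs M d)) (k : Fin K)
    (hk : 0 < typeProb (P : Measure (Obs M d)) k)
    (hY : ∀ j, Integrable (fun o => o.1 j) (typeMeas (P : Measure (Obs M d)) k)) :
    IsRegression (typeMeas (P : Measure (Obs M d)) k) (outcomeReg P k) := by
  have h1 : IsRegression (typeLaw (P : Measure (Obs M d)) k) (outcomeReg P k) :=
    isRegression_of_condDistrib (measurable_outcomeReg P k)
      (fun j => (integrable_typeLaw_iff _ hk _).2 (hY j)) (ae_of_all _ fun o j => rfl)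
  have h0 : (P : Measure (Obs M d)) {z | z.1 = k} ≠ 0 := by
    intro h
    simp [typeProb, measureReal_def, h] at hk
  have h2 : typeMeas (P : Measure (Obs M d)) k =
      (P : Measure (Obs M d)) {z | z.1 = k} • typeLaw (P : Measure (Obs M d)) k := by
    rw [typeLaw_eq_smul, smul_smul, ENNReal.mul_inv_cancel h0 (measure_ne_top _ _), one_smul]
  rw [h2]
  exact h1.smul (measure_ne_top _ _)

/-- The factor `p_k` undoes the conditioning on the type, so variation of the type probabilities
along a submodel needs no separate treatment. -/
theorem tau_eq_sum {w : Weights M d} (hw : ∀ k a, Measurable (w k a))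
    (P : ProbabilityMeasure (Obs M d)) :
    tau w vId P = ∑ k, ∑ a, ∫ o, ∑ j, w k a o.2.2 j * outcomeReg P k a o.2.2 j
      ∂(typeMeas (P : Measure (Obs M d)) k) := by
  unfold tau theta vId
  refine Finset.sum_congr rfl fun k _ => ?_
  rw [Finset.mul_sum]
  refine Finset.sum_congr rfl fun a _ => ?_
  rw [covariateLaw, integral_map measurable_cov.aemeasurable
    (measurable_weighted (hw k) (measurable_outcomeReg P k) a).aestronglyMeasurable,
    typeProb_mul_integral]

variable {P : ProbabilityMeasure (Obs M d)} {e : PSFun M d} {g : ORFun M d} {c B : ℝ}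
  {w : Weights M d}

theorem integrable_phi_and_integral_typeMeas (h : IsNuisance P e g c)
    (hw : ∀ k, BddWeights (w k) B) (k : Fin K) :
    Integrable (phi w e g k) (typeMeas (P : Measure (Obs M d)) k) ∧
      ∫ o, phi w e g k o ∂(typeMeas (P : Measure (Obs M d)) k)
        = typeProb (P : Measure (Obs M d)) k * theta w P k := by
  obtain ⟨h1, h2⟩ := (h.propensity k).aipw_integrable (hw k) (h.regression k) (h.integrable k)
  refine ⟨h1, ?_⟩
  change ∫ o, aipw (w k) (e k) (g k) o ∂(typeMeas (P : Measure (Obs M d)) k) = _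
  rw [h2, theta, Finset.mul_sum]
  refine Finset.sum_congr rfl fun a _ => ?_
  rw [covariateLaw, integral_map measurable_cov.aemeasurable (measurable_weighted
    (hw k).measurable (measurable_outcomeReg P k) a).aestronglyMeasurable, typeProb_mul_integral]
  refine integral_congr_ae ?_
  filter_upwards [h.eq_outcomeReg k a] with o ho
  rw [ho]

theorem integrable_phi (h : IsNuisance P e g c) (hw : ∀ k, BddWeights (w k) B) :
    Integrable (fun z => phi w e g z.1 z.2) (P : Measure (Obs M d)) :=
  (integrable_iff_typeMeas _ _).2 fun k => (integrable_phi_and_integral_typeMeas h hw k).1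

theorem integral_phi (h : IsNuisance P e g c) (hw : ∀ k, BddWeights (w k) B) :
    ∫ z, phi w e g z.1 z.2 ∂(P : Measure (Obs M d)) = tau w vId P := by
  rw [integral_eq_sum_typeMeas _ _ (integrable_phi h hw)]
  exact Finset.sum_congr rfl fun k _ => (integrable_phi_and_integral_typeMeas h hw k).2

theorem IsNuisance.integrable_outcome (h : IsNuisance P e g c) (k : Fin K) (j : Fin (M k)) :
    Integrable (fun o : Cluster (M k) (d k) => o.1 j) (typeMeas (P : Measure (Obs M d)) k) := by
  refine (((h.residual k j).integrable (by norm_num)).add (h.integrable k j)).congr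
    (ae_of_all _ fun o => ?_)
  simp

/-- The bound on the remainder of the expansion of `tau` along a law with bounded likelihood
ratio. -/
theorem abs_tau_sub_le (h : IsNuisance P e g c) (hw : ∀ k, BddWeights (w k) B) (C : ℝ) :
    ∃ κ : Fin K → ℝ, (∀ k, 0 ≤ κ k) ∧ ∀ (Q : ProbabilityMeasure (Obs M d)) (ρ : Obs M d → ℝ),
      BddDensity (P : Measure (Obs M d)) ρ C →
      (Q : Measure (Obs M d)) = tilt (P : Measure (Obs M d)) ρ →
      |∫ z, phi w e g z.1 z.2 ∂(Q : Measure (Obs M d)) - tau w vId Q| ≤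
        ∑ k, √(κ k * (∑ j, ∫ o, ((o.1 j - g k o.2.1 o.2.2 j) * (ρ ⟨k, o⟩ - 1)) ^ 2
          ∂(typeMeas (P : Measure (Obs M d)) k)) *
          ∫ o, (ρ ⟨k, o⟩ - 1) ^ 2 ∂(typeMeas (P : Measure (Obs M d)) k)) := by
  refine ⟨fun k => (2 / c ^ 2 + 2 * Fintype.card (Trt (M k)) / c) * (M k * B ^ 2 * C ^ 2),
    fun k => by have := (h.propensity k).pos; positivity, fun Q ρ hρ hQ => ?_⟩
  have hρk : ∀ k, BddDensity (typeMeas (P : Measure (Obs M d)) k) (fun o => ρ ⟨k, o⟩) C := fun k =>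
    ⟨hρ.pos, hρ.measurable.comp (measurable_sigmaMk k), (ae_iff_typeMeas _ _).1 hρ.bounds k⟩
  have hQk : ∀ k, typeMeas (Q : Measure (Obs M d)) k =
      tilt (typeMeas (P : Measure (Obs M d)) k) (fun o => ρ ⟨k, o⟩) := fun k => by
    rw [hQ, tilt, typeMeas_withDensity]
    rfl
  have hφQ : Integrable (fun z => phi w e g z.1 z.2) (Q : Measure (Obs M d)) := by
    rw [hQ, hρ.integrable_tilt_iff]
    exact integrable_phi h hw
  -- The lower bound on the density keeps every type probability positive under `Q`, as identifying
  -- the regression of `Q` on each type requires.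
  have hpos : ∀ k, 0 < typeProb (Q : Measure (Obs M d)) k := fun k => by
    have h1 := h.typeProb_pos k
    rw [typeProb, measureReal_def, ENNReal.toReal_pos_iff] at h1 ⊢
    refine ⟨?_, measure_lt_top _ _⟩
    rw [pos_iff_ne_zero]
    intro h0
    rw [hQ] at h0
    have h2 := hρ.le_tilt {z | z.1 = k}
    rw [Measure.smul_apply, h0, smul_zero] at h2
    exact h1.1.ne' (le_antisymm h2 zero_le)
  rw [tau_eq_sum (fun k => (hw k).measurable), integral_eq_sum_typeMeas _ _ hφQ,
    ← Finset.sum_sub_distrib]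
  refine (Finset.abs_sum_le_sum_abs _ _).trans (Finset.sum_le_sum fun k _ => ?_)
  refine Real.abs_le_sqrt ?_
  have hreg := isRegression_outcomeReg Q k (hpos k) (fun j => by
    rw [hQk, (hρk k).integrable_tilt_iff]
    exact h.integrable_outcome k j)
  rw [hQk] at hreg ⊢
  exact sq_integral_aipw_sub_le (h.propensity k) (hw k) (h.regression k) (h.integrable k)
    (h.residual k) (hρk k) hreg

/-- The centered augmented inverse probability weighted term is the efficient influence
function. -/
theorem isEfficientInfluenceFunction_phi (h : IsNuisance P e g c) (hw : ∀ k, BddWeights (w k) B)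
    (hφ : MemLp (fun z => phi w e g z.1 z.2) 2 (P : Measure (Obs M d))) :
    IsEfficientInfluenceFunction (tau w vId) P
      (fun z => phi w e g z.1 z.2 - tau w vId P) := by
  have hmem : MemLp (fun z => phi w e g z.1 z.2 - tau w vId P) 2 (P : Measure (Obs M d)) :=
    hφ.sub (memLp_const _)
  have hmean : ∫ z, (phi w e g z.1 z.2 - tau w vId P) ∂(P : Measure (Obs M d)) = 0 := by
    rw [integral_sub (integrable_phi h hw) (integrable_const _), integral_phi h hw]
    simp
  refine ⟨hmem, hmean, ?_, inTangentSpace_of_integral_eq_zero P hmem hmean⟩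
  intro m Q s hQ
  obtain ⟨r, C, hr, hQr⟩ := hQ.exists_isDQM
  obtain ⟨D, hD0, hD⟩ := hr.integral_sq_le
  obtain ⟨κ, hκ0, hκ⟩ := abs_tau_sub_le h hw C
  have hφs : ∀ η : EuclideanSpace ℝ (Fin m),
      inner ℝ (∫ z, (phi w e g z.1 z.2 - tau w vId P) • s z ∂(P : Measure (Obs M d))) η
        = ∫ z, (phi w e g z.1 z.2 - tau w vId P) * inner ℝ η (s z) ∂(P : Measure (Obs M d)) := by
    intro η
    have hi : Integrable (fun z => (phi w e g z.1 z.2 - tau w vId P) • s z)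
        (P : Measure (Obs M d)) := by
      exact memLp_one_iff_integrable.1 (hr.score.smul hmem)
    rw [real_inner_comm, ← integral_inner hi]
    simp only [inner_smul_right]
  rw [hasGradientAt_iff_hasFDerivAt, hasFDerivAt_iff_isLittleO]
  simp only [sub_zero, InnerProductSpace.toDual_apply_apply, hφs, hQ.base]
  have main := hr.integral_mul_sub_isLittleO hmem
  -- For each type the bound is the root of an `o(1)` factor, from the squared residuals, times a
  -- factor of at most `D * ‖η‖ ^ 2`.
  have hrem : (fun η => ∫ z, phi w e g z.1 z.2 ∂(Q η : Measure (Obs M d)) - tau w vId (Q η))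
      =o[𝓝 0] (fun η => η) := by
    have hlim : Tendsto (fun η => ∑ k, √(κ k * (∑ j, ∫ o, ((o.1 j - g k o.2.1 o.2.2 j) *
        (r η ⟨k, o⟩ - 1)) ^ 2 ∂(typeMeas (P : Measure (Obs M d)) k)) * D)) (𝓝 0) (𝓝 0) := by
      have : ∀ k, Tendsto (fun η => √(κ k * (∑ j, ∫ o, ((o.1 j - g k o.2.1 o.2.2 j) *
          (r η ⟨k, o⟩ - 1)) ^ 2 ∂(typeMeas (P : Measure (Obs M d)) k)) * D)) (𝓝 0) (𝓝 0) := by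
        intro k
        have h1 := tendsto_finsetSum Finset.univ fun j (_ : j ∈ Finset.univ) =>
          (hr.typeMeas k).tendsto_integral_sq (h.residual k j)
        have h2 := ((h1.const_mul (κ k)).mul_const D).sqrt
        simpa using h2
      simpa using tendsto_finsetSum Finset.univ fun k (_ : k ∈ Finset.univ) => this k
    rw [isLittleO_iff]
    intro ε hε
    filter_upwards [hQr, hr.bounds, hD, hr.memLp_sub_one, hlim.eventually (gt_mem_nhds hε)]
      with η h1 h2 h3 h4 h5
    have h6 := hκ (Q η) (r η) ⟨hr.pos, hr.measurable η, h2⟩ h1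
    rw [Real.norm_eq_abs]
    refine h6.trans (le_trans ?_ (mul_le_mul_of_nonneg_right h5.le (norm_nonneg η)))
    rw [Finset.sum_mul]
    refine Finset.sum_le_sum fun k _ => ?_
    have h7 := integral_typeMeas_le h4.integrable_sq (fun z => sq_nonneg _) k
    have h8 := hκ0 k
    have h9 : 0 ≤ ∑ j, ∫ o, ((o.1 j - g k o.2.1 o.2.2 j) * (r η ⟨k, o⟩ - 1)) ^ 2
        ∂(typeMeas (P : Measure (Obs M d)) k) :=
      Finset.sum_nonneg fun j _ => integral_nonneg fun o => sq_nonneg _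
    calc _ ≤ √(κ k * (∑ j, ∫ o, ((o.1 j - g k o.2.1 o.2.2 j) * (r η ⟨k, o⟩ - 1)) ^ 2
          ∂(typeMeas (P : Measure (Obs M d)) k)) * (D * ‖η‖ ^ 2)) := by
          gcongr
          exact h7.trans h3
      _ = _ := by
          rw [← mul_assoc, Real.sqrt_mul' _ (sq_nonneg _), Real.sqrt_sq (norm_nonneg _)]
  -- With `Q = Q η`, the increment of `tau` is `(E_Q phi - tau(P)) - (E_Q phi - tau(Q))`. The first
  -- bracket is an integral of `phi - tau(P)` against `r - 1`, because `phi - tau(P)` has mean zero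
  -- under `P`.
  refine (main.sub hrem).congr' ?_ EventuallyEq.rfl
  filter_upwards [hQr, hr.bounds, hr.memLp_sub_one] with η h1 h2 h3
  have hρ : BddDensity (P : Measure (Obs M d)) (r η) C := ⟨hr.pos, hr.measurable η, h2⟩
  have e1 : ∫ z, phi w e g z.1 z.2 ∂(Q η : Measure (Obs M d)) - tau w vId P
      = ∫ z, (phi w e g z.1 z.2 - tau w vId P) * (r η z - 1) ∂(P : Measure (Obs M d)) := by
    have i1 : Integrable (fun z => phi w e g z.1 z.2) (Q η : Measure (Obs M d)) := by
      rw [h1]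
      exact (hρ.integrable_tilt_iff _).2 (integrable_phi h hw)
    have i2 : Integrable (fun z => phi w e g z.1 z.2 - tau w vId P) (Q η : Measure (Obs M d)) :=
      i1.sub (integrable_const _)
    have e2 : ∫ z, phi w e g z.1 z.2 ∂(Q η : Measure (Obs M d)) - tau w vId P
        = ∫ z, (phi w e g z.1 z.2 - tau w vId P) ∂(Q η : Measure (Obs M d)) := by
      rw [integral_sub i1 (integrable_const _)]
      simp
    have h4 : (Q η : Measure (Obs M d)) = tilt (P : Measure (Obs M d)) (r η) := h1
    rw [e2, h4, hρ.integral_eq, ← sub_zero (∫ z, r η z * _ ∂_), ← hmean, ← integral_sub]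
    · congr with z
      ring
    · rw [h4] at i2
      exact (hρ.integrable_iff _).1 i2
    · exact hmem.integrable (by norm_num)
  rw [← e1]
  ring

end PartialInterference

/-! ### Consequences of the identifying assumptions. -/

namespace PartialInterference

variable {K : ℕ} {M d : Fin K → ℕ} {F : ProbabilityMeasure (FullObs M d)}

theorem typeMeas_obsLaw (k : Fin K) :
    typeMeas (obsLaw F : Measure (Obs M d)) k
      = (typeMeas (F : Measure (FullObs M d)) k).map Prod.snd := by
  ext s hs
  have hm := (measurableEmbedding_sigmaMk (β := fun k => Cluster (M k) (d k)) k).measurableSet_image.2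
    hs
  rw [typeMeas_apply, Measure.map_apply measurable_snd hs, typeMeas_apply, obsLaw,
    ProbabilityMeasure.toMeasure_map, Measure.map_apply measurable_observe hm]
  congr 1
  ext ⟨l, w⟩
  simp only [observe, Set.mem_preimage, Set.mem_image]
  constructor
  · rintro ⟨o, ho, h⟩
    obtain ⟨rfl, h⟩ := Sigma.mk.inj_iff.1 h
    obtain rfl := eq_of_heq h
    exact ⟨w, ho, rfl⟩
  · rintro ⟨v, hv, h⟩
    obtain ⟨rfl, h⟩ := Sigma.mk.inj_iff.1 h
    obtain rfl := eq_of_heq h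
    exact ⟨_, hv, rfl⟩

theorem obsLaw_type (k : Fin K) : (obsLaw F : Measure (Obs M d)) {z | z.1 = k}
    = (F : Measure (FullObs M d)) {z | z.1 = k} := by
  rw [obsLaw, ProbabilityMeasure.toMeasure_map,
    Measure.map_apply measurable_observe (measurableSet_type k)]
  rfl

theorem typeProb_obsLaw (k : Fin K) : typeProb (obsLaw F : Measure (Obs M d)) k
    = typeProb (F : Measure (FullObs M d)) k := by
  rw [typeProb, typeProb, measureReal_def, measureReal_def, obsLaw_type]

theorem typeLaw_obsLaw (k : Fin K) :
    typeLaw (obsLaw F : Measure (Obs M d)) k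
      = (typeLaw (F : Measure (FullObs M d)) k).map Prod.snd := by
  rw [typeLaw_eq_smul, typeLaw_eq_smul, Measure.map_smul, typeMeas_obsLaw, obsLaw_type]

theorem typeMeas_eq_smul {β : Fin K → Type} [∀ k, MeasurableSpace (β k)] (μ : Measure (Σ k, β k))
    [IsFiniteMeasure μ] {k : Fin K} (hk : 0 < typeProb μ k) :
    typeMeas μ k = μ {z | z.1 = k} • typeLaw μ k := by
  have h0 : μ {z | z.1 = k} ≠ 0 := by
    intro h
    simp [typeProb, measureReal_def, h] at hk
  rw [typeLaw_eq_smul, smul_smul, ENNReal.mul_inv_cancel h0 (measure_ne_top _ _), one_smul]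

theorem IdentifyingAssumptions.typeProb_obsLaw_pos (hF : IdentifyingAssumptions F)
    (k : Fin K) :
    0 < typeProb (obsLaw F : Measure (Obs M d)) k := by
  rw [typeProb_obsLaw]
  exact hF.typeProb_pos k

theorem IdentifyingAssumptions.memLp_residual_outcomeReg (hF : IdentifyingAssumptions F)
    (k : Fin K) (j : Fin (M k)) :
    MemLp (fun o : Cluster (M k) (d k) => o.1 j - outcomeReg (obsLaw F) k o.2.1 o.2.2 j) 2
      (typeLaw (obsLaw F : Measure (Obs M d)) k) :=
  memLp_residual (T := typeLaw (obsLaw F : Measure (Obs M d)) k)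
    (fun a => hF.cond_moments k a) j (fun a => hF.integrable_cov k a j j)

theorem IdentifyingAssumptions.integrable_outcomeReg (hF : IdentifyingAssumptions F)
    (k : Fin K) (j : Fin (M k)) :
    Integrable (fun o : Cluster (M k) (d k) => outcomeReg (obsLaw F) k o.2.1 o.2.2 j)
      (typeLaw (obsLaw F : Measure (Obs M d)) k) :=
  integrable_of_apply (f := fun a x => outcomeReg (obsLaw F) k a x j)
    (fun a => (measurable_pi_apply j).comp (measurable_outcomeReg _ k a))
    fun a => (hF.integrable_reg k a j).comp_measurable measurable_cov

theorem IdentifyingAssumptions.integrable_outcome (hF : IdentifyingAssumptions F)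
    (k : Fin K) (j : Fin (M k)) :
    Integrable (fun o : Cluster (M k) (d k) => o.1 j)
      (typeLaw (obsLaw F : Measure (Obs M d)) k) := by
  refine (((hF.memLp_residual_outcomeReg k j).integrable (by norm_num)).add
    (hF.integrable_outcomeReg k j)).congr (ae_of_all _ fun o => ?_)
  simp

theorem IdentifyingAssumptions.isRegression (hF : IdentifyingAssumptions F)
    (k : Fin K) :
    IsRegression (typeLaw (obsLaw F : Measure (Obs M d)) k) (outcomeReg (obsLaw F) k) :=
  isRegression_of_condDistrib (measurable_outcomeReg _ k) (hF.integrable_outcome k)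
    (ae_of_all _ fun _ _ => rfl)

theorem IdentifyingAssumptions.exists_isPropensity (hF : IdentifyingAssumptions F) {qe : ℕ}
    {e : EuclideanSpace ℝ (Fin qe) → PSFun M d} (he : ∀ b k a, Measurable (e b k a))
    {b : EuclideanSpace ℝ (Fin qe)} (hb : TruePS (obsLaw F) e b) :
    ∃ c, ∀ k, IsPropensity (typeLaw (obsLaw F : Measure (Obs M d)) k) (e b k) c := by
  obtain ⟨c, hc, ho⟩ := hF.overlap
  refine ⟨c, fun k => isPropensity_of_condDistrib hc (he b k) (hb k) fun a => ?_⟩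
  filter_upwards [hb k a, ho k a] with x h1 h2
  rw [← h1]
  exact h2.1.le

/-- Collects what the analysis of `phi` needs. Finite expected conditional variances make residuals
square integrable, integrable regressions then make outcomes integrable, and the model functions at
true parameters replace the conditional versions almost everywhere. -/
theorem IdentifyingAssumptions.exists_isNuisance (hF : IdentifyingAssumptions F) {qe qg : ℕ}
    {e : EuclideanSpace ℝ (Fin qe) → PSFun M d} (he : ∀ b k a, Measurable (e b k a))
    {b : EuclideanSpace ℝ (Fin qe)} (hb : TruePS (obsLaw F) e b)
    {g : EuclideanSpace ℝ (Fin qg) → ORFun M d} (hg : ∀ b k a, Measurable (g b k a))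
    {b' : EuclideanSpace ℝ (Fin qg)} (hb' : TrueOR (obsLaw F) g b') :
    ∃ c, IsNuisance (obsLaw F) (e b) (g b') c := by
  obtain ⟨c, hc⟩ := hF.exists_isPropensity he hb
  have hsm := fun k => typeMeas_eq_smul (obsLaw F : Measure (Obs M d))
    (hF.typeProb_obsLaw_pos k)
  have hfin : ∀ k, (obsLaw F : Measure (Obs M d)) {z | z.1 = k} ≠ ⊤ := fun k => measure_ne_top _ _
  have hae : ∀ k, ∀ᵐ o ∂(typeLaw (obsLaw F : Measure (Obs M d)) k),
      outcomeReg (obsLaw F) k o.2.1 o.2.2 = g b' k o.2.1 o.2.2 := fun k =>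
    ae_trtCov_of_forall (p := fun a x => outcomeReg (obsLaw F) k a x = g b' k a x) (hb' k)
  have hreg : ∀ k, IsRegression (typeLaw (obsLaw F : Measure (Obs M d)) k) (g b' k) := fun k => by
    refine isRegression_of_condDistrib (hg b' k) (hF.integrable_outcome k) ?_
    filter_upwards [hae k] with o ho j
    rw [← ho]
    rfl
  refine ⟨c, ⟨hF.typeProb_obsLaw_pos, fun k => ?_, fun k => ?_, fun k j => ?_, fun k j => ?_,
    fun k a => ?_⟩⟩
  · rw [hsm k]
    exact (hc k).smul _
  · rw [hsm k]
    exact (hreg k).smul (hfin k)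
  · rw [hsm k]
    refine Integrable.smul_measure ((hF.integrable_outcomeReg k j).congr ?_) (hfin k)
    filter_upwards [hae k] with o ho
    rw [ho]
  · rw [hsm k]
    refine MemLp.smul_measure ((memLp_congr_ae ?_).1 (hF.memLp_residual_outcomeReg k j)) (hfin k)
    filter_upwards [hae k] with o ho
    rw [ho]
  · exact (ae_typeLaw_iff (β := fun k => Cluster (M k) (d k)) _ _).1
      (ae_of_ae_map measurable_cov.aemeasurable (hb' k a))

/-- Identification of the causal estimands from the law of the observed data. -/
theorem IdentifyingAssumptions.tau_eq (hF : IdentifyingAssumptions F) {qe : ℕ}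
    {e : EuclideanSpace ℝ (Fin qe) → PSFun M d} (he : ∀ b k a, Measurable (e b k a))
    {b : EuclideanSpace ℝ (Fin qe)} (hb : TruePS (obsLaw F) e b) {w : Weights M d}
    {w' : (k : Fin K) → Trt (M k) → Out (M k)} (hw : ∀ k a x j, w k a x j = w' k a j) :
    tau w vId (obsLaw F)
      = ∫ z, ∑ a, ∑ j, w' z.1 a j * z.2.1 a j ∂(F : Measure (FullObs M d)) := by
  obtain ⟨c, hc⟩ := hF.exists_isPropensity he hb
  have hpot : ∀ k a j, Integrable (fun v : FullCluster (M k) (d k) => v.1 a j)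
      (typeLaw (F : Measure (FullObs M d)) k) ∧
      ∫ v, v.1 a j ∂(typeLaw (F : Measure (FullObs M d)) k)
        = ∫ o, outcomeReg (obsLaw F) k a o.2.2 j ∂(typeLaw (obsLaw F : Measure (Obs M d)) k) := by
    intro k a j
    have h1 := hc k
    have h2 := hF.isRegression k
    have h3 := hF.integrable_outcome k
    rw [typeLaw_obsLaw] at h1 h2 h3 ⊢
    refine integral_potentialOutcome h1 h2 h3 ?_ a (hF.ignorability k a) j
    exact (ae_typeLaw_iff (β := fun k => FullCluster (M k) (d k)) _ _).2
      ((ae_iff_typeMeas _ _).1 hF.consistency k)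
  have hi : ∀ k a j, Integrable (fun v : FullCluster (M k) (d k) => w' k a j * v.1 a j)
      (typeLaw (F : Measure (FullObs M d)) k) := fun k a j => (hpot k a j).1.const_mul _
  have hint : Integrable (fun z : FullObs M d => ∑ a, ∑ j, w' z.1 a j * z.2.1 a j)
      (F : Measure (FullObs M d)) := by
    rw [integrable_iff_typeMeas]
    intro k
    exact (integrable_typeLaw_iff (β := fun k => FullCluster (M k) (d k)) (F : Measure (FullObs M d))
      (hF.typeProb_pos k) (fun v => ∑ a, ∑ j, w' k a j * v.1 a j)).1
      (integrable_finsetSum _ fun a _ => integrable_finsetSum _ fun j _ => hi k a j)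
  have hsum : ∀ k, ∫ v : FullCluster (M k) (d k), ∑ a, ∑ j, w' k a j * v.1 a j
      ∂(typeLaw (F : Measure (FullObs M d)) k) = theta w (obsLaw F) k := by
    intro k
    rw [integral_finsetSum _ fun a _ => integrable_finsetSum _ fun j _ => hi k a j, theta]
    refine Finset.sum_congr rfl fun a _ => ?_
    simp only [hw]
    have hir : ∀ j, Integrable (fun x => w' k a j * outcomeReg (obsLaw F) k a x j)
        (covariateLaw (obsLaw F) k) := fun j => (hF.integrable_reg k a j).const_mul _
    rw [integral_finsetSum _ fun j _ => hi k a j, integral_finsetSum _ fun j _ => hir j]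
    refine Finset.sum_congr rfl fun j _ => ?_
    have hm : Measurable fun x => outcomeReg (obsLaw F) k a x j :=
      (measurable_pi_apply j).comp (measurable_outcomeReg _ k a)
    rw [integral_const_mul, integral_const_mul, (hpot k a j).2, covariateLaw,
      integral_map measurable_cov.aemeasurable hm.aestronglyMeasurable]
  rw [integral_eq_sum_typeMeas _ _ hint, tau]
  refine Finset.sum_congr rfl fun k _ => ?_
  rw [typeProb_obsLaw, vId, ← hsum k]
  exact typeProb_mul_integral (β := fun k => FullCluster (M k) (d k)) (F : Measure (FullObs M d)) k
    (fun v => ∑ a, ∑ j, w' k a j * v.1 a j)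

end PartialInterference

namespace PartialInterference

/-! ### Sample means and M-estimation. -/

section Sampling

variable {Ω : Type*} [MeasurableSpace Ω] {μ : Measure Ω} {Z : Type*} [MeasurableSpace Z]
  {P : Measure Z} {D : ℕ → Ω → Z}

/-- The `D i` are independent draws from `P`. -/
structure IsSample (μ : Measure Ω) (P : Measure Z) (D : ℕ → Ω → Z) : Prop where
  measurable : ∀ i, Measurable (D i)
  indep : iIndepFun D μ
  law : ∀ i, μ.map (D i) = P

/-- The random variables `X N` are bounded in probability. -/
def BddInProb (μ : Measure Ω) (X : ℕ → Ω → ℝ) : Prop :=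
  ∀ ε : ENNReal, ε ≠ 0 → ∃ R : ℝ, 0 < R ∧ ∀ N, μ {ω | R ≤ X N ω} ≤ ε

theorem IsSample.ae (h : IsSample μ P D) {p : Z → Prop} (hp : ∀ᵐ z ∂P, p z) :
    ∀ᵐ ω ∂μ, ∀ i, p (D i ω) := by
  rw [ae_all_iff]
  intro i
  rw [← h.law i] at hp
  exact ae_of_ae_map (h.measurable i).aemeasurable hp

theorem IsSample.memLp_comp (h : IsSample μ P D) {E : Type*} [NormedAddCommGroup E] {f : Z → E}
    {p : ENNReal} (hf : MemLp f p P) (i : ℕ) : MemLp (fun ω => f (D i ω)) p μ := by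
  rw [← h.law i] at hf
  exact hf.comp_of_map (h.measurable i).aemeasurable

theorem IsSample.integral_comp (h : IsSample μ P D) {E : Type*} [NormedAddCommGroup E]
    [NormedSpace ℝ E] {f : Z → E} (hf : AEStronglyMeasurable f P) (i : ℕ) :
    ∫ ω, f (D i ω) ∂μ = ∫ z, f z ∂P := by
  have hf' := hf
  rw [← h.law i] at hf' ⊢
  exact (integral_map (h.measurable i).aemeasurable hf').symm

theorem IsSample.indepFun_comp (h : IsSample μ P D) {E : Type*} [MeasurableSpace E] {f : Z → E}
    (hf : AEMeasurable f P) {i j : ℕ} (hij : i ≠ j) :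
    IndepFun (fun ω => f (D i ω)) (fun ω => f (D j ω)) μ := by
  have h1 : AEMeasurable f (μ.map (D i)) := by rwa [h.law i]
  have h2 : AEMeasurable f (μ.map (D j)) := by rwa [h.law j]
  exact (h.indep.indepFun hij).comp₀ (h.measurable i).aemeasurable (h.measurable j).aemeasurable
    h1 h2

/-- The law of large numbers. -/
theorem IsSample.tendstoInMeasure_mean (h : IsSample μ P D) [IsFiniteMeasure μ] {E : Type*}
    [NormedAddCommGroup E] [NormedSpace ℝ E] [CompleteSpace E] [MeasurableSpace E] [BorelSpace E] {f : Z → E}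
    (hf : Integrable f P) :
    TendstoInMeasure μ (fun (N : ℕ) ω => (N : ℝ)⁻¹ • ∑ i : Fin N, f (D i ω)) atTop
      (fun _ => ∫ z, f z ∂P) := by
  have hi : ∀ i, Integrable (fun ω => f (D i ω)) μ := fun i =>
    memLp_one_iff_integrable.1 (h.memLp_comp (memLp_one_iff_integrable.2 hf) i)
  have key := strong_law_ae (fun i ω => f (D i ω)) (hi 0)
    (fun i j hij => h.indepFun_comp hf.1.aemeasurable hij) (fun i => by
      have h0 : IdentDistrib (D i) (D 0) μ μ :=
        ⟨(h.measurable i).aemeasurable, (h.measurable 0).aemeasurable, by rw [h.law, h.law]⟩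
      exact h0.comp_of_aemeasurable (by rw [h.law]; exact hf.1.aemeasurable))
  refine tendstoInMeasure_of_tendsto_ae (fun N => ?_) ?_
  · have hs : AEStronglyMeasurable (fun ω => ∑ i : Fin N, f (D i ω)) μ :=
      Finset.aestronglyMeasurable_fun_sum _ fun i _ => (hi i).1
    exact hs.const_smul (N : ℝ)⁻¹
  · filter_upwards [key] with ω hω
    rw [h.integral_comp hf.1] at hω
    refine hω.congr fun N => ?_
    rw [Finset.sum_range]

/-- A normalized sum of centered terms has at most the variance of one term. -/
theorem IsSample.variance_normalized_sum_le (h : IsSample μ P D) [IsProbabilityMeasure μ]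
    {f : Z → ℝ} (hf : MemLp f 2 P) (h0 : ∫ z, f z ∂P = 0) (N : ℕ) :
    variance (fun ω => (√(N : ℝ))⁻¹ * ∑ i : Fin N, f (D i ω)) μ ≤ ∫ z, f z ^ 2 ∂P := by
  have hV0 : 0 ≤ ∫ z, f z ^ 2 ∂P := integral_nonneg fun z => sq_nonneg _
  have hfD : ∀ i, MemLp (fun ω => f (D i ω)) 2 μ := fun i => h.memLp_comp hf i
  have h1 : variance (∑ i : Fin N, fun ω => f (D i ω)) μ
      = ∑ i : Fin N, variance (fun ω => f (D i ω)) μ :=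
    IndepFun.variance_sum (fun i _ => hfD i) (fun i _ j _ hij =>
      h.indepFun_comp hf.1.aemeasurable (fun hh => hij (Fin.ext hh)))
  have h2 : ∀ i, variance (fun ω => f (D i ω)) μ = ∫ z, f z ^ 2 ∂P := by
    intro i
    rw [variance_eq_integral (hfD i).1.aemeasurable, h.integral_comp hf.1, h0]
    simp only [sub_zero]
    exact h.integral_comp (f := fun z => f z ^ 2) (hf.1.pow 2) i
  have h3 : (fun ω => ∑ i : Fin N, f (D i ω)) = ∑ i : Fin N, fun ω => f (D i ω) := by
    ext ω
    simp
  rw [variance_const_mul, h3, h1]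
  simp only [h2, Finset.sum_const, Finset.card_univ, Fintype.card_fin, nsmul_eq_mul]
  rw [inv_pow, Real.sq_sqrt (Nat.cast_nonneg N), ← mul_assoc]
  -- The factor `N⁻¹ * N` is one except for `N = 0`, where it is zero; hence a bound and not an
  -- equality.
  exact mul_le_of_le_one_left hV0 inv_mul_le_one

theorem IsSample.bddInProb_real (h : IsSample μ P D) [IsProbabilityMeasure μ] {f : Z → ℝ}
    (hf : MemLp f 2 P) (h0 : ∫ z, f z ∂P = 0) :
    BddInProb μ (fun N ω => |(√(N : ℝ))⁻¹ * ∑ i : Fin N, f (D i ω)|) := by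
  intro ε hε
  have hV0 : 0 ≤ ∫ z, f z ^ 2 ∂P := integral_nonneg fun z => sq_nonneg _
  obtain ⟨ε', hε', hεε⟩ : ∃ ε' : ℝ, 0 < ε' ∧ ENNReal.ofReal ε' ≤ ε := by
    by_cases ht : ε = ⊤
    · exact ⟨1, one_pos, by simp [ht]⟩
    · exact ⟨ε.toReal, ENNReal.toReal_pos hε ht, by rw [ENNReal.ofReal_toReal ht]⟩
  -- Chosen so that Chebyshev's bound, the variance over the square of this number, is at most `ε'`;
  -- the added `1` keeps the radius positive for zero variance.
  have hR : 0 < √((∫ z, f z ^ 2 ∂P + 1) / ε') := by positivity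
  refine ⟨_, hR, fun N => le_trans ?_ hεε⟩
  have hfD : ∀ i, MemLp (fun ω => f (D i ω)) 2 μ := fun i => h.memLp_comp hf i
  have hs : MemLp (fun ω => ∑ i : Fin N, f (D i ω)) 2 μ :=
    memLp_finsetSum Finset.univ fun (i : Fin N) _ => hfD i
  have hmean : ∫ ω, (√(N : ℝ))⁻¹ * ∑ i : Fin N, f (D i ω) ∂μ = 0 := by
    rw [integral_const_mul, integral_finsetSum Finset.univ
      fun (i : Fin N) _ => (hfD i).integrable (by norm_num)]
    simp [h.integral_comp hf.1, h0]
  have hvar := h.variance_normalized_sum_le hf h0 N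
  have hch := meas_ge_le_variance_div_sq (hs.const_mul (√(N : ℝ))⁻¹) hR
  rw [hmean] at hch
  simp only [sub_zero] at hch
  refine hch.trans (ENNReal.ofReal_le_ofReal ?_)
  rw [Real.sq_sqrt (by positivity), div_le_iff₀ (by positivity)]
  refine hvar.trans ?_
  rw [mul_div_cancel₀ _ hε'.ne']
  linarith

/-- Coordinates reduce this to the real case by a union bound. Since the first order effect of `β̂`
vanishes, boundedness suffices and no limit law of the sum is needed. -/
theorem IsSample.bddInProb (h : IsSample μ P D) [IsProbabilityMeasure μ] [IsFiniteMeasure P] {E : Type*}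
    [NormedAddCommGroup E]
    [NormedSpace ℝ E] [FiniteDimensional ℝ E] {f : Z → E} (hf : MemLp f 2 P)
    (h0 : ∫ z, f z ∂P = 0) :
    BddInProb μ (fun N ω => ‖(√(N : ℝ))⁻¹ • ∑ i : Fin N, f (D i ω)‖) := by
  let b := Module.finBasis ℝ E
  set n := Module.finrank ℝ E
  let Φ : E ≃L[ℝ] (Fin n → ℝ) := b.equivFun.toContinuousLinearEquiv
  let coord : Fin n → (E →L[ℝ] ℝ) := fun l => (ContinuousLinearMap.proj l).comp Φ.toContinuousLinearMap
  have hfl : ∀ l, BddInProb μ (fun N ω => |(√(N : ℝ))⁻¹ * ∑ i : Fin N, coord l (f (D i ω))|) := by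
    intro l
    refine h.bddInProb_real (f := fun z => coord l (f z)) ((coord l).comp_memLp' hf) ?_
    rw [(coord l).integral_comp_comm (hf.integrable (by norm_num)), h0, map_zero]
  intro ε hε
  have hε' : ε / (n + 1 : ℕ) ≠ 0 := by
    simp only [ne_eq, ENNReal.div_eq_zero_iff, not_or]
    exact ⟨hε, ENNReal.natCast_ne_top _⟩
  choose R hR0 hR using fun l => hfl l _ hε'
  set C : ℝ := ‖Φ.symm.toContinuousLinearMap‖ + 1
  have hC : 0 < C := by positivity
  have hsum : 0 ≤ ∑ l, R l := Finset.sum_nonneg fun l _ => (hR0 l).le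
  refine ⟨C * (∑ l, R l + 1), by positivity, fun N => ?_⟩
  have hsub : {ω | C * (∑ l, R l + 1) ≤ ‖(√(N : ℝ))⁻¹ • ∑ i : Fin N, f (D i ω)‖} ⊆
      ⋃ l, {ω | R l ≤ |(√(N : ℝ))⁻¹ * ∑ i : Fin N, coord l (f (D i ω))|} := by
    intro ω hω
    by_contra hcon
    simp only [Set.mem_iUnion, not_exists] at hcon
    have hlt : ∀ l, |(√(N : ℝ))⁻¹ * ∑ i : Fin N, coord l (f (D i ω))| < R l :=
      fun l => not_le.1 (hcon l)
    set v := (√(N : ℝ))⁻¹ • ∑ i : Fin N, f (D i ω)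
    have hv : ∀ l, Φ v l = (√(N : ℝ))⁻¹ * ∑ i : Fin N, coord l (f (D i ω)) := by
      intro l
      change coord l v = _
      simp only [v, map_smul, map_sum, smul_eq_mul]
    have h1 : ‖Φ v‖ ≤ ∑ l, R l := by
      refine (pi_norm_le_iff_of_nonneg hsum).2 fun l => ?_
      rw [hv l]
      exact (hlt l).le.trans (Finset.single_le_sum (f := R) (fun l _ => (hR0 l).le)
        (Finset.mem_univ l))
    have h2 : ‖v‖ ≤ ‖Φ.symm.toContinuousLinearMap‖ * ‖Φ v‖ := by
      simpa using Φ.symm.toContinuousLinearMap.le_opNorm (Φ v)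
    have h3 : C * (∑ l, R l + 1) ≤ ‖v‖ := hω
    have h4 : ‖v‖ ≤ C * ∑ l, R l := h2.trans (by
      gcongr
      simp [C])
    nlinarith
  calc _ ≤ _ := measure_mono hsub
    _ ≤ ∑ l, μ {ω | R l ≤ |(√(N : ℝ))⁻¹ * ∑ i : Fin N, coord l (f (D i ω))|} :=
      measure_iUnion_fintype_le _ _
    _ ≤ ∑ l : Fin n, ε / (n + 1 : ℕ) := Finset.sum_le_sum fun l _ => hR l N
    _ ≤ (n + 1 : ℕ) * (ε / (n + 1 : ℕ)) := by
      rw [Finset.sum_const, Finset.card_univ, Fintype.card_fin, nsmul_eq_mul]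
      gcongr
      omega
    _ ≤ ε := ENNReal.mul_div_le

/-- The remainder bound of a first order Taylor expansion at `x₀`, uniformly on a ball. -/
def TaylorBound {E G : Type*} [NormedAddCommGroup E] [NormedSpace ℝ E] [NormedAddCommGroup G]
    [NormedSpace ℝ G] (f : E → G) (x₀ : E) (r : ℝ) (L : E →L[ℝ] G) (H : ℝ) : Prop :=
  ∀ x ∈ Metric.ball x₀ r, ‖f x - f x₀ - L (x - x₀)‖ ≤ H * ‖x - x₀‖ ^ 2

theorem norm_sum_sub_le {E G : Type*} [NormedAddCommGroup E] [NormedSpace ℝ E]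
    [NormedAddCommGroup G] [NormedSpace ℝ G] {N : ℕ} {f : Fin N → E → G} {x₀ x : E} {r : ℝ}
    {L : Fin N → E →L[ℝ] G} {H : Fin N → ℝ} (h : ∀ i, TaylorBound (f i) x₀ r (L i) (H i))
    (hx : x ∈ Metric.ball x₀ r) :
    ‖(N : ℝ)⁻¹ • ∑ i, f i x - (N : ℝ)⁻¹ • ∑ i, f i x₀ - ((N : ℝ)⁻¹ • ∑ i, L i) (x - x₀)‖ ≤
      ((N : ℝ)⁻¹ • ∑ i, H i) * ‖x - x₀‖ ^ 2 := by
  have e : (N : ℝ)⁻¹ • ∑ i, f i x - (N : ℝ)⁻¹ • ∑ i, f i x₀ - ((N : ℝ)⁻¹ • ∑ i, L i) (x - x₀)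
      = (N : ℝ)⁻¹ • ∑ i, (f i x - f i x₀ - L i (x - x₀)) := by
    simp only [Finset.sum_sub_distrib, smul_sub, smul_apply,
      sum_apply]
  rw [e, norm_smul, Real.norm_of_nonneg (by positivity), smul_eq_mul, mul_assoc, Finset.sum_mul]
  gcongr
  exact norm_sum_le_of_le _ fun i _ => h i x hx

/-- Estimating the nuisance parameter by an estimating equation has no first order effect on a
sample mean whose expected derivative vanishes. -/
theorem tendstoInMeasure_sub_of_orthogonal (hD : IsSample μ P D) [IsProbabilityMeasure μ]
    [IsProbabilityMeasure P] {E : Type*}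
    [NormedAddCommGroup E] [NormedSpace ℝ E] [FiniteDimensional ℝ E]
    {ψ : Z → E → E} {h : Z → E → ℝ} {x₀ : E} {r : ℝ} (hr : 0 < r)
    {Lψ : Z → E →L[ℝ] E} {Lh : Z → E →L[ℝ] ℝ} {H : Z → ℝ}
    (hLψ : Integrable Lψ P) (hLh : Integrable Lh P) (hH : Integrable H P)
    (hTψ : ∀ᵐ z ∂P, TaylorBound (ψ z) x₀ r (Lψ z) (H z))
    (hTh : ∀ᵐ z ∂P, TaylorBound (h z) x₀ r (Lh z) (H z))
    {m : ℝ} (hm : 0 < m) (hA : ∀ v, m * ‖v‖ ≤ ‖(∫ z, Lψ z ∂P) v‖)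
    (horth : ∫ z, Lh z ∂P = 0)
    (hψ2 : MemLp (fun z => ψ z x₀) 2 P) (hψ0 : ∫ z, ψ z x₀ ∂P = 0)
    {xhat : ℕ → Ω → E}
    (hlim : TendstoInMeasure μ xhat atTop (fun _ => x₀))
    (hsol : Tendsto (fun N : ℕ => μ {ω | ∑ i : Fin N, ψ (D i ω) (xhat N ω) ≠ 0}) atTop (𝓝 0)) :
    TendstoInMeasure μ (fun (N : ℕ) ω => (√(N : ℝ))⁻¹ *
      ∑ i : Fin N, (h (D i ω) (xhat N ω) - h (D i ω) x₀)) atTop (fun _ => (0 : ℝ)) := by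
  set A := ∫ z, Lψ z ∂P
  have l1 := hD.tendstoInMeasure_mean hLψ
  have l2 := hD.tendstoInMeasure_mean hLh
  have l3 := hD.tendstoInMeasure_mean hH
  rw [horth] at l2
  rw [tendstoInMeasure_iff_norm] at l1 l2 l3 hlim ⊢
  intro ε hε
  rw [ENNReal.tendsto_nhds_zero]
  intro δ hδ
  have hδ2 : δ / 2 ≠ 0 := by simp [hδ.ne']
  obtain ⟨R, hR0, hR⟩ := hD.bddInProb hψ2 hψ0 _ hδ2
  set c := |∫ z, H z ∂P| + 1 with hc
  have hc0 : 0 < c := by positivity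
  -- The radius `t` keeps the estimator in the Taylor ball, lets the quadratic remainder be absorbed
  -- by the invertible derivative, and makes the final bound smaller than `ε`. Here `c` bounds the
  -- sample mean of `H` outside a rare event.
  obtain ⟨t, ht0, ht1, ht2, ht3⟩ : ∃ t : ℝ, 0 < t ∧ t ≤ r ∧ c * t ≤ m / 4 ∧
      (t + c * t) * (2 / m * R) < ε := by
    have hcont : Tendsto (fun t : ℝ => (t + c * t) * (2 / m * R)) (𝓝[>] 0) (𝓝 ((0 + c * 0) * (2 / m * R))) :=
      (Continuous.tendsto (by fun_prop) 0).mono_left nhdsWithin_le_nhds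
    have hcont2 : Tendsto (fun t : ℝ => c * t) (𝓝[>] 0) (𝓝 (c * 0)) :=
      (Continuous.tendsto (by fun_prop) 0).mono_left nhdsWithin_le_nhds
    have e1 := hcont.eventually (gt_mem_nhds (show (0 + c * 0) * (2 / m * R) < ε by simpa using hε))
    have e2 := hcont2.eventually (gt_mem_nhds (show c * 0 < m / 4 by
      rw [mul_zero]; positivity))
    have e3 : ∀ᶠ t : ℝ in 𝓝[>] 0, t < r := nhdsWithin_le_nhds (gt_mem_nhds hr)
    have e4 : ∀ᶠ t : ℝ in 𝓝[>] 0, 0 < t := self_mem_nhdsWithin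
    obtain ⟨t, h1, h2, h3, h4⟩ := (e1.and (e2.and (e3.and e4))).exists
    exact ⟨t, h4, h3.le, h2.le, h1⟩
  have hlim5 := ((((l1 (m / 4) (by positivity)).add (l2 t ht0)).add (l3 1 one_pos)).add
    (hlim t ht0)).add hsol
  simp only [add_zero] at hlim5
  have hev := (ENNReal.tendsto_nhds_zero.1 hlim5) (δ / 2) (pos_iff_ne_zero.2 hδ2)
  filter_upwards [hev, eventually_gt_atTop 0] with N hN hN0
  -- Outside these six rare events the argument is deterministic: sample means are near their
  -- limits, the estimator is near `x₀` and solves its equation, and the normalized score is at most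
  -- `R`.
  set E1 := {ω | m / 4 ≤ ‖(N : ℝ)⁻¹ • ∑ i : Fin N, Lψ (D i ω) - A‖}
  set E2 := {ω | t ≤ ‖(N : ℝ)⁻¹ • ∑ i : Fin N, Lh (D i ω) - 0‖}
  set E3 := {ω | 1 ≤ ‖(N : ℝ)⁻¹ • ∑ i : Fin N, H (D i ω) - ∫ z, H z ∂P‖}
  set E4 := {ω | t ≤ ‖xhat N ω - x₀‖}
  set E5 := {ω | ∑ i : Fin N, ψ (D i ω) (xhat N ω) ≠ 0}
  set E6 := {ω | R ≤ ‖(√(N : ℝ))⁻¹ • ∑ i : Fin N, ψ (D i ω) x₀‖}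
  have hsub : ∀ᵐ ω ∂μ,
      ω ∈ {ω | ε ≤ ‖(√(N : ℝ))⁻¹ * ∑ i : Fin N, (h (D i ω) (xhat N ω) - h (D i ω) x₀) - 0‖} →
        ω ∈ ((((E1 ∪ E2) ∪ E3) ∪ E4) ∪ E5) ∪ E6 := by
    filter_upwards [hD.ae hTψ, hD.ae hTh] with ω hω1 hω2 hω
    by_contra hcon
    simp only [Set.mem_union, not_or] at hcon
    obtain ⟨⟨⟨⟨⟨n1, n2⟩, n3⟩, n4⟩, n5⟩, n6⟩ := hcon
    have n1 : ‖(N : ℝ)⁻¹ • ∑ i : Fin N, Lψ (D i ω) - A‖ < m / 4 := not_le.1 n1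
    have n2 : ‖(N : ℝ)⁻¹ • ∑ i : Fin N, Lh (D i ω) - 0‖ < t := not_le.1 n2
    have n3 : ‖(N : ℝ)⁻¹ • ∑ i : Fin N, H (D i ω) - ∫ z, H z ∂P‖ < 1 := not_le.1 n3
    have n4 : ‖xhat N ω - x₀‖ < t := not_le.1 n4
    have n5 : ∑ i : Fin N, ψ (D i ω) (xhat N ω) = 0 := not_not.1 n5
    have n6 : ‖(√(N : ℝ))⁻¹ • ∑ i : Fin N, ψ (D i ω) x₀‖ < R := not_le.1 n6
    have hω : ε ≤ ‖(√(N : ℝ))⁻¹ * ∑ i : Fin N, (h (D i ω) (xhat N ω) - h (D i ω) x₀) - 0‖ := hω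
    have hball : xhat N ω ∈ Metric.ball x₀ r := by
      rw [mem_ball_iff_norm]
      exact n4.trans_le ht1
    have b1 := norm_sum_sub_le (N := N) (fun i => hω1 i) hball
    have b2 := norm_sum_sub_le (N := N) (fun i => hω2 i) hball
    rw [n5, smul_zero, zero_sub] at b1
    rw [sub_zero] at n2 hω
    set v := xhat N ω - x₀
    set Hb := (N : ℝ)⁻¹ • ∑ i : Fin N, H (D i ω)
    have hHb : Hb ≤ c := by
      have h1 := (abs_lt.1 n3).2
      have h2 := le_abs_self (∫ z, H z ∂P)
      linarith
    set Ab := (N : ℝ)⁻¹ • ∑ i : Fin N, Lψ (D i ω)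
    set Lb := (N : ℝ)⁻¹ • ∑ i : Fin N, Lh (D i ω)
    set s := (N : ℝ)⁻¹ • ∑ i : Fin N, ψ (D i ω) x₀ with hs
    have hv := norm_nonneg v
    have q1 : ‖Ab v‖ ≤ ‖s‖ + Hb * ‖v‖ ^ 2 := by
      have : Ab v = -s - (-s - Ab v) := by abel
      calc ‖Ab v‖ = ‖-s - (-s - Ab v)‖ := by rw [← this]
        _ ≤ ‖-s‖ + ‖-s - Ab v‖ := norm_sub_le _ _
        _ ≤ _ := by rw [norm_neg]; gcongr
    have q2 : ‖A v‖ ≤ m / 4 * ‖v‖ + ‖Ab v‖ := by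
      calc ‖A v‖ = ‖Ab v - (Ab - A) v‖ := by simp
        _ ≤ ‖Ab v‖ + ‖(Ab - A) v‖ := norm_sub_le _ _
        _ ≤ ‖Ab v‖ + m / 4 * ‖v‖ := by
          gcongr
          exact (ContinuousLinearMap.le_opNorm _ _).trans (by gcongr)
        _ = _ := by ring
    have q0 : Hb * ‖v‖ ^ 2 ≤ c * t * ‖v‖ := by
      rw [sq, ← mul_assoc]
      gcongr
    have q3 : Hb * ‖v‖ ^ 2 ≤ m / 4 * ‖v‖ := q0.trans (by gcongr)
    -- The rate of the estimator: of `m * ‖v‖`, one quarter is lost to the error in the derivative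
    -- and one to the Taylor remainder, leaving `(m / 2) * ‖v‖ ≤ ‖s‖`.
    have q4 : ‖v‖ ≤ 2 / m * ‖s‖ := by
      have := hA v
      rw [div_mul_eq_mul_div, le_div_iff₀ hm]
      linarith
    have hsN : 0 < √(N : ℝ) := Real.sqrt_pos.2 (Nat.cast_pos.2 hN0)
    have hNN : (√(N : ℝ))⁻¹ = √(N : ℝ) * (N : ℝ)⁻¹ := by
      have : (N : ℝ) = √(N : ℝ) * √(N : ℝ) := (Real.mul_self_sqrt (Nat.cast_nonneg N)).symm
      rw [eq_mul_inv_iff_mul_eq₀ (Nat.cast_pos.2 hN0).ne', inv_mul_eq_iff_eq_mul₀ hsN.ne']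
      exact this
    have q5 : √(N : ℝ) * ‖s‖ < R := by
      rwa [hNN, mul_smul, norm_smul, Real.norm_of_nonneg hsN.le] at n6
    -- Orthogonality is used here: the averaged derivative of `h` has norm less than `t`, so the
    -- increment is a small multiple of `‖v‖`, which itself is of order `N^(-1/2)`.
    have q6 : ‖(N : ℝ)⁻¹ • ∑ i : Fin N, h (D i ω) (xhat N ω) -
        (N : ℝ)⁻¹ • ∑ i : Fin N, h (D i ω) x₀‖ ≤ (t + c * t) * ‖v‖ := by
      set u := (N : ℝ)⁻¹ • ∑ i : Fin N, h (D i ω) (xhat N ω) -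
        (N : ℝ)⁻¹ • ∑ i : Fin N, h (D i ω) x₀
      calc ‖u‖ = ‖(u - Lb v) + Lb v‖ := by rw [sub_add_cancel]
        _ ≤ ‖u - Lb v‖ + ‖Lb v‖ := norm_add_le _ _
        _ ≤ Hb * ‖v‖ ^ 2 + t * ‖v‖ := by
          gcongr
          exact (ContinuousLinearMap.le_opNorm _ _).trans (by gcongr)
        _ ≤ c * t * ‖v‖ + t * ‖v‖ := add_le_add q0 le_rfl
        _ = _ := by ring
    have q7 : ‖(√(N : ℝ))⁻¹ * ∑ i : Fin N, (h (D i ω) (xhat N ω) - h (D i ω) x₀)‖ < ε := by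
      rw [hNN, mul_assoc, norm_mul, Real.norm_of_nonneg hsN.le, Finset.sum_sub_distrib, mul_sub]
      calc _ ≤ √(N : ℝ) * ((t + c * t) * ‖v‖) := by gcongr; exact q6
        _ ≤ √(N : ℝ) * ((t + c * t) * (2 / m * ‖s‖)) := by gcongr
        _ = (t + c * t) * (2 / m * (√(N : ℝ) * ‖s‖)) := by ring
        _ ≤ (t + c * t) * (2 / m * R) := by gcongr
        _ < ε := ht3
    exact absurd hω (not_le.2 q7)
  calc _ ≤ μ (((((E1 ∪ E2) ∪ E3) ∪ E4) ∪ E5) ∪ E6) := measure_mono_ae hsub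
    _ ≤ (μ E1 + μ E2 + μ E3 + μ E4 + μ E5) + μ E6 := by
      refine (measure_union_le _ _).trans (add_le_add ?_ le_rfl)
      refine (measure_union_le _ _).trans (add_le_add ?_ le_rfl)
      refine (measure_union_le _ _).trans (add_le_add ?_ le_rfl)
      refine (measure_union_le _ _).trans (add_le_add ?_ le_rfl)
      exact measure_union_le _ _
    _ ≤ δ / 2 + δ / 2 := add_le_add hN (hR N)
    _ = δ := ENNReal.add_halves δ

end Sampling

end PartialInterference

namespace PartialInterference

/-! ### Taylor bounds and derivatives of expected estimating functions. -/

section Taylor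

variable {E G : Type*} [NormedAddCommGroup E] [NormedSpace ℝ E] [NormedAddCommGroup G]
  [NormedSpace ℝ G]

/-- Two mean value inequalities: the bound on the second derivative makes the first derivative
Lipschitz, and integration along the segment gives the quadratic remainder. The constant `H` is not
optimal, which is immaterial. -/
theorem taylorBound_of_norm_iteratedFDeriv_le {f : E → G} {x₀ : E} {r H : ℝ}
    (hf : ContDiffOn ℝ 2 f (Metric.ball x₀ r))
    (hH : ∀ x ∈ Metric.ball x₀ r, ‖iteratedFDeriv ℝ 2 f x‖ ≤ H) :
    TaylorBound f x₀ r (fderiv ℝ f x₀) H := by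
  intro x hx
  have hr : 0 < r := dist_nonneg.trans_lt (Metric.mem_ball.1 hx)
  have hx0 : x₀ ∈ Metric.ball x₀ r := Metric.mem_ball_self hr
  have hat : ∀ y ∈ Metric.ball x₀ r, ContDiffAt ℝ 2 f y := fun y hy =>
    hf.contDiffAt (Metric.isOpen_ball.mem_nhds hy)
  have h1 : ∀ y ∈ Metric.ball x₀ r, ‖fderiv ℝ f y - fderiv ℝ f x₀‖ ≤ H * ‖y - x₀‖ := by
    intro y hy
    refine (convex_ball x₀ r).norm_image_sub_le_of_norm_fderiv_le (fun z hz => ?_)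
      (fun z hz => ?_) hx0 hy (𝕜 := ℝ)
    · exact ((hat z hz).fderiv_right (m := 1) (by norm_num)).differentiableAt (by norm_num)
    · rw [← norm_iteratedFDeriv_one, norm_iteratedFDeriv_fderiv]
      exact hH z hz
  have hH0 : 0 ≤ H := (norm_nonneg _).trans (hH x₀ hx0)
  have hseg : segment ℝ x₀ x ⊆ Metric.ball x₀ r := (convex_ball x₀ r).segment_subset hx0 hx
  have h2 := (convex_segment x₀ x).norm_image_sub_le_of_norm_fderiv_le' (𝕜 := ℝ) (f := f)
    (φ := fderiv ℝ f x₀) (C := H * ‖x - x₀‖)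
    (fun y hy => (hat y (hseg hy)).differentiableAt (by norm_num))
    (fun y hy => (h1 y (hseg hy)).trans
      (mul_le_mul_of_nonneg_left (norm_sub_le_of_mem_segment hy) hH0))
    (left_mem_segment ℝ x₀ x) (right_mem_segment ℝ x₀ x)
  rwa [mul_assoc, ← sq] at h2

/-- Composition on the left and on the right, as an operator on linear maps. -/
noncomputable def compBoth {E' G' : Type*} [NormedAddCommGroup E'] [NormedSpace ℝ E']
    [NormedAddCommGroup G'] [NormedSpace ℝ G'] (T : G →L[ℝ] G') (R : E' →L[ℝ] E) :
    (E →L[ℝ] G) →L[ℝ] (E' →L[ℝ] G') :=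
  (ContinuousLinearMap.compL ℝ E' G G' T).comp ((ContinuousLinearMap.compL ℝ E' E G).flip R)

@[simp]
theorem compBoth_apply {E' G' : Type*} [NormedAddCommGroup E'] [NormedSpace ℝ E']
    [NormedAddCommGroup G'] [NormedSpace ℝ G'] (T : G →L[ℝ] G') (R : E' →L[ℝ] E) (L : E →L[ℝ] G)
    (v : E') : compBoth T R L v = T (L (R v)) := rfl

theorem integral_compBoth {E' G' Z : Type*} [NormedAddCommGroup E'] [NormedSpace ℝ E']
    [NormedAddCommGroup G'] [NormedSpace ℝ G'] [CompleteSpace G] [CompleteSpace G']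
    [MeasurableSpace Z] {P : Measure Z} (T : G →L[ℝ] G') (R : E' →L[ℝ] E) {L : Z → E →L[ℝ] G}
    (hL : Integrable L P) : ∫ z, compBoth T R (L z) ∂P = compBoth T R (∫ z, L z ∂P) :=
  (compBoth T R).integral_comp_comm hL

/-- With `θ` held fixed, one expansion of `Ψ` yields those of both `Ψ_β` and `phi` in `β`, by
different choices of `T`. -/
theorem TaylorBound.slice {E' G' : Type*} [NormedAddCommGroup E'] [NormedSpace ℝ E']
    [NormedAddCommGroup G'] [NormedSpace ℝ G'] {f : E × E' → G} {a : E} {b : E'} {r H C : ℝ}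
    {L : E × E' →L[ℝ] G} (h : TaylorBound f (a, b) r L H) (T : G →L[ℝ] G') (hC : ‖T‖ ≤ C) :
    TaylorBound (fun y => T (f (a, y))) b r (compBoth T (ContinuousLinearMap.inr ℝ E E') L)
      (C * H) := by
  intro y hy
  have e1 : (a, y) - (a, b) = ContinuousLinearMap.inr ℝ E E' (y - b) := by simp
  have e2 : ‖(a, y) - (a, b)‖ = ‖y - b‖ := by simp [Prod.norm_def]
  have h1 := h (a, y) (by rw [mem_ball_iff_norm, e2]; exact mem_ball_iff_norm.1 hy)
  rw [e2, e1] at h1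
  rw [compBoth_apply, ← map_sub, ← map_sub, mul_assoc]
  refine (T.le_opNorm _).trans ?_
  exact mul_le_mul hC h1 (norm_nonneg _) ((norm_nonneg _).trans hC)

variable {Z : Type*} [MeasurableSpace Z] {P : Measure Z}

/-- If the expectation of `h` does not change along the direction `v`, the expected derivative of
`h` vanishes in this direction. -/
theorem integral_apply_eq_zero_of_taylorBound {h : Z → E → ℝ} {x₀ : E} {r : ℝ} (hr : 0 < r)
    {L : Z → E →L[ℝ] ℝ} {H : Z → ℝ} (hL : Integrable L P) (hH : Integrable H P)
    (hT : ∀ᵐ z ∂P, TaylorBound (h z) x₀ r (L z) (H z))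
    (hm : ∀ x, AEStronglyMeasurable (fun z => h z x) P) (hi : Integrable (fun z => h z x₀) P)
    {v : E} (hc : ∀ t : ℝ, Integrable (fun z => h z (x₀ + t • v)) P →
      ∫ z, h z (x₀ + t • v) ∂P = ∫ z, h z x₀ ∂P) :
    (∫ z, L z ∂P) v = 0 := by
  have key : ∀ᶠ t : ℝ in 𝓝[>] 0, ‖(∫ z, L z ∂P) v‖ ≤ t * ((∫ z, H z ∂P) * ‖v‖ ^ 2) := by
    have hcont : Tendsto (fun t : ℝ => x₀ + t • v) (𝓝[>] 0) (𝓝 (x₀ + (0 : ℝ) • v)) :=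
      (Continuous.tendsto (by fun_prop) 0).mono_left nhdsWithin_le_nhds
    rw [zero_smul, add_zero] at hcont
    filter_upwards [hcont.eventually (Metric.ball_mem_nhds x₀ hr), self_mem_nhdsWithin]
      with t ht ht0
    have ht0 : 0 < t := ht0
    have hLv : Integrable (fun z => L z (t • v)) P := hL.apply_continuousLinearMap _
    have hb : ∀ᵐ z ∂P, ‖h z (x₀ + t • v) - h z x₀ - L z (t • v)‖ ≤ H z * ‖t • v‖ ^ 2 := by
      filter_upwards [hT] with z hz
      simpa using hz _ ht
    have hrem : Integrable (fun z => h z (x₀ + t • v) - h z x₀ - L z (t • v)) P :=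
      (hH.mul_const _).mono' (((hm _).sub (hm _)).sub hLv.1) hb
    -- The Taylor bound supplies the integrability under which the mean is known not to change.
    -- Dividing by `t` then bounds the derivative by a multiple of `t`.
    have hit : Integrable (fun z => h z (x₀ + t • v)) P := by
      refine ((hrem.add hLv).add hi).congr (ae_of_all _ fun z => ?_)
      simp
    have h1 : ∫ z, (h z (x₀ + t • v) - h z x₀ - L z (t • v)) ∂P = - (t * (∫ z, L z ∂P) v) := by
      have hd : Integrable (fun z => h z (x₀ + t • v) - h z x₀) P := hit.sub hi
      rw [integral_sub hd hLv, integral_sub hit hi, hc t hit,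
        ← ContinuousLinearMap.integral_apply hL, map_smul, smul_eq_mul]
      ring
    have h2 := norm_integral_le_of_norm_le (hH.mul_const _) hb
    rw [h1, norm_neg, norm_mul, Real.norm_of_nonneg ht0.le, integral_mul_const, norm_smul,
      Real.norm_of_nonneg ht0.le] at h2
    refine le_of_mul_le_mul_left (h2.trans (le_of_eq ?_)) ht0
    ring
  have hlim : Tendsto (fun t : ℝ => t * ((∫ z, H z ∂P) * ‖v‖ ^ 2)) (𝓝[>] 0)
      (𝓝 (0 * ((∫ z, H z ∂P) * ‖v‖ ^ 2))) :=
    (Continuous.tendsto (by fun_prop) 0).mono_left nhdsWithin_le_nhds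
  rw [zero_mul] at hlim
  exact norm_le_zero_iff.1 (ge_of_tendsto hlim key)

/-- If the derivative of a map is block triangular and nonsingular, so is its lower right block. -/
theorem exists_lower_bound_of_isUnit {E' : Type*} [NormedAddCommGroup E'] [NormedSpace ℝ E']
    [FiniteDimensional ℝ E'] {D : E × E' →L[ℝ] E × E'} (hD : IsUnit D)
    (h0 : ∀ v, (D (v, 0)).2 = 0) :
    ∃ m : ℝ, 0 < m ∧ ∀ v : E', m * ‖v‖ ≤
      ‖compBoth (ContinuousLinearMap.snd ℝ E E') (ContinuousLinearMap.inr ℝ E E') D v‖ := by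
  set A := compBoth (ContinuousLinearMap.snd ℝ E E') (ContinuousLinearMap.inr ℝ E E') D
  have hsurj : Function.Surjective (A : E' →ₗ[ℝ] E') := by
    intro y
    obtain ⟨u, rfl⟩ := hD
    -- The first component of the preimage of `(0, y)` does not affect the second component of its
    -- image, so the block is surjective. In finite dimension it is then injective and bounded
    -- below.
    set u' := (↑u⁻¹ : E × E' →L[ℝ] E × E') (0, y) with hu'
    have h1 : (u : E × E' →L[ℝ] E × E') u' = (0, y) := by
      rw [hu', ← mul_apply_eq_comp, Units.mul_inv]
      rfl
    refine ⟨u'.2, ?_⟩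
    have h2 : u' = (u'.1, 0) + (0, u'.2) := by simp
    rw [h2, map_add] at h1
    have h3 := congrArg Prod.snd h1
    rw [Prod.snd_add, h0, zero_add] at h3
    exact h3
  obtain ⟨κ, hκ, hA⟩ := LinearMap.exists_antilipschitzWith (A : E' →ₗ[ℝ] E')
    (LinearMap.ker_eq_bot.2 (LinearMap.injective_iff_surjective.2 hsurj))
  refine ⟨(κ : ℝ)⁻¹, by positivity, fun v => ?_⟩
  rw [inv_mul_le_iff₀ (by positivity)]
  simpa using hA.le_mul_dist v 0

end Taylor

end PartialInterference

/-! ### Orthogonality and efficiency of the plug-in estimator. -/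

namespace PartialInterference

variable {K : ℕ} {M d : Fin K → ℕ} {qe qg : ℕ} {P : ProbabilityMeasure (Obs M d)}
  {w : Weights M d} {B : ℝ}
  {e : EuclideanSpace ℝ (Fin qe) → PSFun M d} {g : EuclideanSpace ℝ (Fin qg) → ORFun M d}
  {psiBeta : Obs M d → Nuis qe qg → Nuis qe qg} {Θ : Set (EuclideanSpace ℝ (Fin K))}
  {Be : Set (EuclideanSpace ℝ (Fin qe))} {Bg : Set (EuclideanSpace ℝ (Fin qg))}
  {θs : EuclideanSpace ℝ (Fin K)} {bd : Nuis qe qg} {c : ℝ}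

theorem measurable_phi (hw : ∀ k, BddWeights (w k) B) {f : PSFun M d} {m : ORFun M d}
    (hf : ∀ k a, Measurable (f k a)) (hm : ∀ k a, Measurable (m k a)) :
    Measurable (fun z : Obs M d => phi w f m z.1 z.2) :=
  measurable_of_sigma fun k => show Measurable (aipw (w k) (f k) (m k)) from
    measurable_aipw (hw k).measurable (hf k) (hm k)

/-- The sum of the components of `θ`. -/
noncomputable def sumTheta (K qe qg : ℕ) : Param K qe qg →L[ℝ] ℝ :=
  (∑ k, (EuclideanSpace.proj k : EuclideanSpace ℝ (Fin K) →L[ℝ] ℝ)).comp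
    (ContinuousLinearMap.fst ℝ _ _)

/-- Only the component of the observed type is nonzero. Thus `phi` is, up to a term free of `β`, a
fixed linear image of `Ψ`, and inherits its moments and Taylor bounds. -/
theorem sumTheta_psi (z : Obs M d) (b : Nuis qe qg) :
    sumTheta K qe qg (psi w e g psiBeta z (θs, b)) = phi w (e b.1) (g b.2) z.1 z.2 - θs z.1 := by
  simp [sumTheta, psi, psiTheta]

/-- At the true parameters, the estimating function has mean zero. -/
theorem integral_psi_eq_zero {b : Nuis qe qg} (h : IsNuisance P (e b.1) (g b.2) c)
    (hw : ∀ k, BddWeights (w k) B)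
    (hψ : Integrable (fun z => psiBeta z b) (P : Measure (Obs M d)))
    (hψ0 : ∫ z, psiBeta z b ∂(P : Measure (Obs M d)) = 0) :
    Integrable (fun z => psi w e g psiBeta z (WithLp.toLp 2 (theta w P), b))
        (P : Measure (Obs M d)) ∧
      ∫ z, psi w e g psiBeta z (WithLp.toLp 2 (theta w P), b) ∂(P : Measure (Obs M d)) = 0 := by
  have hk : ∀ k, Integrable (fun z : Obs M d => if z.1 = k then
        phi w (e b.1) (g b.2) z.1 z.2 - theta w P k else 0) (P : Measure (Obs M d)) ∧
      ∫ z : Obs M d, (if z.1 = k then phi w (e b.1) (g b.2) z.1 z.2 - theta w P k else 0)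
        ∂(P : Measure (Obs M d)) = 0 := by
    intro k
    have hi : Integrable (fun z : Obs M d => if z.1 = k then
        phi w (e b.1) (g b.2) z.1 z.2 - theta w P k else 0) (P : Measure (Obs M d)) := by
      have := ((integrable_phi h hw).sub (integrable_const (theta w P k))).indicator
        (measurableSet_type k)
      refine this.congr (ae_of_all _ fun z => ?_)
      simp [Set.indicator_apply]
    refine ⟨hi, ?_⟩
    obtain ⟨h1, h2⟩ := integrable_phi_and_integral_typeMeas h hw k
    rw [integral_eq_sum_typeMeas _ _ hi, Finset.sum_eq_single_of_mem k (Finset.mem_univ k)]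
    · simp only [if_true]
      rw [integral_sub h1 (integrable_const _), h2, integral_const, measureReal_def,
        typeMeas_univ, typeProb, measureReal_def, smul_eq_mul, sub_self]
    · intro l _ hl
      simp [hl]
  have h1 : Integrable (fun z => psiTheta w e g z (WithLp.toLp 2 (theta w P), b))
      (P : Measure (Obs M d)) := Integrable.of_eval_piLp fun k => (hk k).1
  refine ⟨h1.prodMk hψ, ?_⟩
  have h2 := integral_pair h1 hψ
  refine h2.trans ?_
  rw [hψ0]
  refine Prod.ext ?_ rfl
  ext k
  exact (eval_integral_piLp (f := fun z => psiTheta w e g z (WithLp.toLp 2 (theta w P), b))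
    (fun k => (hk k).1) k).trans (hk k).2

/-- The limit of the nuisance estimator is the true parameter. -/
theorem RegularityConditions.true_limit
    (hR : RegularityConditions P w e g psiBeta Θ Be Bg (WithLp.toLp 2 (theta w P)) bd)
    (hP : P ∈ propensityModel e Be ∩ outcomeModel g Bg) (hw : ∀ k, BddWeights (w k) B)
    (hN : ∀ b b', TruePS P e b → TrueOR P g b' → ∃ c, IsNuisance P (e b) (g b') c)
    (hψ : ∀ b : Nuis qe qg, b.1 ∈ Be → b.2 ∈ Bg → TruePS P e b.1 → TrueOR P g b.2 →
      Integrable (fun z => psiBeta z b) (P : Measure (Obs M d)) ∧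
        ∫ z, psiBeta z b ∂(P : Measure (Obs M d)) = 0) :
    TruePS P e bd.1 ∧ TrueOR P g bd.2 := by
  obtain ⟨⟨be, ⟨hbe, hbe'⟩, -⟩, ⟨bg, ⟨hbg, hbg'⟩, -⟩⟩ := hP
  obtain ⟨c, hc⟩ := hN be bg hbe' hbg'
  obtain ⟨h1, h2⟩ := hψ (be, bg) hbe hbg hbe' hbg'
  obtain ⟨h3, h4⟩ := integral_psi_eq_zero (b := (be, bg)) hc hw h1 h2
  -- The true parameters give a zero of the expected estimating function inside the parameter space,
  -- and (R3) allows only one.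
  have h5 := hR.r3_unique _ ⟨hR.r1_mem.1, hbe, hbg⟩ h3 h4
  obtain rfl : (be, bg) = bd := congrArg Prod.snd h5
  exact ⟨hbe', hbg'⟩

theorem RegularityConditions.exists_taylorBound
    (hR : RegularityConditions P w e g psiBeta Θ Be Bg θs bd) :
    ∃ r : ℝ, 0 < r ∧ ∃ H : Obs M d → ℝ, Integrable H (P : Measure (Obs M d)) ∧
      ∀ᵐ z ∂(P : Measure (Obs M d)), DifferentiableAt ℝ (psi w e g psiBeta z) (θs, bd) ∧
        TaylorBound (psi w e g psiBeta z) (θs, bd) r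
          (fderiv ℝ (psi w e g psiBeta z) (θs, bd)) (H z) := by
  obtain ⟨U, hU, H, hH, hUH⟩ := hR.r4
  have hopen : IsOpen (Θ ×ˢ Be ×ˢ Bg) :=
    hR.r1_open.1.prod (hR.r1_open.2.1.prod hR.r1_open.2.2)
  have hmem : (θs, bd) ∈ Θ ×ˢ Be ×ˢ Bg := ⟨hR.r1_mem.1, hR.r1_mem.2⟩
  obtain ⟨r, hr, hball⟩ := Metric.mem_nhds_iff.1 (inter_mem hU (hopen.mem_nhds hmem))
  refine ⟨r, hr, H, hH, ?_⟩
  filter_upwards [hUH, hR.r2] with z hz hz2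
  exact ⟨(hz2.contDiffAt (hopen.mem_nhds hmem)).differentiableAt (by norm_num),
    taylorBound_of_norm_iteratedFDeriv_le (hz2.mono fun x hx => (hball hx).2)
      fun x hx => hz x (hball hx).1⟩

/-- The lower left block of the derivative of the estimating function is zero. -/
theorem snd_fderiv_psi {z : Obs M d}
    (h : DifferentiableAt ℝ (psi w e g psiBeta z) (θs, bd)) (v : EuclideanSpace ℝ (Fin K)) :
    (fderiv ℝ (psi w e g psiBeta z) (θs, bd) (v, 0)).2 = 0 := by
  have h1 : HasFDerivAt (fun θ : EuclideanSpace ℝ (Fin K) => (θ, bd))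
      (ContinuousLinearMap.inl ℝ (EuclideanSpace ℝ (Fin K)) (Nuis qe qg)) θs :=
    (hasFDerivAt_id θs).prodMk (hasFDerivAt_const bd θs)
  have h2 := (hasFDerivAt_snd (𝕜 := ℝ) (p := psi w e g psiBeta z (θs, bd))).comp θs
    (h.hasFDerivAt.comp θs h1)
  have h3 := h2.unique (hasFDerivAt_const (psiBeta z bd) θs)
  have h4 := congrArg (fun L => L v) h3
  simpa using h4

/-- Double robustness: the mean of `φ` stays the same if one of the propensity score and the
outcome regression is replaced by another function. -/
theorem integral_phi_eq {f f' : PSFun M d} {m m' : ORFun M d} (h : IsNuisance P f m c)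
    (hw : ∀ k, BddWeights (w k) B) (hf' : ∀ k a, Measurable (f' k a))
    (hm' : ∀ k a, Measurable (m' k a)) (hor : f' = f ∨ m' = m)
    (hi : Integrable (fun z => phi w f' m' z.1 z.2) (P : Measure (Obs M d))) :
    ∫ z, phi w f' m' z.1 z.2 ∂(P : Measure (Obs M d))
      = ∫ z, phi w f m z.1 z.2 ∂(P : Measure (Obs M d)) := by
  have hi0 := integrable_phi h hw
  rw [integral_eq_sum_typeMeas _ _ hi, integral_eq_sum_typeMeas _ _ hi0]
  have hk := (integrable_iff_typeMeas _ _).1 hi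
  have hk0 := (integrable_iff_typeMeas _ _).1 hi0
  refine Finset.sum_congr rfl fun k _ => ?_
  rcases hor with rfl | rfl
  · exact (h.propensity k).integral_aipw_regression (hw k).measurable (h.regression k).measurable
      (hm' k) (hk0 k) (hk k)
  · exact (h.regression k).integral_aipw_propensity (hw k) (h.propensity k).measurable
      (hf' k) (hk0 k) (hk k)

/-- With both models correct, the plug-in estimator is efficient. -/
theorem RegularityConditions.isEfficientAt {Ω : Type*} [MeasurableSpace Ω] {μ : Measure Ω}
    [IsProbabilityMeasure μ] {D : ℕ → Ω → Obs M d}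
    (hR : RegularityConditions P w e g psiBeta Θ Be Bg θs bd)
    (hD : IsSample μ (P : Measure (Obs M d)) D)
    (he : ∀ b k a, Measurable (e b k a)) (hg : ∀ b k a, Measurable (g b k a))
    (h : IsNuisance P (e bd.1) (g bd.2) c) (hw : ∀ k, BddWeights (w k) B)
    {betaHat : (N : ℕ) → (Fin N → Obs M d) → Nuis qe qg}
    (hβ : IsNuisanceEstimator μ D P e g Be Bg psiBeta betaHat bd)
    {est : (N : ℕ) → (Fin N → Obs M d) → ℝ}
    (hest : ∀ N z, est N z = (N : ℝ)⁻¹ *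
      ∑ i, phi w (e (betaHat N z).1) (g (betaHat N z).2) (z i).1 (z i).2) :
    IsEfficientAt μ D est (tau w vId) P := by
  have hmφ : ∀ b : Nuis qe qg, Measurable fun z : Obs M d => phi w (e b.1) (g b.2) z.1 z.2 :=
    fun b => measurable_phi hw (he b.1) (hg b.2)
  have hφ2 : MemLp (fun z => phi w (e bd.1) (g bd.2) z.1 z.2) 2 (P : Measure (Obs M d)) := by
    have h1 := (sumTheta K qe qg).comp_memLp' hR.r3_memLp
    have h2 : MemLp (fun z : Obs M d => θs z.1) 2 (P : Measure (Obs M d)) :=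
      MemLp.of_bound (measurable_of_sigma (f := fun z : Obs M d => θs z.1)
        fun k => (measurable_const : Measurable fun _ => θs k)).aestronglyMeasurable ‖θs‖
        (ae_of_all _ fun z => PiLp.norm_apply_le θs z.1)
    refine (h1.add h2).congr_norm (hmφ bd).aestronglyMeasurable (ae_of_all _ fun z => ?_)
    simp [sumTheta_psi]
  refine ⟨_, isEfficientInfluenceFunction_phi h hw hφ2, ?_⟩
  obtain ⟨r, hr, H, hH, hT⟩ := hR.exists_taylorBound
  set L : Obs M d → Param K qe qg →L[ℝ] Param K qe qg :=
    fun z => fderiv ℝ (psi w e g psiBeta z) (θs, bd)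
  have hL : Integrable L (P : Measure (Obs M d)) := hR.r3_integrable_deriv
  set C : ℝ := max ‖sumTheta K qe qg‖
    ‖ContinuousLinearMap.snd ℝ (EuclideanSpace ℝ (Fin K)) (Nuis qe qg)‖
  let inr := ContinuousLinearMap.inr ℝ (EuclideanSpace ℝ (Fin K)) (Nuis qe qg)
  let Φ := compBoth (ContinuousLinearMap.snd ℝ (EuclideanSpace ℝ (Fin K)) (Nuis qe qg)) inr
  let Φh := compBoth (sumTheta K qe qg) inr
  have hTψ : ∀ᵐ z ∂(P : Measure (Obs M d)),
      TaylorBound (psiBeta z) bd r (Φ (L z)) (C * H z) := by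
    filter_upwards [hT] with z hz
    exact hz.2.slice (ContinuousLinearMap.snd ℝ _ _) (le_max_right _ _)
  have hTh : ∀ᵐ z ∂(P : Measure (Obs M d)),
      TaylorBound (fun b => phi w (e b.1) (g b.2) z.1 z.2) bd r (Φh (L z)) (C * H z) := by
    filter_upwards [hT] with z hz
    have := hz.2.slice (C := C) (sumTheta K qe qg) (le_max_left _ _)
    intro b hb
    have := this b hb
    simpa only [sumTheta_psi, sub_sub_sub_cancel_right] using this
  have hLψ := Φ.integrable_comp hL
  have hLh := Φh.integrable_comp hL
  have hCH := hH.const_mul C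
  -- Moving `β_g` alone keeps the propensity score correct and moving `β_e` alone keeps the
  -- regression correct. Double robustness makes the mean constant in both cases, and these
  -- directions span all of them.
  have horth : ∫ z, Φh (L z) ∂(P : Measure (Obs M d)) = 0 := by
    have hdir : ∀ v : Nuis qe qg, (v.1 = 0 ∨ v.2 = 0) →
        (∫ z, Φh (L z) ∂(P : Measure (Obs M d))) v = 0 := by
      intro v hv
      refine integral_apply_eq_zero_of_taylorBound hr hLh hCH hTh
        (fun b => (hmφ b).aestronglyMeasurable) (hφ2.integrable (by norm_num)) fun t ht => ?_
      refine integral_phi_eq h hw (he _) (hg _) ?_ ht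
      rcases hv with hv | hv
      · exact Or.inl (by simp [hv])
      · exact Or.inr (by simp [hv])
    ext v
    · exact hdir _ (Or.inr rfl)
    · exact hdir _ (Or.inl rfl)
  -- Since `Ψ_β` does not involve `θ`, the expected derivative is block triangular, and (R3) makes
  -- its `β` block invertible.
  obtain ⟨m, hm, hA⟩ := exists_lower_bound_of_isUnit hR.r3_nonsingular (fun v => by
    have hi : Integrable (fun z => L z (v, 0)) (P : Measure (Obs M d)) :=
      hL.apply_continuousLinearMap _
    rw [ContinuousLinearMap.integral_apply hL]
    have h1 := (ContinuousLinearMap.snd ℝ (EuclideanSpace ℝ (Fin K))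
      (Nuis qe qg)).integral_comp_comm hi
    refine h1.symm.trans (integral_eq_zero_of_ae ?_)
    filter_upwards [hT] with z hz
    exact snd_fderiv_psi hz.1 v)
  have hA' : ∀ v, m * ‖v‖ ≤ ‖(∫ z, Φ (L z) ∂(P : Measure (Obs M d))) v‖ := by
    intro v
    rw [integral_compBoth _ _ hL]
    exact hA v
  have hψ2 : MemLp (fun z => psiBeta z bd) 2 (P : Measure (Obs M d)) :=
    (ContinuousLinearMap.snd ℝ (EuclideanSpace ℝ (Fin K)) (Nuis qe qg)).comp_memLp' hR.r3_memLp
  have hψ0 : ∫ z, psiBeta z bd ∂(P : Measure (Obs M d)) = 0 := by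
    have h1 := (ContinuousLinearMap.snd ℝ (EuclideanSpace ℝ (Fin K))
      (Nuis qe qg)).integral_comp_comm (hR.r3_memLp.integrable (by norm_num))
    rw [hR.r3_zero, map_zero] at h1
    exact h1
  have main := tendstoInMeasure_sub_of_orthogonal hD hr hLψ hLh hCH hTψ hTh hm hA' horth hψ2 hψ0
    hβ.limit hβ.solves
  refine main.congr' (Eventually.of_forall fun N => ae_of_all _ fun ω => ?_)
    (ae_of_all _ fun _ => rfl)
  simp only [hest, Finset.sum_sub_distrib, Finset.sum_const, Finset.card_univ, Fintype.card_fin,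
    nsmul_eq_mul]
  rcases Nat.eq_zero_or_pos N with rfl | hN
  · simp
  have hN' : (0 : ℝ) < N := Nat.cast_pos.2 hN
  have hs : 0 < √(N : ℝ) := Real.sqrt_pos.2 hN'
  have e1 : √(N : ℝ) * √(N : ℝ) = N := Real.mul_self_sqrt hN'.le
  have e2 : √(N : ℝ) * (N : ℝ)⁻¹ = (√(N : ℝ))⁻¹ := by
    rw [eq_comm, eq_mul_inv_iff_mul_eq₀ hN'.ne', inv_mul_eq_iff_eq_mul₀ hs.ne', e1]
  have e3 : (√(N : ℝ))⁻¹ * N = √(N : ℝ) := by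
    rw [inv_mul_eq_iff_eq_mul₀ hs.ne', e1]
  rw [mul_sub, mul_sub, mul_sub, ← mul_assoc, e2, ← mul_assoc, e3]
  ring

end PartialInterference

/-! ### Assembly for weights that are free of the covariates. -/

namespace PartialInterference

variable {K : ℕ} {M d : Fin K → ℕ} {qe qg : ℕ}

/-- There are only finitely many types, treatments and units, so the sum of all absolute weights is
a common bound. -/
theorem exists_bddWeights {w : Weights M d} {w' : (k : Fin K) → Trt (M k) → Out (M k)}
    (hw : ∀ k a x j, w k a x j = w' k a j) : ∃ B, ∀ k, BddWeights (w k) B := by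
  refine ⟨∑ k, ∑ a, ∑ j, |w' k a j|, fun k => ⟨fun a => ?_, fun a x j => ?_⟩⟩
  · have : w k a = fun _ => w' k a := by
      funext x j
      exact hw k a x j
    rw [this]
    exact measurable_const
  · rw [hw]
    calc |w' k a j| ≤ ∑ j, |w' k a j| :=
          Finset.single_le_sum (f := fun j => |w' k a j|) (fun _ _ => abs_nonneg _)
            (Finset.mem_univ j)
      _ ≤ ∑ a, ∑ j, |w' k a j| :=
          Finset.single_le_sum (f := fun a => ∑ j, |w' k a j|)
            (fun _ _ => Finset.sum_nonneg fun _ _ => abs_nonneg _) (Finset.mem_univ a)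
      _ ≤ _ := Finset.single_le_sum (f := fun k => ∑ a, ∑ j, |w' k a j|)
            (fun _ _ => Finset.sum_nonneg fun _ _ => Finset.sum_nonneg fun _ _ => abs_nonneg _)
            (Finset.mem_univ k)

theorem isSample_observe {Ω : Type*} [MeasurableSpace Ω] {μ : Measure Ω}
    {F : ProbabilityMeasure (FullObs M d)} {W : ℕ → Ω → FullObs M d}
    (hW_meas : ∀ i, Measurable (W i)) (hW_indep : iIndepFun W μ)
    (hW_law : ∀ i, μ.map (W i) = (F : Measure (FullObs M d))) :
    IsSample μ (obsLaw F : Measure (Obs M d)) (fun i ω => observe (W i ω)) where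
  measurable i := measurable_observe.comp (hW_meas i)
  indep := hW_indep.comp (fun _ => observe) fun _ => measurable_observe
  law i := by
    rw [obsLaw, ProbabilityMeasure.toMeasure_map, ← hW_law i,
      Measure.map_map measurable_observe (hW_meas i)]
    rfl

/-- Identification of the estimand, and efficiency of the plug-in estimator, for weights that do
not depend on the covariates. -/
theorem IdentifyingAssumptions.tau_eq_and_isEfficientAt {Ω : Type*} [MeasurableSpace Ω]
    {μ : Measure Ω} [IsProbabilityMeasure μ] {F : ProbabilityMeasure (FullObs M d)}
    (hF : IdentifyingAssumptions F) {D : ℕ → Ω → Obs M d}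
    (hD : IsSample μ (obsLaw F : Measure (Obs M d)) D)
    {e : EuclideanSpace ℝ (Fin qe) → PSFun M d} {g : EuclideanSpace ℝ (Fin qg) → ORFun M d}
    (he : ∀ b k a, Measurable (e b k a)) (hg : ∀ b k a, Measurable (g b k a))
    {Be : Set (EuclideanSpace ℝ (Fin qe))} {Bg : Set (EuclideanSpace ℝ (Fin qg))}
    (hP : obsLaw F ∈ propensityModel e Be ∩ outcomeModel g Bg)
    {psiBeta : Obs M d → Nuis qe qg → Nuis qe qg}
    {betaHat : (N : ℕ) → (Fin N → Obs M d) → Nuis qe qg} {bd : Nuis qe qg}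
    (hβ : IsNuisanceEstimator μ D (obsLaw F) e g Be Bg psiBeta betaHat bd)
    {w : Weights M d} {w' : (k : Fin K) → Trt (M k) → Out (M k)}
    (hw : ∀ k a x j, w k a x j = w' k a j) {Θ : Set (EuclideanSpace ℝ (Fin K))}
    (hR : RegularityConditions (obsLaw F) w e g psiBeta Θ Be Bg
      (WithLp.toLp 2 (theta w (obsLaw F))) bd)
    {est : (N : ℕ) → (Fin N → Obs M d) → ℝ}
    (hest : ∀ N z, est N z = (N : ℝ)⁻¹ *
      ∑ i, phi w (e (betaHat N z).1) (g (betaHat N z).2) (z i).1 (z i).2) :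
    tau w vId (obsLaw F) = ∫ z, ∑ a, ∑ j, w' z.1 a j * z.2.1 a j ∂(F : Measure (FullObs M d)) ∧
      IsEfficientAt μ D est (tau w vId) (obsLaw F) := by
  obtain ⟨B, hB⟩ := exists_bddWeights hw
  obtain ⟨hbe, hbg⟩ := hR.true_limit hP hB
    (fun b b' hb hb' => hF.exists_isNuisance he hb hg hb') hβ.unbiased
  obtain ⟨c, hc⟩ := hF.exists_isNuisance he hbe hg hbg
  exact ⟨hF.tau_eq he hbe hw, hR.isEfficientAt hD he hg hc hB hβ hest⟩

end PartialInterference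

theorem corollary1 {K : ℕ} {M d : Fin K → ℕ} {qe qg : ℕ}
    {Ω : Type*} [MeasurableSpace Ω] (μ : Measure Ω)
    [IsProbabilityMeasure μ]
    -- independent clusters, with full data drawn from the law `F`
    (F : ProbabilityMeasure (FullObs M d))
    (W : ℕ → Ω → FullObs M d)
    (hW_meas : ∀ i, Measurable (W i))
    (hW_indep : iIndepFun W μ)
    (hW_law : ∀ i, μ.map (W i) = (F : Measure (FullObs M d)))
    (hF : IdentifyingAssumptions F)
    -- parametric working models, both correctly specified
    (e : EuclideanSpace ℝ (Fin qe) → PSFun M d)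
    (g : EuclideanSpace ℝ (Fin qg) → ORFun M d)
    (he_meas : ∀ b k a, Measurable (e b k a))
    (hg_meas : ∀ b k a, Measurable (g b k a))
    (Be : Set (EuclideanSpace ℝ (Fin qe))) (Bg : Set (EuclideanSpace ℝ (Fin qg)))
    (hP : obsLaw F ∈
      propensityModel e Be ∩ outcomeModel g Bg)
    -- the estimator of the nuisance parameters
    (psiBeta : Obs M d →
      Nuis qe qg → Nuis qe qg)
    (betaHat : (N : ℕ) → (Fin N → Obs M d) → Nuis qe qg)
    (betaDagger : Nuis qe qg)
    (hbeta : IsNuisanceEstimator μ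
      (fun i ω => observe (W i ω)) (obsLaw F)
      e g Be Bg psiBeta betaHat betaDagger)
    -- the nuisance estimates in the estimator of Liu et al. are the same
    (fHat : (N : ℕ) → (Fin N → Obs M d) → PSFun M d)
    (mHat : (N : ℕ) → (Fin N → Obs M d) → ORFun M d)
    (hfHat : ∀ N z k a x, fHat N z k a x = e (betaHat N z).1 k a x)
    (hmHat : ∀ N z k a x j, mHat N z k a x j = g (betaHat N z).2 k a x j)
    (α α' : ℝ) (hα : α ∈ Set.Ioo (0 : ℝ) 1) (hα' : α' ∈ Set.Ioo (0 : ℝ) 1) :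
    -- the estimators coincide with the plug-in estimators
    (∀ (N : ℕ) (z : Fin N → Obs M d) (t : ℝ),
      IsPlugInEstimate (weightDE α)
        vId e g z (betaHat N z) t ↔
      t = liuDE (fHat N z) (mHat N z) α z) ∧
    (∀ (N : ℕ) (z : Fin N → Obs M d) (t : ℝ),
      IsPlugInEstimate (weightIE α α')
        vId e g z (betaHat N z) t ↔
      t = liuIE (fHat N z) (mHat N z) α α' z) ∧
    -- the estimator of the direct effect is locally efficient
    ((∃ Θ, RegularityConditions (obsLaw F)
        (weightDE α) e g psiBeta Θ Be Bg
        (WithLp.toLp 2 (theta (weightDE α)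
          (obsLaw F))) betaDagger) →
      tau (weightDE α) vId
          (obsLaw F) = directEffect F α ∧
      IsEfficientAt μ (fun i ω => observe (W i ω))
        (fun N z => liuDE (fHat N z) (mHat N z) α z)
        (tau (weightDE α) vId)
        (obsLaw F)) ∧
    -- the estimator of the indirect effect is locally efficient
    ((∃ Θ, RegularityConditions (obsLaw F)
        (weightIE α α') e g psiBeta Θ Be Bg
        (WithLp.toLp 2 (theta (weightIE α α')
          (obsLaw F))) betaDagger) →
      tau (weightIE α α') vId
          (obsLaw F) = indirectEffect F α α' ∧
      IsEfficientAt μ (fun i ω => observe (W i ω))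
        (fun N z => liuIE (fHat N z) (mHat N z) α α' z)
        (tau (weightIE α α') vId)
        (obsLaw F)) := by 
  have hf : ∀ N z, fHat N z = e (betaHat N z).1 := fun N z => by
    funext k a x
    exact hfHat N z k a x
  have hm : ∀ N z, mHat N z = g (betaHat N z).2 := fun N z => by
    funext k a x j
    exact hmHat N z k a x j
  have hD := isSample_observe hW_meas hW_indep hW_law
  refine ⟨fun N z t => ?_, fun N z t => ?_, ?_, ?_⟩
  · rw [isPlugInEstimate_iff, liuDE_eq, hf, hm]
  · rw [isPlugInEstimate_iff, liuIE_eq, hf, hm]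
  · rintro ⟨Θ, hR⟩
    obtain ⟨h1, h2⟩ := hF.tau_eq_and_isEfficientAt hD he_meas hg_meas hP hbeta (w := weightDE α)
      (w' := fun k a j => weightDE (M := M) (d := d) α k a 0 j) (fun _ _ _ _ => rfl) hR
      (est := fun N z => liuDE (fHat N z) (mHat N z) α z) (fun N z => by rw [liuDE_eq, hf, hm])
    refine ⟨h1.trans (integral_congr_ae (ae_of_all _ fun z => ?_)), h2⟩
    exact (clusterAverage_sub_eq_weightDE (d := d) α z.1 0 z.2.1).symm
  · rintro ⟨Θ, hR⟩
    obtain ⟨h1, h2⟩ := hF.tau_eq_and_isEfficientAt hD he_meas hg_meas hP hbeta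
      (w := weightIE α α')
      (w' := fun k a j => weightIE (M := M) (d := d) α α' k a 0 j) (fun _ _ _ _ => rfl) hR
      (est := fun N z => liuIE (fHat N z) (mHat N z) α α' z) (fun N z => by rw [liuIE_eq, hf, hm])
    refine ⟨h1.trans (integral_congr_ae (ae_of_all _ fun z => ?_)), h2⟩
    exact (clusterAverage_sub_eq_weightIE (d := d) α α' z.1 0 z.2.1).symm
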